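/- **Setting.** Let $\xi(x)=\sum_{p\ge 2}\beta_p^2x^p$ with real $\beta_p$ such that $\sum_{p\ge2}p\,\beta_p^2<\infty$ (for instance $|\beta_p|\le p^{-2}$), so that $\xi'(x)=\sum_{p\ge2}p\beta_p^2x^{p-1}$ on $[0,1]$. Let $C>0$, let $n,k\ge 0$ be integers and let $E=(e_{l,i})_{l\le k,\,i\le n}$ be non-negative integers. A probability measure $\zeta$ on $[0,1]$ satisfies *finite RSB* if its support is a finite set $q_0<q_1<\dots<q_r$; put $q_*=q_r$. For such a $\zeta$, let $(w_\alpha)_{\alpha\in\mathbb N^r}$ be the weights of the Ruelle probability cascade with overlap distribution $\zeta$: for every vertex $b$ of depth $p<r$ of the tree $\bigcup_{p\le r}\mathbb N^p$ let $u_{b0}>u_{b1}>\dots$ be the decreasingly ordered points of a Poisson process on $(0,\infty)$ with intensity $m x^{-1-m}dx$, $m=\zeta([0,q_p])$, independently over $b$, and let $w_\alpha=v_\alpha/\sum_\gamma v_\gamma$ with $v_\alpha$ the product of the $u$'s along the path from the root to $\alpha$. The overlap of two leaves is $\langle h_\alpha,h_\gamma\rangle=q_{\alpha\wedge\gamma}$,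 where $\alpha\wedge\gamma$ is the depth of the last common vertex of their paths. Let $Y^1,\dots,Y^n,Z^1,\dots,Z^n$ be independent centred Gaussian processes on the leaves, independent of the weights, with $$\mathrm{Cov}(Y^i(h_\alpha),Y^i(h_\gamma))=\langle h_\alpha,h_\gamma\rangle\,\xi'(\langle h_\alpha,h_\gamma\rangle),\qquad \mathrm{Cov}(Z^i(h_\alpha),Z^i(h_\gamma))=\xi'(\langle h_\alpha,h_\gamma\rangle).$$ For real $R$ put $$U^R_\zeta(y,z,s)=-\tfrac12 s^2\bigl[1+\xi'(q_*)(1-q_*)\bigr]+zs+y\Bigl[\sqrt{R^2+1}-\tfrac{s^2}{2\sqrt{R^2+1}}\Bigr]+\tfrac{(\xi'(1)-q_*\xi'(q_*))s^4}{4(R^2+1)},$$ $$F^{R,C,E}(\zeta)=\mathbb E\prod_{l=1}^k\frac{\sum_\alpha w_\alpha\prod_{i=1}^n\int_{-C}^Cs_i^{e_{l,i}}e^{U^R_\zeta(Y^i(h_\alpha),Z^i(h_\alpha),s_i)}\,ds_i}{\sum_\alpha w_\alpha\prod_{i=1}^n\int_{-C}^Ce^{U^R_\zeta(Y^i(h_\alpha),Z^i(h_\alpha),s_i)}\,ds_i},$$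 $$F^{C,E}(\zeta)=\mathbb E\prod_{l=1}^k\frac{\sum_\alpha w_\alpha\prod_{i=1}^n\int_{-C}^Cs_i^{e_{l,i}}e^{-\frac12s_i^2[1+\hat S_\zeta]+Z^i(h_\alpha)s_i}\,ds_i}{\sum_\alpha w_\alpha\prod_{i=1}^n\int_{-C}^Ce^{-\frac12s_i^2[1+\hat S_\zeta]+Z^i(h_\alpha)s_i}\,ds_i},$$ $$\hat S_\zeta=\xi'(q_*)(1-q_*)+\sum_{p=1}^r\bigl(q_p\xi'(q_p)-q_{p-1}\xi'(q_{p-1})\bigr)\zeta([0,q_{p-1}]).$$ **Lemma.** For every $\zeta$ satisfying finite RSB, all these series converge almost surely, the denominators are almost surely positive, the expectations exist, and $$\lim_{R\to\infty}F^{R,C,E}(\zeta)=F^{C,E}(\zeta).$$ Moreover, if $(\zeta_j)_{j\ge0}$ is a sequence of probability measures satisfying finite RSB that converges weakly to some probability measure $\zeta^*$ on $[0,1]$, then the limit is uniform along the sequence: $\sup_j\bigl|F^{R,C,E}(\zeta_j)-F^{C,E}(\zeta_j)\bigr|\to0$ as $R\to\infty$. -/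

import Mathlib

open MeasureTheory ProbabilityTheory Filter Topology

namespace SphericalCascade

noncomputable section

/-! ### The covariance function of the model -/

/-- `ξ(x) = ∑_{p ≥ 2} β_p² x^p`. -/
def xi (β : ℕ → ℝ) (x : ℝ) : ℝ := ∑' p : ℕ, β (p + 2) ^ 2 * x ^ (p + 2)

/-- `ξ'(x) = ∑_{p ≥ 2} p β_p² x^(p-1)`, the derivative of `ξ` on `[0,1]`
(one-sided at the end points), see `hasDerivWithinAt_xi`. -/
def xiDeriv (β : ℕ → ℝ) (x : ℝ) : ℝ :=
  ∑' p : ℕ, ((p : ℝ) + 2) * β (p + 2) ^ 2 * x ^ (p + 1)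

/-- The covariance function `x ↦ x ξ'(x)` of the fields `Y`. -/
def thetaY (β : ℕ → ℝ) (x : ℝ) : ℝ := x * xiDeriv β x

/-! ### Overlap distributions with finite replica symmetry breaking -/

/-- A probability measure `ζ` on `[0,1]` whose support is a finite set `q 0 < q 1 < ⋯ < q r`. -/
structure FiniteRSB where
  /-- the overlap distribution -/
  ζ : ProbabilityMeasure unitInterval
  /-- the number of levels of the cascade -/
  r : ℕ
  /-- the points of the support, in increasing order -/
  q : Fin (r + 1) → unitInterval
  strictMono_q : StrictMono q
  support_eq : (ζ : Measure unitInterval).support = Set.range q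

namespace FiniteRSB

variable (S : FiniteRSB)

/-- `ζ([0, q_p])`. -/
def cdf (p : Fin (S.r + 1)) : ℝ := (S.ζ : Measure unitInterval).real (Set.Iic (S.q p))

/-- `q_* = q_r`, the largest point of the support. -/
def qStar : ℝ := (S.q (Fin.last S.r) : ℝ)

/-- `Ŝ_ζ = ξ'(q_*)(1 - q_*) + ∑_{p=1}^r (q_p ξ'(q_p) - q_{p-1} ξ'(q_{p-1})) ζ([0, q_{p-1}])`. -/
def sHat (β : ℕ → ℝ) : ℝ :=
  xiDeriv β S.qStar * (1 - S.qStar) +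
    ∑ p : Fin S.r, ((S.q p.succ : ℝ) * xiDeriv β (S.q p.succ) -
      (S.q p.castSucc : ℝ) * xiDeriv β (S.q p.castSucc)) * S.cdf p.castSucc

end FiniteRSB

/-! ### The probability space

The vertices of the infinitary tree are the finite sequences of natural numbers: the root is `[]`,
and the children of `b` are `b ++ [0], b ++ [1], …`. The probability space carries independent
variables: a standard exponential one for every vertex, and, for every vertex and every
`i : Fin n`, two standard Gaussian ones (one for `Y^i`, the other for `Z^i`). -/

instance instIsProbabilityMeasureExp : IsProbabilityMeasure (expMeasure 1) :=
  isProbabilityMeasure_expMeasure one_pos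

/-- Sample space: exponential variables, Gaussian variables for `Y`, Gaussian variables for `Z`. -/
abbrev Sample (n : ℕ) : Type :=
  (List ℕ → ℝ) × (List ℕ × Fin n → ℝ) × (List ℕ × Fin n → ℝ)

/-- The law of the independent family of variables. -/
def sampleLaw (n : ℕ) : Measure (Sample n) :=
  (Measure.infinitePi fun _ : List ℕ => expMeasure 1).prod
    ((Measure.infinitePi fun _ : List ℕ × Fin n => gaussianReal 0 1).prod
      (Measure.infinitePi fun _ : List ℕ × Fin n => gaussianReal 0 1))

/-! ### The Ruelle probability cascade -/

/-- The vertex at depth `p` on the path from the root to the leaf `α`. -/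
def anc {r : ℕ} (α : Fin r → ℕ) (p : ℕ) : List ℕ := (List.ofFn α).take p

/-- `Γ_j = E_0 + ⋯ + E_j`, where `E_k` is the exponential variable of the `k`-th child of `b`: these
are the arrival times of a Poisson process of rate one on `(0, ∞)`. Hence, for `0 < m < 1`, the
points `Γ_j ^ (-1/m)` are a Poisson process on `(0, ∞)` with intensity `m x^(-1-m) dx`, listed
in decreasing order. -/
def arrival (E : List ℕ → ℝ) (b : List ℕ) (j : ℕ) : ℝ :=
  ∑ k ∈ Finset.range (j + 1), E (b ++ [k])

/-- The unnormalized weight `v_α` of a leaf `α`: the product, along the path from the root to `α`,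
of points of Poisson processes, that of the vertices at depth `p` having intensity
`m x^(-1-m) dx` with `m = ζ([0, q_p])`. -/
def rawWeight (S : FiniteRSB) (E : List ℕ → ℝ) (α : Fin S.r → ℕ) : ℝ :=
  ∏ p : Fin S.r, arrival E (anc α p) (α p) ^ (-1 / S.cdf p.castSucc)

/-- The weight `w_α` of the leaf `α` in the Ruelle probability cascade. -/
def weight (S : FiniteRSB) (E : List ℕ → ℝ) (α : Fin S.r → ℕ) : ℝ :=
  rawWeight S E α / ∑' γ : Fin S.r → ℕ, rawWeight S E γ

/-! ### Gaussian fields on the cascade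

For a nondecreasing function `f ≥ 0` on `[0,1]` this is the centred Gaussian field on the leaves
with covariance `f(q_{α ∧ γ})`, where `α ∧ γ` is the depth of the last common vertex of
the paths to `α` and `γ`, and so `q_{α ∧ γ} = ⟨h_α, h_γ⟩` is the overlap of `α` and `γ`,
see `integral_field_mul_field`. -/

/-- The field at the leaf `α`, as a sum over the vertices on the path from the root to `α`. -/
def field (S : FiniteRSB) (f : ℝ → ℝ) (g : List ℕ → ℝ) (α : Fin S.r → ℕ) : ℝ :=
  √(f (S.q 0)) * g (anc α 0) +
    ∑ p : Fin S.r, √(f (S.q p.succ) - f (S.q p.castSucc)) * g (anc α (p + 1))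

/-- `Y^i(h_α)`, with covariance `x ξ'(x)` at `x = ⟨h_α, h_γ⟩`. -/
def fieldY {n : ℕ} (β : ℕ → ℝ) (S : FiniteRSB) (ω : Sample n) (i : Fin n) (α : Fin S.r → ℕ) : ℝ :=
  field S (thetaY β) (fun b => ω.2.1 (b, i)) α

/-- `Z^i(h_α)`, with covariance `ξ'(x)` at `x = ⟨h_α, h_γ⟩`. -/
def fieldZ {n : ℕ} (β : ℕ → ℝ) (S : FiniteRSB) (ω : Sample n) (i : Fin n) (α : Fin S.r → ℕ) : ℝ :=
  field S (xiDeriv β) (fun b => ω.2.2 (b, i)) α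

/-! ### The cascade functionals

`U y z s` is the exponent of the weight of a spin `s` when `Y^i = y` and `Z^i = z`. -/

/-- The terms of the numerator:
`w_α ∏_i ∫_{-C}^C s^{e_i} exp(U(Y^i(h_α), Z^i(h_α), s)) ds`. For `e = 0` these are the terms
of the denominator. -/
def cascadeTerm {n : ℕ} (β : ℕ → ℝ) (C : ℝ) (U : ℝ → ℝ → ℝ → ℝ) (S : FiniteRSB) (e : Fin n → ℕ)
    (ω : Sample n) (α : Fin S.r → ℕ) : ℝ :=
  weight S ω.1 α *
    ∏ i, ∫ s in (-C)..C, s ^ e i * Real.exp (U (fieldY β S ω i α) (fieldZ β S ω i α) s)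

/-- The cascade average of `∏_i s_i^{e_i}`. -/
def cascadeAverage {n : ℕ} (β : ℕ → ℝ) (C : ℝ) (U : ℝ → ℝ → ℝ → ℝ) (S : FiniteRSB)
    (e : Fin n → ℕ) (ω : Sample n) : ℝ :=
  (∑' α, cascadeTerm β C U S e ω α) / ∑' α, cascadeTerm β C U S 0 ω α

/-- The expectation of the product over the replicas `l` of the cascade averages of
`∏_i s_i^{e_{l,i}}`. -/
def cascadeMoment {n k : ℕ} (β : ℕ → ℝ) (C : ℝ) (U : ℝ → ℝ → ℝ → ℝ) (S : FiniteRSB)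
    (e : Fin k → Fin n → ℕ) : ℝ :=
  ∫ ω, ∏ l, cascadeAverage β C U S (e l) ω ∂(sampleLaw n)

/-- All series in `cascadeMoment` converge almost surely, the denominators are almost surely
positive, and the expectation exists. -/
structure WellDefined {n k : ℕ} (β : ℕ → ℝ) (C : ℝ) (U : ℝ → ℝ → ℝ → ℝ) (S : FiniteRSB)
    (e : Fin k → Fin n → ℕ) : Prop where
  weights : ∀ᵐ ω ∂(sampleLaw n), Summable (rawWeight S ω.1) ∧ 0 < ∑' α, rawWeight S ω.1 α
  numerators : ∀ l, ∀ᵐ ω ∂(sampleLaw n), Summable (cascadeTerm β C U S (e l) ω)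
  denominator : ∀ᵐ ω ∂(sampleLaw n), Summable (cascadeTerm β C U S 0 ω) ∧
    0 < ∑' α, cascadeTerm β C U S 0 ω α
  integrable : Integrable (fun ω => ∏ l, cascadeAverage β C U S (e l) ω) (sampleLaw n)

/-- The exponent in `F^{R,C,E}(ζ)`. -/
def exponentR (β : ℕ → ℝ) (R : ℝ) (S : FiniteRSB) (y z s : ℝ) : ℝ :=
  -(1 / 2) * s ^ 2 * (1 + xiDeriv β S.qStar * (1 - S.qStar)) + z * s
    + y * (√(R ^ 2 + 1) - s ^ 2 / (2 * √(R ^ 2 + 1)))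
    + (xiDeriv β 1 - S.qStar * xiDeriv β S.qStar) * s ^ 4 / (4 * (R ^ 2 + 1))

/-- The exponent in the limit `F^{C,E}(ζ)`; it does not involve the fields `Y^i`. -/
def exponentLim (β : ℕ → ℝ) (S : FiniteRSB) (_y z s : ℝ) : ℝ :=
  -(1 / 2) * s ^ 2 * (1 + S.sHat β) + z * s

/-- The functional `F^{R,C,E}(ζ)`. -/
def F {n k : ℕ} (β : ℕ → ℝ) (C : ℝ) (e : Fin k → Fin n → ℕ) (R : ℝ) (S : FiniteRSB) : ℝ :=
  cascadeMoment β C (exponentR β R S) S e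

/-- The limiting functional `F^{C,E}(ζ)`. -/
def FLim {n k : ℕ} (β : ℕ → ℝ) (C : ℝ) (e : Fin k → Fin n → ℕ) (S : FiniteRSB) : ℝ :=
  cascadeMoment β C (exponentLim β S) S e

/-! ### Two facts that identify the objects above -/

theorem hasDerivWithinAt_xi {β : ℕ → ℝ}
    (hβ : Summable fun p : ℕ => ((p : ℝ) + 2) * β (p + 2) ^ 2) {x : ℝ} (hx : x ∈ Set.Icc (0 : ℝ) 1) :
    HasDerivWithinAt (xi β) (xiDeriv β x) (Set.Icc 0 1) x := by
  have hsum : ∀ y ∈ Set.Icc (0 : ℝ) 1, Summable fun p : ℕ => β (p + 2) ^ 2 * y ^ (p + 2) := by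
    intro y hy
    refine Summable.of_nonneg_of_le (fun p => ?_) (fun p => ?_) hβ
    · exact mul_nonneg (sq_nonneg _) (pow_nonneg hy.1 _)
    · have h1 : y ^ (p + 2) ≤ 1 := pow_le_one₀ hy.1 hy.2
      have h2 := sq_nonneg (β (p + 2))
      have h3 : (0 : ℝ) ≤ p := Nat.cast_nonneg p
      nlinarith [mul_nonneg h3 h2, mul_le_mul_of_nonneg_left h1 h2]
  rw [hasDerivWithinAt_iff_tendsto_slope]
  have key : Tendsto (fun y => ∑' p : ℕ, β (p + 2) ^ 2 * slope (fun t : ℝ => t ^ (p + 2)) x y)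
      (𝓝[Set.Icc (0 : ℝ) 1 \ {x}] x) (𝓝 (xiDeriv β x)) := by
    refine tendsto_tsum_of_dominated_convergence hβ (fun p => ?_) ?_
    · have h := (hasDerivAt_pow (p + 2) x).hasDerivWithinAt (s := Set.Icc (0 : ℝ) 1)
      rw [hasDerivWithinAt_iff_tendsto_slope] at h
      have h' := h.const_mul (β (p + 2) ^ 2)
      convert h' using 2
      push_cast
      ring
    · filter_upwards [self_mem_nhdsWithin] with y hy p
      have hb : |slope (fun t : ℝ => t ^ (p + 2)) x y| ≤ (p : ℝ) + 2 := by
        have hyx : y - x ≠ 0 := sub_ne_zero.mpr hy.2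
        rw [slope_def_field, ← (Commute.all y x).geom_sum₂_mul, mul_div_assoc, div_self hyx, mul_one]
        refine (Finset.abs_sum_le_sum_abs _ _).trans ?_
        refine (Finset.sum_le_card_nsmul _ _ 1 fun i _ => ?_).trans (by simp)
        rw [abs_mul, abs_pow, abs_pow, abs_of_nonneg hy.1.1, abs_of_nonneg hx.1]
        exact mul_le_one₀ (pow_le_one₀ hy.1.1 hy.1.2) (pow_nonneg hx.1 _)
          (pow_le_one₀ hx.1 hx.2)
      rw [Real.norm_eq_abs, abs_mul, abs_of_nonneg (sq_nonneg _), mul_comm]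
      exact mul_le_mul_of_nonneg_right hb (sq_nonneg _)
  refine key.congr' ?_
  filter_upwards [self_mem_nhdsWithin] with y hy
  rw [slope_def_field, xi, xi, ← (hsum y hy.1).tsum_sub (hsum x hx), ← tsum_div_const]
  refine tsum_congr fun p => ?_
  rw [slope_def_field]
  ring

theorem integral_coord_mul_coord {ι : Type*} (a b : ι) [Decidable (a = b)] :
    Integrable (fun g : ι → ℝ => g a * g b) (Measure.infinitePi fun _ : ι => gaussianReal 0 1) ∧
    ∫ g : ι → ℝ, g a * g b ∂(Measure.infinitePi fun _ : ι => gaussianReal 0 1) =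
      if a = b then 1 else 0 := by
  have hmp := fun c : ι => measurePreserving_eval_infinitePi (fun _ : ι => gaussianReal 0 1) c
  have hL2 : ∀ c : ι, MemLp (fun g : ι → ℝ => g c) 2
      (Measure.infinitePi fun _ : ι => gaussianReal 0 1) := fun c =>
    (memLp_id_gaussianReal 2).comp_measurePreserving (hmp c)
  have h1 : ∀ c : ι, ∫ g : ι → ℝ, g c ∂(Measure.infinitePi fun _ : ι => gaussianReal 0 1) = 0 := by
    intro c
    have h := (hmp c).map_eq
    have h2 := integral_map (μ := Measure.infinitePi fun _ : ι => gaussianReal 0 1)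
      (φ := Function.eval c) (hmp c).measurable.aemeasurable (f := fun x : ℝ => x)
      measurable_id.aestronglyMeasurable
    rw [h, integral_id_gaussianReal] at h2
    exact h2.symm
  refine ⟨(hL2 a).integrable_mul (hL2 b), ?_⟩
  split_ifs with hab
  · subst hab
    have h := (hmp a).map_eq
    have h2 := integral_map (μ := Measure.infinitePi fun _ : ι => gaussianReal 0 1)
      (φ := Function.eval a) (hmp a).measurable.aemeasurable (f := fun x : ℝ => x * x)
      (measurable_id.mul measurable_id).aestronglyMeasurable
    rw [h] at h2
    have h3 := variance_fun_id_gaussianReal (μ := 0) (v := 1)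
    rw [variance_eq_integral (by fun_prop), integral_id_gaussianReal] at h3
    simp only [sub_zero, NNReal.coe_one, pow_two] at h3
    exact h2.symm.trans h3
  · have hind := (iIndepFun_infinitePi (P := fun _ : ι => gaussianReal 0 1)
      (X := fun _ x => x) (fun _ => measurable_id)).indepFun hab
    have h := hind.integral_fun_mul_eq_mul_integral (hL2 a).1 (hL2 b).1
    rw [h1, h1, mul_zero] at h
    exact h

theorem integral_field_mul_field {n : ℕ} (S : FiniteRSB) (f : ℝ → ℝ) (h0 : 0 ≤ f (S.q 0))
    (hf : ∀ p : Fin S.r, f (S.q p.castSucc) ≤ f (S.q p.succ)) (i j : Fin n) (α γ : Fin S.r → ℕ)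
    (d : Fin (S.r + 1)) (hd : ∀ p : Fin (S.r + 1), anc α p = anc γ p ↔ p ≤ d) :
    ∫ g : List ℕ × Fin n → ℝ, field S f (fun b => g (b, i)) α * field S f (fun b => g (b, j)) γ
      ∂(Measure.infinitePi fun _ => gaussianReal 0 1) = if i = j then f (S.q d) else 0 := by
  classical
  obtain ⟨c, hc0, hc⟩ : ∃ c : Fin (S.r + 1) → ℝ, c 0 = √(f (S.q 0)) ∧
      ∀ p : Fin S.r, c p.succ = √(f (S.q p.succ) - f (S.q p.castSucc)) :=
    ⟨Fin.cons (√(f (S.q 0))) fun p => √(f (S.q p.succ) - f (S.q p.castSucc)), rfl, fun p => rfl⟩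
  have hfield : ∀ (g : List ℕ → ℝ) (δ : Fin S.r → ℕ),
      field S f g δ = ∑ p : Fin (S.r + 1), c p * g (anc δ p) := by
    intro g δ
    rw [Fin.sum_univ_succ, hc0]
    simp [field, hc]
  have hlen : ∀ (δ : Fin S.r → ℕ) (p : Fin (S.r + 1)), (anc δ p).length = p := by
    intro δ p
    simp [anc, Nat.lt_succ_iff.mp p.2]
  have hint : ∀ p p' : Fin (S.r + 1), Integrable
      (fun g : List ℕ × Fin n → ℝ => c p * g (anc α p, i) * (c p' * g (anc γ p', j)))
      (Measure.infinitePi fun _ => gaussianReal 0 1) := by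
    intro p p'
    refine ((integral_coord_mul_coord (anc α p, i) (anc γ p', j)).1.const_mul (c p * c p')).congr
      (Eventually.of_forall fun g => ?_)
    ring
  simp_rw [hfield, Finset.sum_mul_sum]
  rw [integral_finsetSum _ fun p _ => integrable_finsetSum _ fun p' _ => hint p p']
  have hterm : ∀ p : Fin (S.r + 1), ∫ g : List ℕ × Fin n → ℝ,
      ∑ p', c p * g (anc α p, i) * (c p' * g (anc γ p', j))
        ∂(Measure.infinitePi fun _ => gaussianReal 0 1) =
      if i = j then (if p ≤ d then c p ^ 2 else 0) else 0 := by
    intro p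
    rw [integral_finsetSum _ fun p' _ => hint p p', Finset.sum_eq_single p]
    · have h2 : ∀ g : List ℕ × Fin n → ℝ, c p * g (anc α p, i) * (c p * g (anc γ p, j)) =
          c p ^ 2 * (g (anc α p, i) * g (anc γ p, j)) := fun g => by ring
      simp_rw [h2]
      rw [integral_const_mul, (integral_coord_mul_coord _ _).2]
      simp only [Prod.mk.injEq, hd]
      by_cases hij : i = j <;> by_cases hpd : p ≤ d <;> simp [hij, hpd]
    · intro p' _ hp'
      have h2 : ∀ g : List ℕ × Fin n → ℝ, c p * g (anc α p, i) * (c p' * g (anc γ p', j)) =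
          (c p * c p') * (g (anc α p, i) * g (anc γ p', j)) := fun g => by ring
      simp_rw [h2]
      rw [integral_const_mul, (integral_coord_mul_coord _ _).2, if_neg, mul_zero]
      intro h
      apply hp'
      have h3 := congrArg List.length (Prod.mk.inj h).1
      rw [hlen, hlen] at h3
      exact Fin.ext h3.symm
    · simp
  rw [Finset.sum_congr rfl fun p _ => hterm p]
  split_ifs with hij
  · clear hterm hint hd
    induction d using Fin.induction with
    | zero =>
      rw [Finset.sum_eq_single 0]
      · simp [hc0, Real.sq_sqrt h0]
      · intro p _ hp
        rw [if_neg (fun h => hp (Fin.le_zero_iff.mp h))]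
      · simp
    | succ d ih =>
      have h4 : ∀ p : Fin (S.r + 1), (if p ≤ d.succ then c p ^ 2 else 0) =
          (if p ≤ d.castSucc then c p ^ 2 else 0) + if p = d.succ then c p ^ 2 else 0 := by
        intro p
        have e1 : p ≤ d.succ ↔ (p : ℕ) ≤ d + 1 := Iff.rfl
        have e2 : p ≤ d.castSucc ↔ (p : ℕ) ≤ d := Iff.rfl
        have e3 : p = d.succ ↔ (p : ℕ) = d + 1 := Fin.ext_iff
        simp only [e1, e2, e3]
        split_ifs <;> first | omega | simp
      simp_rw [h4]
      rw [Finset.sum_add_distrib, ih, Finset.sum_ite_eq' Finset.univ d.succ]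
      simp [hc, Real.sq_sqrt (sub_nonneg.mpr (hf d))]
  · simp

end

end SphericalCascade

open scoped ENNReal

namespace SphericalCascade

/-! ### Decompositions of infinite product measures -/

/-! With A = √(R² + 1), the exponent in `F` is A y plus a rest `exponentPert` in which y has the
small coefficient -s²/(2A). The large term A y tilts the weight of each leaf by exp(A ∑ Y^i). By the
Bolthausen–Sznitman invariance of the Ruelle cascade, such a tilt has the same effect on averages as
replacing each Y^i by Y^i + A·`shift`, where `shift` is the sum of the increments of x ξ'(x) times
the parameters ζ([0, q_{p-1}]) (`cascadeMoment_add_linear`). Inserted into -y s²/(2A), this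
deterministic shift gives -`shift`·s²/2, in which A cancels, and this is exactly the sum in Ŝ_ζ
(`exponentPert_add_shift`).

What is left over differs from the limiting exponent by at most (c |y| + c')/A on |s| ≤ C. Hence the
averages differ by at most a constant over A times a Gibbs average of exp(∑ (c |Y^i| + c'))
(`abs_cascadeAverage_sub_le`). The Gibbs weights are those of the limiting exponent, which does not
contain Y; they are independent of Y, so Y can be integrated first (`lintegral_gibbs_exp_le`). The
variance of Y^i is at most ξ'(1), so the resulting bound of order 1/A is the same for all ζ
(`abs_F_sub_FLim_le`), which gives pointwise and uniform convergence at once.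

The invariance is proved with Laplace transforms. A cascade is a sum over the points of a Poisson
process of independent copies of cascades of smaller depth, so its Laplace transform satisfies a
recursion (`cascadeLaplace_succ`), by the formula for the generating functional of a marked Poisson
process (`lintegral_tendsto_prod_of_infinitePi_exp`). By the scaling of the stable intensity, a tilt
f at a vertex enters this recursion only through f ^ m (`lintegral_one_sub_cascadeLaplace_eq`); for
a Gaussian f, Cameron–Martin turns f ^ m into a constant and a shift. The constants collect into a
single factor κ, common to numerators and denominators, which cancels in the ratios. Joint laws
follow from `ext_of_laplace`. The strict growth of the parameters m along the levels makes the
integrals in the recursion finite (`exists_one_sub_cascadeLaplace_le`). -/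

theorem infinitePi_map_optionElim {ι X : Type*} [MeasurableSpace X] (ν : Measure X)
    [IsProbabilityMeasure ν] :
    (ν.prod (Measure.infinitePi fun _ : ι => ν)).map
      (fun p (o : Option ι) => o.elim p.1 p.2) = Measure.infinitePi fun _ : Option ι => ν := by
  classical
  have hm : Measurable (fun (p : X × (ι → X)) (o : Option ι) => o.elim p.1 p.2) := by
    refine measurable_pi_lambda _ fun o => ?_
    cases o with
    | none => exact measurable_fst
    | some i => exact (measurable_pi_apply i).comp measurable_snd
  refine Measure.eq_infinitePi _ fun s t ht => ?_
  have hs : (fun (p : X × (ι → X)) (o : Option ι) => o.elim p.1 p.2) ⁻¹' (Set.pi s t) =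
      (if none ∈ s then t none else Set.univ) ×ˢ
        (Set.pi (s.eraseNone : Set ι) fun i => t (some i)) := by
    ext p
    simp only [Set.mem_preimage, Set.mem_pi, Finset.mem_coe, Set.mem_prod, Finset.mem_eraseNone]
    constructor
    · intro h
      refine ⟨?_, fun i hi => h _ hi⟩
      split_ifs with h0
      · exact h _ h0
      · trivial
    · rintro ⟨h1, h2⟩ o ho
      cases o with
      | none => rwa [if_pos ho] at h1
      | some i => exact h2 i ho
  rw [Measure.map_apply hm (.pi s.countable_toSet fun _ _ => ht _), hs, Measure.prod_prod,
    Measure.infinitePi_pi _ fun i _ => ht _]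
  have h3 : ∏ i ∈ s, ν (t i) =
      (if none ∈ s then ν (t none) else 1) * ∏ i ∈ s.eraseNone, ν (t (some i)) := by
    split_ifs with h
    · have : s = Finset.insertNone s.eraseNone := by
        rw [Finset.insertNone_eraseNone, Finset.insert_eq_of_mem h]
      conv_lhs => rw [this]
      rw [Finset.prod_insertNone]
    · rw [one_mul]
      have : s = s.eraseNone.map Function.Embedding.some := by
        rw [Finset.map_some_eraseNone, Finset.erase_eq_of_notMem h]
      conv_lhs => rw [this]
      rw [Finset.prod_map]
      rfl
  rw [h3]
  split_ifs <;> simp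

theorem measurePreserving_infinitePi_peel {ι κ X : Type*} [MeasurableSpace X] (ν : Measure X)
    [IsProbabilityMeasure ν] (e : Option ι ≃ κ) :
    MeasurePreserving (fun ω : κ → X => (ω (e none), fun i => ω (e (some i))))
      (Measure.infinitePi fun _ : κ => ν) (ν.prod (Measure.infinitePi fun _ : ι => ν)) := by
  have hm : Measurable (fun (p : X × (ι → X)) (o : Option ι) => o.elim p.1 p.2) := by
    refine measurable_pi_lambda _ fun o => ?_
    cases o with
    | none => exact measurable_fst
    | some i => exact (measurable_pi_apply i).comp measurable_snd
  have hF : Measurable (fun ω : Option ι → X => (ω none, fun i => ω (some i))) := by fun_prop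
  have hE : Measurable (fun (ω : κ → X) o => ω (e o)) := by fun_prop
  refine ⟨by fun_prop, ?_⟩
  have h1 := Measure.map_infinitePi_infinitePi_of_inj (P := fun _ : κ => ν) e.injective
  have h2 : (fun ω : κ → X => (ω (e none), fun i => ω (e (some i)))) =
      (fun ω : Option ι → X => (ω none, fun i => ω (some i))) ∘ fun ω o => ω (e o) := rfl
  rw [h2, ← Measure.map_map hF hE, h1, ← infinitePi_map_optionElim, Measure.map_map hF hm]
  exact Measure.map_id

theorem measurePreserving_seq_peel {X : Type*} [MeasurableSpace X] (ν : Measure X)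
    [IsProbabilityMeasure ν] :
    MeasurePreserving (fun ω : ℕ → X => (ω 0, fun i => ω (i + 1)))
      (Measure.infinitePi fun _ : ℕ => ν) (ν.prod (Measure.infinitePi fun _ : ℕ => ν)) :=
  measurePreserving_infinitePi_peel ν
    ⟨fun o => o.elim 0 Nat.succ, fun n => n.casesOn none some,
      fun o => by cases o <;> rfl, fun n => by cases n <;> rfl⟩

/-- A list is either empty or of the form `j :: b`: the tree consists of its root and of countably
many independent copies of itself. This self-similarity drives every recursion on the depth. -/
theorem measurePreserving_tree_peel {X : Type*} [MeasurableSpace X] (ν : Measure X)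
    [IsProbabilityMeasure ν] :
    MeasurePreserving (fun ω : List ℕ → X => (ω [], fun (j : ℕ) (b : List ℕ) => ω (j :: b)))
      (Measure.infinitePi fun _ : List ℕ => ν)
      (ν.prod (Measure.infinitePi fun _ : ℕ => Measure.infinitePi fun _ : List ℕ => ν)) := by
  have h1 := measurePreserving_infinitePi_peel ν (ι := ℕ × List ℕ) (κ := List ℕ)
    ⟨fun o => o.elim [] fun p => p.1 :: p.2, fun b => b.casesOn none fun j b => some (j, b),
      fun o => by cases o <;> rfl, fun n => by cases n <;> rfl⟩
  have h2 : MeasurePreserving (MeasurableEquiv.curry ℕ (List ℕ) X)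
      (Measure.infinitePi fun _ : ℕ × List ℕ => ν)
      (Measure.infinitePi fun _ : ℕ => Measure.infinitePi fun _ : List ℕ => ν) :=
    ⟨MeasurableEquiv.measurable _, Measure.infinitePi_map_curry fun (_ : ℕ) (_ : List ℕ) => ν⟩
  exact ((MeasurePreserving.id ν).prod h2).comp h1

/-! ### The function `t ↦ exp (-t)` on `[0, ∞]` -/

/-- `exp (-t)` for `t` in `[0, ∞]`. -/
noncomputable def expNeg (t : ℝ≥0∞) : ℝ≥0∞ := (EReal.exp t)⁻¹

theorem expNeg_ofReal {t : ℝ} (ht : 0 ≤ t) :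
    expNeg (ENNReal.ofReal t) = ENNReal.ofReal (Real.exp (-t)) := by
  rw [expNeg, EReal.coe_ennreal_ofReal, max_eq_left ht, EReal.exp_coe,
    ← ENNReal.ofReal_inv_of_pos (Real.exp_pos t), Real.exp_neg]

theorem expNeg_zero : expNeg 0 = 1 := by simp [expNeg]

theorem expNeg_top : expNeg ∞ = 0 := by simp [expNeg]

theorem expNeg_le_one (t : ℝ≥0∞) : expNeg t ≤ 1 := by
  rw [expNeg, ENNReal.inv_le_one, EReal.one_le_exp_iff]
  exact EReal.coe_ennreal_nonneg t

theorem expNeg_add (s t : ℝ≥0∞) : expNeg (s + t) = expNeg s * expNeg t := by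
  have h : ∀ t : ℝ≥0∞, EReal.exp t ≠ 0 := fun t => by
    rw [Ne, EReal.exp_eq_zero_iff]
    exact (EReal.bot_lt_coe_ennreal t).ne'
  rw [expNeg, expNeg, expNeg, EReal.coe_ennreal_add, EReal.exp_add,
    ENNReal.mul_inv (Or.inl (h s)) (Or.inr (h t))]

theorem continuous_expNeg : Continuous expNeg :=
  continuous_inv.comp (EReal.expHomeomorph.continuous.comp continuous_coe_ennreal_ereal)

theorem measurable_expNeg : Measurable expNeg := continuous_expNeg.measurable

theorem expNeg_sum {ι : Type*} (s : Finset ι) (f : ι → ℝ≥0∞) :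
    expNeg (∑ i ∈ s, f i) = ∏ i ∈ s, expNeg (f i) := by
  classical
  induction s using Finset.induction_on with
  | empty => simp [expNeg_zero]
  | insert a s ha ih => rw [Finset.sum_insert ha, Finset.prod_insert ha, expNeg_add, ih]

theorem expNeg_injective : Function.Injective expNeg := fun s t h => by
  rw [expNeg, expNeg, inv_inj] at h
  exact EReal.coe_ennreal_injective (EReal.exp_strictMono.injective h)

theorem expNeg_nsmul (n : ℕ) (t : ℝ≥0∞) : expNeg (n * t) = expNeg t ^ n := by
  induction n with
  | zero => simp [expNeg_zero]
  | succ n ih => rw [Nat.cast_succ, add_mul, one_mul, expNeg_add, ih, pow_succ]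

theorem one_sub_expNeg_le (t : ℝ≥0∞) : 1 - expNeg t ≤ t := by
  rcases eq_or_ne t ∞ with rfl | ht
  · exact le_top
  rw [← ENNReal.ofReal_toReal ht, expNeg_ofReal ENNReal.toReal_nonneg, ← ENNReal.ofReal_one,
    ← ENNReal.ofReal_sub _ (Real.exp_pos _).le]
  refine ENNReal.ofReal_le_ofReal ?_
  linarith [Real.add_one_le_exp (-t.toReal)]

/-! ### The probability generating functional of a marked Poisson process -/

theorem lintegral_expMeasure_one {f : ℝ → ℝ≥0∞} (hf : Measurable f) :
    ∫⁻ x, f x ∂(expMeasure 1) = ∫⁻ x in Set.Ioi 0, ENNReal.ofReal (Real.exp (-x)) * f x := by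
  have h1 : expMeasure 1 = volume.withDensity (exponentialPDF 1) := rfl
  have hpdf : Measurable (exponentialPDF 1) := (measurable_exponentialPDFReal 1).ennreal_ofReal
  rw [h1, lintegral_withDensity_eq_lintegral_mul _ hpdf hf,
    ← lintegral_add_compl _ (measurableSet_Iio (a := (0 : ℝ)))]
  rw [setLIntegral_congr_fun measurableSet_Iio (g := fun _ => 0), lintegral_zero, zero_add,
    Set.compl_Iio, ← restrict_Ioi_eq_restrict_Ici]
  · refine setLIntegral_congr_fun measurableSet_Ioi fun x hx => ?_
    simp only [Pi.mul_apply]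
    rw [exponentialPDF_of_nonneg (le_of_lt hx)]
    simp
  · intro x hx
    simp only [Pi.mul_apply]
    rw [exponentialPDF_of_neg hx, zero_mul]

theorem ae_expMeasure_pos : ∀ᵐ x ∂(expMeasure 1), 0 < x := by
  have h : expMeasure 1 (Set.Iic 0) = 0 := by
    rw [← lintegral_indicator_one measurableSet_Iic,
      lintegral_expMeasure_one (measurable_one.indicator measurableSet_Iic),
      setLIntegral_congr_fun measurableSet_Ioi (g := fun _ => 0), lintegral_zero]
    intro x hx
    simp only
    rw [Set.indicator_of_notMem (by simpa using hx), mul_zero]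
  rw [ae_iff]
  simpa [Set.Iic_def] using h

/-- A renewal identity, conditioning on the next arrival a + x after time a. With G(x) = ∫_x^∞ φ,
the function -e^{-x} e^{-G(a+x)} is a primitive of e^{-x} (1 - φ(a+x)) e^{-G(a+x)} and vanishes at
infinity. -/
theorem lintegral_one_sub_mul_exp_neg_integral_Ioi {φ : ℝ → ℝ} (hm : Measurable φ)
    (hi : IntegrableOn φ (Set.Ioi 0)) (hc : ∀ y > 0, ContinuousAt φ y)
    (h0 : ∀ y > 0, 0 ≤ φ y) (h1 : ∀ y > 0, φ y ≤ 1) {a : ℝ} (ha : 0 ≤ a) :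
    ∫⁻ x, ENNReal.ofReal ((1 - φ (a + x)) * Real.exp (-∫ y in Set.Ioi (a + x), φ y))
      ∂(expMeasure 1) = ENNReal.ofReal (Real.exp (-∫ y in Set.Ioi a, φ y)) := by
  -- Integrability of φ is known only on (0, ∞). The cut-off makes the primitive continuous on the
  -- whole line and changes nothing at nonnegative arguments.
  set φ' : ℝ → ℝ := (Set.Ioi 0).indicator φ with hφ'
  have hi' : Integrable φ' := hi.integrable_indicator measurableSet_Ioi
  have hG : ∀ x, 0 ≤ x → ∫ y in Set.Ioi x, φ y = (∫ y in Set.Ioi 0, φ y) - ∫ y in (0)..x, φ' y := by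
    intro x hx
    have h2 : ∫ y in (0)..x, φ' y = ∫ y in (0)..x, φ y := by
      rw [intervalIntegral.integral_of_le hx, intervalIntegral.integral_of_le hx]
      exact setIntegral_congr_fun measurableSet_Ioc fun y hy => Set.indicator_of_mem hy.1 φ
    rw [h2, ← intervalIntegral.integral_Ioi_sub_Ioi hi hx, sub_sub_cancel]
  set G : ℝ → ℝ := fun x => (∫ y in Set.Ioi 0, φ y) - ∫ y in (0)..x, φ' y with hGdef
  have hGc : Continuous G :=
    continuous_const.sub (intervalIntegral.continuous_primitive (fun _ _ => hi'.intervalIntegrable) 0)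
  have hGd : ∀ x > 0, HasDerivAt G (-φ x) x := by
    intro x hx
    have hev : φ' =ᶠ[𝓝 x] φ := by
      filter_upwards [Ioi_mem_nhds hx] with y hy
      exact Set.indicator_of_mem hy φ
    have := intervalIntegral.integral_hasDerivAt_right (a := 0) (b := x) (f := φ')
      hi'.intervalIntegrable (hi'.1.stronglyMeasurableAtFilter) ((hc x hx).congr hev.symm)
    rw [hev.eq_of_nhds] at this
    exact this.const_sub _
  have hGn : ∀ x, 0 ≤ x → 0 ≤ G x := by
    intro x hx
    rw [hGdef]
    simp only
    rw [← hG x hx]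
    exact setIntegral_nonneg measurableSet_Ioi fun y hy => h0 y (hx.trans_lt hy)
  have key : ∀ x ∈ Set.Ioi (0 : ℝ), HasDerivAt (fun x => -(Real.exp (-x) * Real.exp (-G (a + x))))
      (Real.exp (-x) * ((1 - φ (a + x)) * Real.exp (-G (a + x)))) x := by
    intro x hx
    have hx' : 0 < a + x := add_pos_of_nonneg_of_pos ha hx
    have d1 := (hasDerivAt_neg x).exp
    have d2 : HasDerivAt (fun x => Real.exp (-G (a + x)))
        (Real.exp (-G (a + x)) * -(-φ (a + x))) x := (((hGd _ hx').comp_const_add a x).neg).exp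
    convert! (d1.mul d2).neg using 1
    ring
  have hpos : ∀ x ∈ Set.Ioi (0 : ℝ), 0 ≤ Real.exp (-x) * ((1 - φ (a + x)) * Real.exp (-G (a + x))) := by
    intro x hx
    have hx' : 0 < a + x := add_pos_of_nonneg_of_pos ha hx
    have := h1 _ hx'
    have : 0 ≤ 1 - φ (a + x) := by linarith
    positivity
  have hlim : Tendsto (fun x => -(Real.exp (-x) * Real.exp (-G (a + x)))) atTop (𝓝 0) := by
    rw [← neg_zero]
    refine Tendsto.neg ?_
    refine squeeze_zero' (Eventually.of_forall fun x => by positivity) ?_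
      (Real.tendsto_exp_atBot.comp tendsto_neg_atTop_atBot)
    filter_upwards [eventually_ge_atTop 0] with x hx
    have := hGn (a + x) (add_nonneg ha hx)
    exact mul_le_of_le_one_right (Real.exp_pos _).le (Real.exp_le_one_iff.mpr (by linarith))
  have hcont : ContinuousWithinAt (fun x => -(Real.exp (-x) * Real.exp (-G (a + x))))
      (Set.Ici 0) 0 := by
    apply Continuous.continuousWithinAt
    fun_prop
  have hint := integrableOn_Ioi_deriv_of_nonneg hcont key hpos hlim
  have hval := integral_Ioi_of_hasDerivAt_of_nonneg hcont key hpos hlim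
  have hmG : Measurable fun x => ENNReal.ofReal ((1 - φ (a + x)) * Real.exp (-G (a + x))) := by
    have := hGc.measurable
    fun_prop
  have hcongr : ∫⁻ x, ENNReal.ofReal ((1 - φ (a + x)) * Real.exp (-∫ y in Set.Ioi (a + x), φ y))
      ∂(expMeasure 1) =
      ∫⁻ x, ENNReal.ofReal ((1 - φ (a + x)) * Real.exp (-G (a + x))) ∂(expMeasure 1) := by
    refine lintegral_congr_ae ?_
    filter_upwards [ae_expMeasure_pos] with x hx
    rw [hG _ (add_nonneg ha hx.le)]
  rw [hcongr, lintegral_expMeasure_one hmG, hG a ha]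
  simp_rw [← ENNReal.ofReal_mul (Real.exp_pos _).le]
  rw [← ofReal_integral_eq_lintegral_ofReal hint
    ((ae_restrict_iff' measurableSet_Ioi).mpr (Eventually.of_forall hpos)), hval]
  simp [hGdef]

/-- Truncation to [0, 1] makes integrability trivial and keeps the mean positive, so by the strong
law already the truncated sums diverge. -/
theorem tendsto_sum_atTop_of_infinitePi_exp {W : Type*} [MeasurableSpace W] (ρ : Measure W)
    [IsProbabilityMeasure ρ] :
    ∀ᵐ ω ∂(Measure.infinitePi fun _ : ℕ => (expMeasure 1).prod ρ),
      Tendsto (fun N => ∑ k ∈ Finset.range N, (ω k).1) atTop atTop := by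
  set Q := Measure.infinitePi fun _ : ℕ => (expMeasure 1).prod ρ
  set X : ℕ → (ℕ → ℝ × W) → ℝ := fun k ω => max 0 (min (ω k).1 1)
  have hXm : ∀ k, Measurable (X k) := fun k => by fun_prop
  have hX1 : ∀ k ω, |X k ω| ≤ 1 := fun k ω => by
    rw [abs_of_nonneg (le_max_left _ _)]
    exact max_le zero_le_one (min_le_right _ _)
  have hint : Integrable (X 0) Q :=
    Integrable.of_bound (hXm 0).aestronglyMeasurable 1 (Eventually.of_forall (hX1 0))
  have hg : Measurable fun p : ℝ × W => max 0 (min p.1 1) := by fun_prop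
  have hind := iIndepFun_infinitePi (P := fun _ : ℕ => (expMeasure 1).prod ρ)
    (X := fun _ p => max 0 (min p.1 1)) fun _ => hg
  have hmp := fun k => measurePreserving_eval_infinitePi (fun _ : ℕ => (expMeasure 1).prod ρ) k
  have hid : ∀ k, IdentDistrib (X k) (X 0) Q Q := fun k =>
    ⟨(hXm k).aemeasurable, (hXm 0).aemeasurable, by
      have h1 := Measure.map_map hg (hmp k).measurable (μ := Q)
      have h2 := Measure.map_map hg (hmp 0).measurable (μ := Q)
      rw [(hmp k).map_eq] at h1
      rw [(hmp 0).map_eq] at h2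
      exact h1.symm.trans h2⟩
  have hpos1 : ∀ k, ∀ᵐ ω ∂Q, 0 < (ω k).1 := fun k =>
    (hmp k).quasiMeasurePreserving.ae
      ((Measure.quasiMeasurePreserving_fst (μ := expMeasure 1) (ν := ρ)).ae ae_expMeasure_pos)
  have hpos : 0 < ∫ ω, X 0 ω ∂Q := by
    refine (integral_pos_iff_support_of_nonneg (f := X 0) (fun ω => le_max_left _ _) hint).mpr ?_
    have : Q (Function.support (X 0)) = Q Set.univ := by
      refine measure_congr ?_
      filter_upwards [hpos1 0] with ω hω
      refine propext ⟨fun _ => trivial, fun _ => ?_⟩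
      have : 0 < X 0 ω := lt_max_of_lt_right (lt_min hω one_pos)
      exact this.ne'
    rw [this]
    simp
  have hsl := strong_law_ae_real X hint (fun i j hij => hind.indepFun hij) hid
  filter_upwards [hsl, ae_all_iff.mpr hpos1] with ω h1 h2
  have h3 : Tendsto (fun N : ℕ => (N : ℝ) * ((∑ k ∈ Finset.range N, X k ω) / N)) atTop atTop :=
    tendsto_natCast_atTop_atTop.atTop_mul_pos hpos h1
  refine tendsto_atTop_mono' _ ?_ h3
  filter_upwards [eventually_gt_atTop 0] with N hN
  rw [mul_div_cancel₀ _ (by positivity)]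
  exact Finset.sum_le_sum fun k _ => max_le (h2 k).le (min_le_left _ _)

/-- The renewal identity iterated N times: the first N points contribute their factors ψ, and H at
the N-th arrival stands for all later points. The starting time a is kept general because peeling
off the first point moves it. -/
theorem lintegral_prod_mul_exp_neg_integral_Ioi {W : Type*} [MeasurableSpace W] (ρ : Measure W)
    [IsProbabilityMeasure ρ] {ψ : ℝ × W → ℝ≥0∞} (hψ : Measurable ψ) {φ : ℝ → ℝ} (hm : Measurable φ)
    (hφ : ∀ x > 0, ∫⁻ v, ψ (x, v) ∂ρ = ENNReal.ofReal (1 - φ x))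
    (hi : IntegrableOn φ (Set.Ioi 0)) (hc : ∀ y > 0, ContinuousAt φ y)
    (h0 : ∀ y > 0, 0 ≤ φ y) (h1 : ∀ y > 0, φ y ≤ 1)
    {H : ℝ → ℝ≥0∞} (hHm : Measurable H)
    (hH : ∀ a, 0 ≤ a → H a = ENNReal.ofReal (Real.exp (-∫ y in Set.Ioi a, φ y)))
    (N : ℕ) {a : ℝ} (ha : 0 ≤ a) :
    ∫⁻ ω, (∏ j ∈ Finset.range N, ψ (a + ∑ k ∈ Finset.range (j + 1), (ω k).1, (ω j).2)) *
      H (a + ∑ k ∈ Finset.range N, (ω k).1)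
      ∂(Measure.infinitePi fun _ : ℕ => (expMeasure 1).prod ρ) = H a := by
  induction N generalizing a with
  | zero => simp
  | succ N ih =>
    set F : (ℝ × W) × (ℕ → ℝ × W) → ℝ≥0∞ := fun p => ψ (a + p.1.1, p.1.2) *
      ((∏ j ∈ Finset.range N, ψ (a + p.1.1 + ∑ k ∈ Finset.range (j + 1), (p.2 k).1, (p.2 j).2)) *
        H (a + p.1.1 + ∑ k ∈ Finset.range N, (p.2 k).1)) with hF
    have hFm : Measurable F := by fun_prop
    have hcomp : ∀ ω : ℕ → ℝ × W,
        (∏ j ∈ Finset.range (N + 1), ψ (a + ∑ k ∈ Finset.range (j + 1), (ω k).1, (ω j).2)) *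
          H (a + ∑ k ∈ Finset.range (N + 1), (ω k).1) = F (ω 0, fun i => ω (i + 1)) := by
      intro ω
      rw [Finset.prod_range_succ', hF]
      simp only [Finset.sum_range_succ' _ (_ + 1), Finset.sum_range_succ' _ N]
      simp only [zero_add, Finset.sum_range_one]
      rw [mul_assoc, mul_left_comm]
      simp only [add_assoc, add_comm (ω 0).1]
    simp_rw [hcomp]
    rw [(measurePreserving_seq_peel ((expMeasure 1).prod ρ)).lintegral_comp hFm,
      lintegral_prod _ hFm.aemeasurable]
    have hinner : ∀ᵐ y ∂((expMeasure 1).prod ρ),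
        ∫⁻ ω', F (y, ω') ∂(Measure.infinitePi fun _ : ℕ => (expMeasure 1).prod ρ) =
          ψ (a + y.1, y.2) * H (a + y.1) := by
      filter_upwards [(Measure.quasiMeasurePreserving_fst (μ := expMeasure 1) (ν := ρ)).ae
        ae_expMeasure_pos] with y hy
      rw [hF]
      simp only
      rw [lintegral_const_mul _ (by fun_prop), ih (add_nonneg ha hy.le)]
    rw [lintegral_congr_ae hinner, lintegral_prod _ (by fun_prop),
      hH a ha, ← lintegral_one_sub_mul_exp_neg_integral_Ioi hm hi hc h0 h1 ha]
    refine lintegral_congr_ae ?_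
    filter_upwards [ae_expMeasure_pos] with x hx
    rw [lintegral_mul_const _ (by fun_prop), hφ _ (by linarith), hH _ (by linarith),
      ENNReal.ofReal_mul (by linarith [h1 (a + x) (by linarith)])]

/-- The generating functional of a marked Poisson process of rate one, E ∏ ψ(Γ_j, v_j) = exp(-∫ (1 -
E ψ(x, v)) dx). It follows by letting N → ∞ in the finite identity with a = 0: the arrivals tend to
infinity, so the factor H tends to 1, and everything is dominated by 1. -/
theorem lintegral_tendsto_prod_of_infinitePi_exp {W : Type*} [MeasurableSpace W] (ρ : Measure W)
    [IsProbabilityMeasure ρ] {ψ : ℝ × W → ℝ≥0∞} (hψ : Measurable ψ) (hψ1 : ∀ p, ψ p ≤ 1)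
    (hc : ∀ y > 0, ContinuousAt (fun x => ∫⁻ v, ψ (x, v) ∂ρ) y)
    (hi : ∫⁻ x in Set.Ioi (0 : ℝ), (1 - ∫⁻ v, ψ (x, v) ∂ρ) ≠ ∞)
    {L : (ℕ → ℝ × W) → ℝ≥0∞}
    (hL : ∀ᵐ ω ∂(Measure.infinitePi fun _ : ℕ => (expMeasure 1).prod ρ),
      Tendsto (fun N => ∏ j ∈ Finset.range N, ψ (∑ k ∈ Finset.range (j + 1), (ω k).1, (ω j).2))
        atTop (𝓝 (L ω))) :
    ∫⁻ ω, L ω ∂(Measure.infinitePi fun _ : ℕ => (expMeasure 1).prod ρ) =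
      expNeg (∫⁻ x in Set.Ioi (0 : ℝ), (1 - ∫⁻ v, ψ (x, v) ∂ρ)) := by
  set Φ : ℝ → ℝ≥0∞ := fun x => ∫⁻ v, ψ (x, v) ∂ρ with hΦ
  have hΦm : Measurable Φ := hψ.lintegral_prod_right'
  have hΦ1 : ∀ x, Φ x ≤ 1 := fun x =>
    (lintegral_mono fun v => hψ1 (x, v)).trans (by simp)
  have hΦt : ∀ x, Φ x ≠ ∞ := fun x => ((hΦ1 x).trans_lt ENNReal.one_lt_top).ne
  set φ : ℝ → ℝ := fun x => 1 - (Φ x).toReal with hφ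
  have hφm : Measurable φ := by fun_prop
  have hφ0 : ∀ x, 0 ≤ φ x := fun x => sub_nonneg.mpr
    (by simpa using ENNReal.toReal_mono ENNReal.one_ne_top (hΦ1 x))
  have hφe : ∀ x, ENNReal.ofReal (φ x) = 1 - Φ x := fun x => by
    rw [hφ, ENNReal.ofReal_sub _ ENNReal.toReal_nonneg, ENNReal.ofReal_toReal (hΦt x),
      ENNReal.ofReal_one]
  have hint : IntegrableOn φ (Set.Ioi 0) := by
    refine ⟨hφm.aestronglyMeasurable, ?_⟩
    rw [hasFiniteIntegral_iff_ofReal (Eventually.of_forall hφ0)]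
    simp_rw [hφe]
    exact hi.lt_top
  -- The maximum with 0 makes the exponent monotone on the whole line, hence H measurable.
  set H : ℝ → ℝ≥0∞ := fun a => ENNReal.ofReal (Real.exp (-∫ y in Set.Ioi (max a 0), φ y)) with hH
  have hanti : Monotone fun a : ℝ => -∫ y in Set.Ioi (max a 0), φ y := fun a b hab =>
    neg_le_neg (setIntegral_mono_set (hint.mono_set (Set.Ioi_subset_Ioi (le_max_right _ _)))
      (Eventually.of_forall hφ0)
      (Set.Ioi_subset_Ioi (max_le_max_right 0 hab)).eventuallyLE)
  have hHm : Measurable H := by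
    have := hanti.measurable
    fun_prop
  have hHlim : Tendsto H atTop (𝓝 1) := by
    have h2 := intervalIntegral_tendsto_integral_Ioi 0 hint tendsto_id
    have h3 : Tendsto (fun a : ℝ => -((∫ y in Set.Ioi 0, φ y) - ∫ y in (0)..a, φ y)) atTop
        (𝓝 (-((∫ y in Set.Ioi 0, φ y) - ∫ y in Set.Ioi 0, φ y))) := (h2.const_sub _).neg
    rw [sub_self, neg_zero] at h3
    have h4 := ENNReal.tendsto_ofReal ((Real.continuous_exp.tendsto 0).comp h3)
    rw [Real.exp_zero, ENNReal.ofReal_one] at h4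
    refine h4.congr' ?_
    filter_upwards [eventually_ge_atTop 0] with a ha
    rw [hH]
    simp only [Function.comp_apply]
    rw [max_eq_left ha, ← intervalIntegral.integral_Ioi_sub_Ioi hint ha, sub_sub_cancel]
  have hlim : Tendsto (fun N => ∫⁻ ω, (∏ j ∈ Finset.range N,
      ψ (0 + ∑ k ∈ Finset.range (j + 1), (ω k).1, (ω j).2)) *
      H (0 + ∑ k ∈ Finset.range N, (ω k).1)
      ∂(Measure.infinitePi fun _ : ℕ => (expMeasure 1).prod ρ)) atTop
      (𝓝 (∫⁻ ω, L ω ∂(Measure.infinitePi fun _ : ℕ => (expMeasure 1).prod ρ))) := by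
    refine tendsto_lintegral_of_dominated_convergence (fun _ => 1) (fun N => by fun_prop)
      (fun N => Eventually.of_forall fun ω => ?_) (by simp) ?_
    · refine mul_le_one' (Finset.prod_le_one' fun j _ => hψ1 _) ?_
      rw [hH, ENNReal.ofReal_le_one, Real.exp_le_one_iff, Left.neg_nonpos_iff]
      exact integral_nonneg hφ0
    · filter_upwards [hL, tendsto_sum_atTop_of_infinitePi_exp ρ] with ω h1 h2
      simp only [zero_add]
      simpa using ENNReal.Tendsto.mul h1 (Or.inr ENNReal.one_ne_top) (hHlim.comp h2)
        (Or.inl one_ne_zero)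
  have hconst : ∀ N, _ := fun N => lintegral_prod_mul_exp_neg_integral_Ioi ρ hψ hφm
    (fun x _ => by rw [hφ, sub_sub_cancel, ENNReal.ofReal_toReal (hΦt x)]) hint
    (fun y hy => continuousAt_const.sub ((ENNReal.tendsto_toReal (hΦt y)).comp (hc y hy)))
    (fun y _ => hφ0 y) (fun y _ => sub_le_self _ ENNReal.toReal_nonneg) hHm
    (fun a ha => by rw [hH]; simp only [max_eq_left ha]) N le_rfl
  simp_rw [hconst] at hlim
  rw [← tendsto_nhds_unique tendsto_const_nhds hlim, hH]
  simp only [max_self]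
  rw [← expNeg_ofReal (integral_nonneg hφ0), ofReal_integral_eq_lintegral_ofReal hint
    (Eventually.of_forall hφ0)]
  simp_rw [hφe, hΦ]

/-! ### Cascades on the infinitary tree -/

/-- The law of independent node variables on the tree: a standard exponential variable
and an independent mark with law `γ`. -/
noncomputable def treeLaw {X : Type*} [MeasurableSpace X] (γ : Measure X) :
    Measure (List ℕ → ℝ × X) :=
  Measure.infinitePi fun _ : List ℕ => (expMeasure 1).prod γ

section Tree

variable {X : Type*} [MeasurableSpace X] (γ : Measure X) [IsProbabilityMeasure γ]

instance : IsProbabilityMeasure (treeLaw γ) := by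
  unfold treeLaw
  infer_instance

theorem measurePreserving_treeLaw_children :
    MeasurePreserving (fun (ω : List ℕ → ℝ × X) (j : ℕ) (b : List ℕ) => ω (j :: b))
      (treeLaw γ) (Measure.infinitePi fun _ : ℕ => treeLaw γ) :=
  measurePreserving_snd.comp (measurePreserving_tree_peel ((expMeasure 1).prod γ))

/-- The root variable is independent of all others, so it may be resampled. This separates the mark
of a vertex from the cascade below it. -/
theorem measurePreserving_treeLaw_update_root :
    MeasurePreserving (fun p : (ℝ × X) × (List ℕ → ℝ × X) => Function.update p.2 [] p.1)
      (((expMeasure 1).prod γ).prod (treeLaw γ)) (treeLaw γ) := by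
  set glue : (ℝ × X) × (ℕ → List ℕ → ℝ × X) → List ℕ → ℝ × X := fun p b =>
    b.casesOn p.1 fun j b => p.2 j b with hglue
  have hm : Measurable glue := by
    refine measurable_pi_lambda _ fun b => ?_
    cases b with
    | nil => exact measurable_fst
    | cons j b => exact by fun_prop
  have h1 := measurePreserving_tree_peel ((expMeasure 1).prod γ)
  have h2 : MeasurePreserving glue (((expMeasure 1).prod γ).prod
      (Measure.infinitePi fun _ : ℕ => treeLaw γ)) (treeLaw γ) := by
    refine ⟨hm, ?_⟩
    unfold treeLaw
    rw [← h1.map_eq, Measure.map_map hm h1.measurable]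
    have h3 : (glue ∘ fun ω : List ℕ → ℝ × X => (ω [], fun (j : ℕ) (b : List ℕ) => ω (j :: b))) =
        id := by
      ext ω b : 2
      cases b <;> rfl
    rw [h3, Measure.map_id]
  have h3 := h2.comp ((MeasurePreserving.id ((expMeasure 1).prod γ)).prod
    (measurePreserving_treeLaw_children γ))
  convert! h3 using 1
  ext p b : 2
  cases b <;> simp [hglue]

end Tree

theorem anc_zero {r : ℕ} (α : Fin r → ℕ) : anc α 0 = [] := rfl

theorem anc_cons_succ {r : ℕ} (j : ℕ) (α : Fin r → ℕ) (p : ℕ) :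
    anc (Fin.cons j α : Fin (r + 1) → ℕ) (p + 1) = j :: anc α p := by
  simp [anc, List.ofFn_succ]

theorem anc_succ_ne_nil {r : ℕ} (α : Fin r → ℕ) (p : Fin r) : anc α (p + 1) ≠ [] := by
  intro h
  have := congrArg List.length h
  simp only [anc, List.length_take, List.length_ofFn, List.length_nil] at this
  omega

/-- The sum over the leaves of the product of the cascade weights with parameters `m`, of the
tilts `f` of the marks along the path, and of `h` at the end point of the random walk
on the tree that starts in `x` and has the increments `σ`. -/
noncomputable def cascadeSum {X V : Type*} [AddCommMonoid V] {r : ℕ} (m : Fin r → ℝ)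
    (f : Fin r → X → ℝ≥0∞) (σ : Fin r → X → V) (h : V → ℝ≥0∞) (x : V) (ω : List ℕ → ℝ × X) : ℝ≥0∞ :=
  ∑' α : Fin r → ℕ, (∏ p : Fin r,
    (ENNReal.ofReal (arrival (fun b => (ω b).1) (anc α p) (α p) ^ (-1 / m p)) *
      f p (ω (anc α (p + 1))).2)) * h (x + ∑ p : Fin r, σ p (ω (anc α (p + 1))).2)

section CascadeSum

variable {X V : Type*} [AddCommMonoid V]

theorem cascadeSum_zero (m : Fin 0 → ℝ) (f : Fin 0 → X → ℝ≥0∞) (σ : Fin 0 → X → V)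
    (h : V → ℝ≥0∞) (x : V) (ω : List ℕ → ℝ × X) : cascadeSum m f σ h x ω = h x := by
  simp [cascadeSum]

/-- The leaves are sorted by the first step j of their path. The vertex `[j]` is the root of its own
subtree, so its mark is the root mark of the shifted family `fun b => ω (j :: b)`. -/
theorem cascadeSum_succ {r : ℕ} (m : Fin (r + 1) → ℝ) (f : Fin (r + 1) → X → ℝ≥0∞)
    (σ : Fin (r + 1) → X → V) (h : V → ℝ≥0∞) (x : V) (ω : List ℕ → ℝ × X) :
    cascadeSum m f σ h x ω = ∑' j : ℕ,
      ENNReal.ofReal ((∑ k ∈ Finset.range (j + 1), (ω [k]).1) ^ (-1 / m 0)) *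
        (f 0 (ω [j]).2 * cascadeSum (fun p => m p.succ) (fun p => f p.succ) (fun p => σ p.succ) h
          (x + σ 0 (ω [j]).2) fun b => ω (j :: b)) := by
  rw [cascadeSum, ← (Fin.consEquiv fun _ => ℕ).tsum_eq, ENNReal.tsum_prod']
  refine tsum_congr fun j => ?_
  rw [cascadeSum, ← ENNReal.tsum_mul_left, ← ENNReal.tsum_mul_left]
  refine tsum_congr fun α => ?_
  have harr : ∀ (b : List ℕ) (i : ℕ), arrival (fun b => (ω b).1) (j :: b) i =
      arrival (fun b => (ω (j :: b)).1) b i := fun b i => rfl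
  have harr0 : ∀ i, arrival (fun b => (ω b).1) [] i = ∑ k ∈ Finset.range (i + 1), (ω [k]).1 :=
    fun i => rfl
  have hcons : (Fin.consEquiv fun _ => ℕ) (j, α) = (Fin.cons j α : Fin (r + 1) → ℕ) := rfl
  simp only [hcons, Fin.prod_univ_succ, Fin.sum_univ_succ, Fin.cons_zero,
    Fin.cons_succ, Fin.val_zero, Fin.val_succ, anc_zero, anc_cons_succ, harr, harr0]
  rw [← add_assoc]
  ring

/-- Arrival times use the variables of children, and tilts and increments those of vertices at depth
at least one; the root variable is never read. It therefore stays free to serve as the mark one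
level up, or as a random starting point. -/
theorem cascadeSum_update_nil {r : ℕ} (m : Fin r → ℝ) (f : Fin r → X → ℝ≥0∞)
    (σ : Fin r → X → V) (h : V → ℝ≥0∞) (x : V) (ω : List ℕ → ℝ × X) (y : ℝ × X) :
    cascadeSum m f σ h x (Function.update ω [] y) = cascadeSum m f σ h x ω := by
  have h1 : ∀ (α : Fin r → ℕ) (p : Fin r), Function.update ω [] y (anc α (p + 1)) =
      ω (anc α (p + 1)) := fun α p => Function.update_of_ne (anc_succ_ne_nil α p) _ _
  have h2 : ∀ b i, arrival (fun b => (Function.update ω [] y b).1) b i =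
      arrival (fun b => (ω b).1) b i := fun b i => by
    refine Finset.sum_congr rfl fun k _ => ?_
    simp only
    rw [Function.update_of_ne (by simp)]
  simp only [cascadeSum, h1, h2]

theorem cascadeSum_const_mul {r : ℕ} (m : Fin r → ℝ) (f : Fin r → X → ℝ≥0∞)
    (σ : Fin r → X → V) (h : V → ℝ≥0∞) (c : ℝ≥0∞) (x : V) (ω : List ℕ → ℝ × X) :
    cascadeSum m f σ (fun y => c * h y) x ω = c * cascadeSum m f σ h x ω := by
  rw [cascadeSum, cascadeSum, ← ENNReal.tsum_mul_left]
  exact tsum_congr fun α => mul_left_comm _ _ _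

theorem cascadeSum_finset_sum {ι : Type*} (s : Finset ι) {r : ℕ} (m : Fin r → ℝ)
    (f : Fin r → X → ℝ≥0∞) (σ : Fin r → X → V) (h : ι → V → ℝ≥0∞) (x : V) (ω : List ℕ → ℝ × X) :
    cascadeSum m f σ (fun y => ∑ i ∈ s, h i y) x ω = ∑ i ∈ s, cascadeSum m f σ (h i) x ω := by
  simp only [cascadeSum, Finset.mul_sum]
  exact Summable.tsum_finsetSum fun _ _ => ENNReal.summable

variable [MeasurableSpace X]

/-- The Laplace transform of `cascadeSum` at `t`. -/
noncomputable def cascadeLaplace (γ : Measure X) {r : ℕ} (m : Fin r → ℝ)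
    (f : Fin r → X → ℝ≥0∞) (σ : Fin r → X → V) (h : V → ℝ≥0∞) (t : ℝ≥0∞) (x : V) : ℝ≥0∞ :=
  ∫⁻ ω, expNeg (t * cascadeSum m f σ h x ω) ∂(treeLaw γ)

theorem cascadeLaplace_le_one (γ : Measure X) [IsProbabilityMeasure γ] {r : ℕ} (m : Fin r → ℝ)
    (f : Fin r → X → ℝ≥0∞) (σ : Fin r → X → V) (h : V → ℝ≥0∞) (t : ℝ≥0∞) (x : V) :
    cascadeLaplace γ m f σ h t x ≤ 1 :=
  (lintegral_mono fun _ => expNeg_le_one _).trans (by simp)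

theorem cascadeLaplace_zero (γ : Measure X) [IsProbabilityMeasure γ] (m : Fin 0 → ℝ)
    (f : Fin 0 → X → ℝ≥0∞) (σ : Fin 0 → X → V) (h : V → ℝ≥0∞) (t : ℝ≥0∞) (x : V) :
    cascadeLaplace γ m f σ h t x = expNeg (t * h x) := by
  simp [cascadeLaplace, cascadeSum_zero]

variable [MeasurableSpace V] [MeasurableAdd₂ V]

theorem measurable_cascadeSum {Y : Type*} [MeasurableSpace Y] {a : Y → V}
    {b : Y → List ℕ → ℝ × X} (ha : Measurable a) (hb : Measurable b) {r : ℕ} (m : Fin r → ℝ)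
    {f : Fin r → X → ℝ≥0∞} {σ : Fin r → X → V}
    {h : V → ℝ≥0∞} (hf : ∀ p, Measurable (f p)) (hσ : ∀ p, Measurable (σ p)) (hh : Measurable h) :
    Measurable fun y => cascadeSum m f σ h (a y) (b y) := by
  unfold cascadeSum arrival
  refine Measurable.tsum fun α => ?_
  fun_prop

/-! ### The Laplace transform of a cascade -/

variable (γ : Measure X) [IsProbabilityMeasure γ]

theorem measurable_cascadeLaplace {r : ℕ} (m : Fin r → ℝ) {f : Fin r → X → ℝ≥0∞}
    {σ : Fin r → X → V} {h : V → ℝ≥0∞} (hf : ∀ p, Measurable (f p)) (hσ : ∀ p, Measurable (σ p))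
    (hh : Measurable h) : Measurable fun q : ℝ≥0∞ × V => cascadeLaplace γ m f σ h q.1 q.2 := by
  unfold cascadeLaplace
  have h1 : Measurable fun z : (ℝ≥0∞ × V) × (List ℕ → ℝ × X) => cascadeSum m f σ h z.1.2 z.2 :=
    measurable_cascadeSum (by fun_prop) (by fun_prop) m hf hσ hh
  have h2 : Measurable fun z : (ℝ≥0∞ × V) × (List ℕ → ℝ × X) =>
      expNeg (z.1.1 * cascadeSum m f σ h z.1.2 z.2) :=
    measurable_expNeg.comp (by fun_prop)
  exact h2.lintegral_prod_right'

/-- Over the children of the root, the pairs (exponential variable, tilt times subtree sum) are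
independent with a common product law. The sum is thus a functional of a marked Poisson process, and
the generating functional applies with ψ(u, z) = exp(-u^{-1/m} t z). -/
theorem cascadeLaplace_succ {r : ℕ} (m : Fin (r + 1) → ℝ) {f : Fin (r + 1) → X → ℝ≥0∞}
    {σ : Fin (r + 1) → X → V} {h : V → ℝ≥0∞} (hf : ∀ p, Measurable (f p))
    (hσ : ∀ p, Measurable (σ p)) (hh : Measurable h) (t : ℝ≥0∞) (x : V)
    (hfin : ∫⁻ u in Set.Ioi (0 : ℝ), (1 - ∫⁻ g, cascadeLaplace γ (fun p => m p.succ)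
      (fun p => f p.succ) (fun p => σ p.succ) h
      (ENNReal.ofReal (u ^ (-1 / m 0)) * (t * f 0 g)) (x + σ 0 g) ∂γ) ≠ ∞) :
    cascadeLaplace γ m f σ h t x =
      expNeg (∫⁻ u in Set.Ioi (0 : ℝ), (1 - ∫⁻ g, cascadeLaplace γ (fun p => m p.succ)
        (fun p => f p.succ) (fun p => σ p.succ) h
        (ENNReal.ofReal (u ^ (-1 / m 0)) * (t * f 0 g)) (x + σ 0 g) ∂γ)) := by
  set T : V → (List ℕ → ℝ × X) → ℝ≥0∞ := cascadeSum (fun p => m p.succ) (fun p => f p.succ)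
    (fun p => σ p.succ) h with hT
  -- The contribution of one subtree, including the mark of its root. In `w` that mark is an
  -- independent argument, and in `w'` the exponential variable, which is not needed, is dropped.
  set v : (List ℕ → ℝ × X) → ℝ≥0∞ := fun ω => f 0 (ω []).2 * T (x + σ 0 (ω []).2) ω with hv
  set w : (ℝ × X) × (List ℕ → ℝ × X) → ℝ≥0∞ := fun p => f 0 p.1.2 * T (x + σ 0 p.1.2) p.2 with hw
  have hwm : Measurable w := by
    have h1 : Measurable fun p : (ℝ × X) × (List ℕ → ℝ × X) => T (x + σ 0 p.1.2) p.2 :=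
      measurable_cascadeSum (by fun_prop) (by fun_prop) _ (fun p => hf p.succ)
        (fun p => hσ p.succ) hh
    exact Measurable.mul (by fun_prop) h1
  have hvm : Measurable v :=
    hwm.comp (g := w) (f := fun ω : List ℕ → ℝ × X => (ω [], ω)) (by fun_prop)
  have hupd := measurePreserving_treeLaw_update_root γ
  have hvw : ∀ p : (ℝ × X) × (List ℕ → ℝ × X), v (Function.update p.2 [] p.1) = w p := by
    intro p
    simp only [hv, hw, hT, Function.update_self, cascadeSum_update_nil]
  set w' : X × (List ℕ → ℝ × X) → ℝ≥0∞ := fun p => f 0 p.1 * T (x + σ 0 p.1) p.2 with hw'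
  have hwm' : Measurable w' := by
    have h1 : Measurable fun p : X × (List ℕ → ℝ × X) => T (x + σ 0 p.1) p.2 :=
      measurable_cascadeSum (by fun_prop) (by fun_prop) _ (fun p => hf p.succ)
        (fun p => hσ p.succ) hh
    exact Measurable.mul (by fun_prop) h1
  set ρ : Measure ℝ≥0∞ := (γ.prod (treeLaw γ)).map w' with hρ
  have : IsProbabilityMeasure ρ := Measure.isProbabilityMeasure_map hwm'.aemeasurable
  -- the law of the exponential variable of a vertex and of the sum over its subtree
  have hpair : (treeLaw γ).map (fun ω => ((ω []).1, v ω)) = (expMeasure 1).prod ρ := by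
    have h1 : Measurable fun ω : List ℕ → ℝ × X => ((ω []).1, v ω) :=
      by fun_prop
    rw [← hupd.map_eq, Measure.map_map h1 hupd.measurable]
    have h2 : (fun ω : List ℕ → ℝ × X => ((ω []).1, v ω)) ∘
        (fun p : (ℝ × X) × (List ℕ → ℝ × X) => Function.update p.2 [] p.1) =
        Prod.map id w' ∘ MeasurableEquiv.prodAssoc := by
      ext p : 1
      simp only [Function.comp_apply, hvw, Function.update_self]
      rfl
    rw [h2, ← Measure.map_map (measurable_id.prodMap hwm') (MeasurableEquiv.measurable _),
      Measure.prodAssoc_prod, ← Measure.map_prod_map _ _ measurable_id hwm', Measure.map_id]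
  have hS : ∀ ω : List ℕ → ℝ × X, t * cascadeSum m f σ h x ω = ∑' j : ℕ,
      ENNReal.ofReal ((∑ k ∈ Finset.range (j + 1), (ω (k :: [])).1) ^ (-1 / m 0)) *
        (t * v fun b => ω (j :: b)) := by
    intro ω
    rw [cascadeSum_succ, ← ENNReal.tsum_mul_left]
    exact tsum_congr fun j => mul_left_comm _ _ _
  set L : (ℕ → ℝ × ℝ≥0∞) → ℝ≥0∞ := fun y => expNeg (∑' j : ℕ,
      ENNReal.ofReal ((∑ k ∈ Finset.range (j + 1), (y k).1) ^ (-1 / m 0)) * (t * (y j).2)) with hL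
  have hLm : Measurable L := by
    refine measurable_expNeg.comp (Measurable.tsum fun j => ?_)
    fun_prop
  have hΦ : ∀ s : ℝ≥0∞, ∫⁻ z, expNeg (s * (t * z)) ∂ρ = ∫⁻ g, cascadeLaplace γ
      (fun p => m p.succ) (fun p => f p.succ) (fun p => σ p.succ) h (s * (t * f 0 g))
      (x + σ 0 g) ∂γ := by
    intro s
    have h1 : Measurable fun z : ℝ≥0∞ => expNeg (s * (t * z)) :=
      measurable_expNeg.comp (by fun_prop)
    rw [hρ, lintegral_map h1 hwm']
    refine (lintegral_prod _ (h1.comp hwm').aemeasurable).trans ?_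
    simp only [cascadeLaplace, hw', hT, Function.comp_apply, mul_assoc]
  have h1 : cascadeLaplace γ m f σ h t x =
      ∫⁻ y, L y ∂(Measure.infinitePi fun _ : ℕ => (expMeasure 1).prod ρ) := by
    have h2 : Measurable fun ω : List ℕ → ℝ × X => ((ω []).1, v ω) :=
      by fun_prop
    have h3 := Measure.infinitePi_map_pi (fun _ : ℕ => treeLaw γ) (fun _ => h2)
    simp only [hpair] at h3
    have h4 : Measurable fun (ws : ℕ → List ℕ → ℝ × X) j => ((ws j []).1, v (ws j)) :=
      by fun_prop
    rw [← h3, lintegral_map hLm h4]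
    refine Eq.trans ?_ ((measurePreserving_treeLaw_children γ).lintegral_comp (hLm.comp h4))
    rw [cascadeLaplace]
    refine lintegral_congr fun ω => ?_
    rw [hS]
  rw [h1]
  set ψ : ℝ × ℝ≥0∞ → ℝ≥0∞ := fun p => expNeg (ENNReal.ofReal (p.1 ^ (-1 / m 0)) * (t * p.2))
    with hψ
  have hψm : Measurable ψ := measurable_expNeg.comp (by fun_prop)
  have hfin' : ∫⁻ u in Set.Ioi (0 : ℝ), (1 - ∫⁻ z, ψ (u, z) ∂ρ) ≠ ∞ := by
    simp only [hψ, hΦ]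
    exact hfin
  rw [lintegral_tendsto_prod_of_infinitePi_exp ρ hψm (fun p => expNeg_le_one _) ?_ hfin' ?_]
  · simp only [hψ, hΦ]
  · intro y hy
    refine tendsto_lintegral_filter_of_dominated_convergence (fun _ => 1)
      (Eventually.of_forall fun u => hψm.comp measurable_prodMk_left)
      (Eventually.of_forall fun u => Eventually.of_forall fun z => expNeg_le_one _) (by simp)
      (Eventually.of_forall fun z => ?_)
    -- The subtree sum z may be infinite, and multiplication by z is then continuous only away from
    -- 0.
    have hpos : 0 < y ^ (-1 / m 0) := Real.rpow_pos_of_pos hy _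
    have hcont : ContinuousAt (fun u : ℝ => u ^ (-1 / m 0)) y :=
      Real.continuousAt_rpow_const _ _ (Or.inl hy.ne')
    exact (continuous_expNeg.tendsto _).comp (ENNReal.Tendsto.mul_const
      (ENNReal.tendsto_ofReal hcont) (Or.inl (by simpa using hpos)))
  · refine Eventually.of_forall fun ω => ?_
    simp only [hψ, hL, ← expNeg_sum]
    exact (continuous_expNeg.tendsto _).comp (ENNReal.tendsto_nat_tsum _)

end CascadeSum

/-! ### Scaling of stable integrals -/

/-- Homogeneity of the intensity m x^{-1-m} dx, in the form of the substitution u ↦ s^{-m} u. The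
assumption `hG0` covers s = 0. -/
theorem lintegral_Ioi_rpow_mul {m : ℝ} (hm : 0 < m) {G : ℝ≥0∞ → ℝ≥0∞} (hG : Measurable G)
    (hG0 : G 0 = 0) {s : ℝ≥0∞} (hs : s ≠ ∞) :
    ∫⁻ u in Set.Ioi (0 : ℝ), G (ENNReal.ofReal (u ^ (-1 / m)) * s) =
      s ^ m * ∫⁻ u in Set.Ioi (0 : ℝ), G (ENNReal.ofReal (u ^ (-1 / m))) := by
  rcases eq_or_ne s 0 with rfl | hs0
  · simp [hG0, ENNReal.zero_rpow_of_pos hm]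
  have hpos : 0 < s.toReal := ENNReal.toReal_pos hs0 hs
  set c : ℝ := s.toReal ^ (-m) with hc
  have hcpos : 0 < c := Real.rpow_pos_of_pos hpos _
  set F : ℝ → ℝ≥0∞ := (Set.Ioi (0 : ℝ)).indicator fun u => G (ENNReal.ofReal (u ^ (-1 / m)))
    with hF
  have hFm : Measurable F := Measurable.indicator (by fun_prop) measurableSet_Ioi
  have h1 : ∀ u : ℝ, (Set.Ioi (0 : ℝ)).indicator
      (fun u => G (ENNReal.ofReal (u ^ (-1 / m)) * s)) u = F (c * u) := by
    intro u
    by_cases hu : 0 < u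
    · rw [hF, Set.indicator_of_mem (Set.mem_Ioi.mpr hu),
        Set.indicator_of_mem (Set.mem_Ioi.mpr (mul_pos hcpos hu)),
        Real.mul_rpow hcpos.le hu.le, hc, ← Real.rpow_mul hpos.le]
      have : -m * (-1 / m) = 1 := by field_simp
      rw [this, Real.rpow_one, mul_comm s.toReal,
        ENNReal.ofReal_mul (Real.rpow_nonneg hu.le _), ENNReal.ofReal_toReal hs]
    · rw [hF, Set.indicator_of_notMem (by simpa using hu), Set.indicator_of_notMem]
      simp only [Set.mem_Ioi, not_lt]
      exact mul_nonpos_of_nonneg_of_nonpos hcpos.le (not_lt.mp hu)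
  rw [← lintegral_indicator measurableSet_Ioi, ← lintegral_indicator measurableSet_Ioi,
    lintegral_congr h1, ← lintegral_map hFm (measurable_const_mul c),
    Real.map_volume_mul_left hcpos.ne', lintegral_smul_measure, smul_eq_mul]
  congr 1
  rw [abs_of_pos (inv_pos.mpr hcpos), hc, Real.rpow_neg hpos.le, inv_inv,
    ← ENNReal.ofReal_rpow_of_pos hpos, ENNReal.ofReal_toReal hs]

/-- The bound 1 is used on (0, 1], and u^{-ν/m} is integrable at infinity because ν > m. -/
theorem lintegral_Ioi_min_one_rpow_lt_top {m ν : ℝ} (hm : 0 < m) (hν : m < ν) {J : ℝ≥0∞}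
    (hJ : J ≠ ∞) :
    ∫⁻ u in Set.Ioi (0 : ℝ), min 1 (J * ENNReal.ofReal (u ^ (-1 / m)) ^ ν) ≠ ∞ := by
  have ha : -ν / m < -1 := by
    rw [div_lt_iff₀ hm]
    linarith
  have h1 : ∫⁻ u in Set.Ioc (0 : ℝ) 1, min 1 (J * ENNReal.ofReal (u ^ (-1 / m)) ^ ν) ≠ ∞ := by
    refine ((setLIntegral_mono measurable_one fun u _ => min_le_left _ _).trans_lt ?_).ne
    simp
  have h2 : ∫⁻ u in Set.Ioi (1 : ℝ), min 1 (J * ENNReal.ofReal (u ^ (-1 / m)) ^ ν) ≠ ∞ := by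
    have h3 : ∀ u ∈ Set.Ioi (1 : ℝ), min 1 (J * ENNReal.ofReal (u ^ (-1 / m)) ^ ν) ≤
        J * ENNReal.ofReal (u ^ (-ν / m)) := by
      intro u hu
      have hu0 : (0 : ℝ) < u := one_pos.trans hu
      refine (min_le_right _ _).trans_eq ?_
      rw [ENNReal.ofReal_rpow_of_pos (Real.rpow_pos_of_pos hu0 _), ← Real.rpow_mul hu0.le]
      congr 3
      ring
    refine ((setLIntegral_mono (by fun_prop) h3).trans_lt ?_).ne
    rw [lintegral_const_mul _ (by fun_prop)]
    exact ENNReal.mul_lt_top hJ.lt_top (integrableOn_Ioi_rpow_of_lt ha one_pos).lintegral_lt_top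
  rw [← Set.Ioc_union_Ioi_eq_Ioi zero_le_one,
    lintegral_union measurableSet_Ioi Set.Ioc_disjoint_Ioi_same]
  exact ENNReal.add_ne_top.mpr ⟨h1, h2⟩

/-! ### Laplace transforms of tilted cascades: scaling, finiteness and invariance. -/

section Invariance

variable {X V : Type*} [AddCommMonoid V] [MeasurableSpace X] [MeasurableSpace V] [MeasurableAdd₂ V]
variable (γ : Measure X) [IsProbabilityMeasure γ]

theorem one_sub_lintegral_prob {F : X → ℝ≥0∞} (hF : Measurable F) (h1 : ∀ g, F g ≤ 1) :
    1 - ∫⁻ g, F g ∂γ = ∫⁻ g, (1 - F g) ∂γ := by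
  have hle : ∫⁻ g, F g ∂γ ≤ 1 := (lintegral_mono h1).trans (by simp)
  rw [lintegral_sub hF (hle.trans_lt ENNReal.one_lt_top).ne (Eventually.of_forall h1)]
  simp

/-- After exchanging the two integrals, scaling extracts t f₀(g) from the Laplace variable as the
factor (t f₀(g)) ^ m₀. The tilt thus acts only as the density f₀ ^ m₀ on the mark, which is the core
of the invariance. -/
theorem lintegral_one_sub_cascadeLaplace_eq {r : ℕ} {m₀ : ℝ} (hm₀ : 0 < m₀) (m : Fin r → ℝ)
    {f : Fin r → X → ℝ≥0∞} {σ : Fin r → X → V} {h : V → ℝ≥0∞} (hf : ∀ p, Measurable (f p))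
    (hσ : ∀ p, Measurable (σ p)) (hh : Measurable h) {f₀ : X → ℝ≥0∞} (hf₀ : Measurable f₀)
    (hf₀t : ∀ g, f₀ g ≠ ∞) {σ₀ : X → V} (hσ₀ : Measurable σ₀) {t : ℝ≥0∞} (ht : t ≠ ∞) (x : V) :
    ∫⁻ u in Set.Ioi (0 : ℝ), (1 - ∫⁻ g, cascadeLaplace γ m f σ h
      (ENNReal.ofReal (u ^ (-1 / m₀)) * (t * f₀ g)) (x + σ₀ g) ∂γ) =
    t ^ m₀ * ∫⁻ g, f₀ g ^ m₀ * (∫⁻ u in Set.Ioi (0 : ℝ),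
      (1 - cascadeLaplace γ m f σ h (ENNReal.ofReal (u ^ (-1 / m₀))) (x + σ₀ g))) ∂γ := by
  have hL := measurable_cascadeLaplace γ m hf hσ hh
  have hm1 : Measurable fun q : ℝ × X => 1 - cascadeLaplace γ m f σ h
      (ENNReal.ofReal (q.1 ^ (-1 / m₀)) * (t * f₀ q.2)) (x + σ₀ q.2) := by
    refine measurable_const.sub (hL.comp (g := fun q : ℝ≥0∞ × V => _)
      (f := fun q : ℝ × X => (ENNReal.ofReal (q.1 ^ (-1 / m₀)) * (t * f₀ q.2), x + σ₀ q.2)) ?_)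
    fun_prop
  have h1 : ∀ u : ℝ, 1 - ∫⁻ g, cascadeLaplace γ m f σ h
      (ENNReal.ofReal (u ^ (-1 / m₀)) * (t * f₀ g)) (x + σ₀ g) ∂γ =
      ∫⁻ g, (1 - cascadeLaplace γ m f σ h
      (ENNReal.ofReal (u ^ (-1 / m₀)) * (t * f₀ g)) (x + σ₀ g)) ∂γ := by
    intro u
    refine one_sub_lintegral_prob γ ?_ fun g => cascadeLaplace_le_one γ _ _ _ _ _ _
    exact hL.comp (g := fun q : ℝ≥0∞ × V => _)
      (f := fun g : X => (ENNReal.ofReal (u ^ (-1 / m₀)) * (t * f₀ g), x + σ₀ g)) (by fun_prop)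
  rw [lintegral_congr h1, lintegral_lintegral_swap hm1.aemeasurable, ← lintegral_const_mul]
  · refine lintegral_congr fun g => ?_
    rw [← mul_assoc, ← ENNReal.mul_rpow_of_nonneg _ _ hm₀.le]
    refine lintegral_Ioi_rpow_mul hm₀ (G := fun s => 1 - cascadeLaplace γ m f σ h s (x + σ₀ g))
      ?_ ?_ (ENNReal.mul_ne_top ht (hf₀t g))
    · exact measurable_const.sub (hL.comp (g := fun q : ℝ≥0∞ × V => _)
        (f := fun s : ℝ≥0∞ => (s, x + σ₀ g)) (by fun_prop))
    · simp [cascadeLaplace, expNeg_zero]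
  · refine Measurable.mul (by fun_prop) (Measurable.lintegral_prod_left' (f := fun q : ℝ × X =>
      1 - cascadeLaplace γ m f σ h (ENNReal.ofReal (q.1 ^ (-1 / m₀))) (x + σ₀ q.2)) ?_)
    exact measurable_const.sub (hL.comp (g := fun q : ℝ≥0∞ × V => _)
      (f := fun q : ℝ × X => (ENNReal.ofReal (q.1 ^ (-1 / m₀)), x + σ₀ q.2)) (by fun_prop))

/-- The exponent ν is the parameter of the top level, or 1 at depth 0. The clause about μ records
this in a form that the induction can use: the parameter of a new top level, smaller than all others
and than 1, lies below the ν of the subtrees, so the integral over the Poisson points is finite. -/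
theorem exists_one_sub_cascadeLaplace_le {h : V → ℝ≥0∞} (hh : Measurable h) {M : ℝ≥0∞} (hM : M ≠ ∞)
    (hhM : ∀ x, h x ≤ M) {r : ℕ} {m : Fin r → ℝ} (hm0 : ∀ p, 0 < m p) (hm1 : ∀ p, m p < 1)
    (hmono : StrictMono m) {f : Fin r → X → ℝ≥0∞} {σ : Fin r → X → V} (hf : ∀ p, Measurable (f p))
    (hσ : ∀ p, Measurable (σ p)) (hft : ∀ p g, f p g ≠ ∞) (hfm : ∀ p, ∫⁻ g, f p g ^ m p ∂γ ≠ ∞) :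
    ∃ ν > 0, (∀ μ < 1, (∀ p, μ < m p) → μ < ν) ∧ ∃ J ≠ ∞, ∀ t ≠ ∞, ∀ x,
      1 - cascadeLaplace γ m f σ h t x ≤ J * t ^ ν := by
  induction r with
  | zero =>
    refine ⟨1, one_pos, fun μ hμ _ => hμ, M, hM, fun t _ x => ?_⟩
    rw [cascadeLaplace_zero, ENNReal.rpow_one, mul_comm M]
    exact (one_sub_expNeg_le _).trans (mul_le_mul_right (hhM x) t)
  | succ r ih =>
    obtain ⟨ν, hν0, hν, J, hJ, hbound⟩ := ih (m := fun p => m p.succ) (fun p => hm0 p.succ)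
      (fun p => hm1 p.succ) (fun p q hpq => hmono (Fin.succ_lt_succ_iff.mpr hpq))
      (f := fun p => f p.succ) (σ := fun p => σ p.succ)
      (fun p => hf p.succ) (fun p => hσ p.succ) (fun p => hft p.succ) (fun p => hfm p.succ)
    have hmν : m 0 < ν := hν _ (hm1 0) fun p => hmono (Fin.succ_pos p)
    set I := ∫⁻ u in Set.Ioi (0 : ℝ), min 1 (J * ENNReal.ofReal (u ^ (-1 / m 0)) ^ ν) with hI
    have hIt : I ≠ ∞ := lintegral_Ioi_min_one_rpow_lt_top (hm0 0) hmν hJ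
    have hIg : ∀ x, ∫⁻ u in Set.Ioi (0 : ℝ), (1 - cascadeLaplace γ (fun p => m p.succ)
        (fun p => f p.succ) (fun p => σ p.succ) h (ENNReal.ofReal (u ^ (-1 / m 0))) x) ≤ I :=
      fun x => lintegral_mono fun u => le_min tsub_le_self (hbound _ ENNReal.ofReal_ne_top _)
    refine ⟨m 0, hm0 0, fun μ _ h => h 0, (∫⁻ g, f 0 g ^ m 0 ∂γ) * I,
      ENNReal.mul_ne_top (hfm 0) hIt, fun t ht x => ?_⟩
    have hle : ∫⁻ u in Set.Ioi (0 : ℝ), (1 - ∫⁻ g, cascadeLaplace γ (fun p => m p.succ)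
        (fun p => f p.succ) (fun p => σ p.succ) h
        (ENNReal.ofReal (u ^ (-1 / m 0)) * (t * f 0 g)) (x + σ 0 g) ∂γ) ≤
        (∫⁻ g, f 0 g ^ m 0 ∂γ) * I * t ^ m 0 := by
      rw [lintegral_one_sub_cascadeLaplace_eq γ (hm0 0) _ (fun p => hf p.succ)
        (fun p => hσ p.succ) hh (hf 0) (hft 0) (hσ 0) ht, mul_comm _ (t ^ m 0),
        ← lintegral_mul_const _ ((hf 0).pow_const _)]
      exact mul_le_mul_right (lintegral_mono fun g => mul_le_mul_right (hIg _) _) _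
    rw [cascadeLaplace_succ γ m hf hσ hh t x (hle.trans_lt (ENNReal.mul_lt_top
      (ENNReal.mul_lt_top (hfm 0).lt_top hIt.lt_top)
      (ENNReal.rpow_lt_top_of_nonneg (hm0 0).le ht))).ne]
    exact (one_sub_expNeg_le _).trans hle

theorem lintegral_one_sub_cascadeLaplace_ne_top {h : V → ℝ≥0∞} (hh : Measurable h) {M : ℝ≥0∞}
    (hM : M ≠ ∞) (hhM : ∀ x, h x ≤ M) {r : ℕ} {m : Fin (r + 1) → ℝ} (hm0 : ∀ p, 0 < m p)
    (hm1 : ∀ p, m p < 1) (hmono : StrictMono m) {f : Fin (r + 1) → X → ℝ≥0∞}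
    {σ : Fin (r + 1) → X → V} (hf : ∀ p, Measurable (f p))
    (hσ : ∀ p, Measurable (σ p)) (hft : ∀ p g, f p g ≠ ∞) (hfm : ∀ p, ∫⁻ g, f p g ^ m p ∂γ ≠ ∞)
    {t : ℝ≥0∞} (ht : t ≠ ∞) (x : V) :
    ∫⁻ u in Set.Ioi (0 : ℝ), (1 - ∫⁻ g, cascadeLaplace γ (fun p => m p.succ)
        (fun p => f p.succ) (fun p => σ p.succ) h
        (ENNReal.ofReal (u ^ (-1 / m 0)) * (t * f 0 g)) (x + σ 0 g) ∂γ) ≠ ∞ := by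
  obtain ⟨ν, hν0, hν, J, hJ, hbound⟩ := exists_one_sub_cascadeLaplace_le γ hh hM hhM
    (m := fun p => m p.succ) (fun p => hm0 p.succ)
    (fun p => hm1 p.succ) (fun p q hpq => hmono (Fin.succ_lt_succ_iff.mpr hpq))
    (f := fun p => f p.succ) (σ := fun p => σ p.succ)
    (fun p => hf p.succ) (fun p => hσ p.succ) (fun p => hft p.succ) (fun p => hfm p.succ)
  have hmν : m 0 < ν := hν _ (hm1 0) fun p => hmono (Fin.succ_pos p)
  have hIt := lintegral_Ioi_min_one_rpow_lt_top (hm0 0) hmν hJ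
  rw [lintegral_one_sub_cascadeLaplace_eq γ (hm0 0) _ (fun p => hf p.succ)
    (fun p => hσ p.succ) hh (hf 0) (hft 0) (hσ 0) ht]
  refine ENNReal.mul_ne_top (ENNReal.rpow_lt_top_of_nonneg (hm0 0).le ht).ne ?_
  refine ne_top_of_le_ne_top (ENNReal.mul_ne_top (hfm 0) hIt) ?_
  rw [← lintegral_mul_const _ ((hf 0).pow_const _)]
  exact lintegral_mono fun g => mul_le_mul_right (lintegral_mono fun u =>
    le_min tsub_le_self (hbound _ ENNReal.ofReal_ne_top _)) _

/-- Induction on the depth. The subtrees contribute a factor κ in the Laplace variable, which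
scaling turns into κ ^ m, and the top level contributes the normalization K of its tilt. Since κ ^ m
· K · t ^ m = (κ K^{1/m} t) ^ m, the new constant is κ K^{1/m}. It does not depend on h, as is
needed later for joint laws. -/
theorem exists_cascadeLaplace_eq_of_bounded {r : ℕ} {m : Fin r → ℝ} (hm0 : ∀ p, 0 < m p)
    (hm1 : ∀ p, m p < 1) (hmono : StrictMono m) {f : Fin r → X → ℝ≥0∞} {σ τ : Fin r → X → V}
    (hf : ∀ p, Measurable (f p)) (hσ : ∀ p, Measurable (σ p)) (hτ : ∀ p, Measurable (τ p))
    (hft : ∀ p g, f p g ≠ ∞) (htilt : ∀ p, ∃ K ≠ 0, K ≠ ∞ ∧ ∀ F : V → ℝ≥0∞, Measurable F →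
      ∫⁻ g, f p g ^ m p * F (σ p g) ∂γ = K * ∫⁻ g, F (τ p g) ∂γ) :
    ∃ κ ≠ 0, κ ≠ ∞ ∧ ∀ h : V → ℝ≥0∞, Measurable h → ∀ M ≠ ∞, (∀ x, h x ≤ M) → ∀ t ≠ ∞, ∀ x,
      cascadeLaplace γ m f σ h t x = cascadeLaplace γ m (fun _ _ => 1) τ h (κ * t) x := by
  induction r with
  | zero =>
    refine ⟨1, one_ne_zero, ENNReal.one_ne_top, fun h hh M hM hhM t ht x => ?_⟩
    rw [cascadeLaplace_zero, cascadeLaplace_zero, one_mul]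
  | succ r ih =>
    obtain ⟨κ, hκ0, hκt, hκ⟩ := ih (m := fun p => m p.succ) (fun p => hm0 p.succ)
      (fun p => hm1 p.succ) (fun p q hpq => hmono (Fin.succ_lt_succ_iff.mpr hpq))
      (f := fun p => f p.succ) (σ := fun p => σ p.succ) (τ := fun p => τ p.succ)
      (fun p => hf p.succ) (fun p => hσ p.succ) (fun p => hτ p.succ) (fun p => hft p.succ)
      (fun p => htilt p.succ)
    obtain ⟨K, hK0, hKt, hK⟩ := htilt 0
    have hfm : ∀ p, ∫⁻ g, f p g ^ m p ∂γ ≠ ∞ := fun p => by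
      obtain ⟨K, -, hKt, hK⟩ := htilt p
      have := hK (fun _ => 1) measurable_const
      simp only [mul_one, lintegral_const, measure_univ] at this
      rwa [this]
    refine ⟨κ * K ^ (1 / m 0), mul_ne_zero hκ0 ?_, ENNReal.mul_ne_top hκt ?_,
      fun h hh M hM hhM t ht x => ?_⟩
    · simp [ENNReal.rpow_eq_zero_iff, hK0, hKt]
    · simp [ENNReal.rpow_eq_top_iff, hK0, hKt]
    have hKm : (K ^ (1 / m 0)) ^ m 0 = K := by
      rw [← ENNReal.rpow_mul, one_div_mul_cancel (hm0 0).ne', ENNReal.rpow_one]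
    have hKt' : K ^ (1 / m 0) ≠ ∞ := by simp [ENNReal.rpow_eq_top_iff, hK0, hKt]
    have hct : κ * K ^ (1 / m 0) * t ≠ ∞ :=
      ENNReal.mul_ne_top (ENNReal.mul_ne_top hκt hKt') ht
    rw [cascadeLaplace_succ γ m hf hσ hh t x (lintegral_one_sub_cascadeLaplace_ne_top γ hh hM hhM
        hm0 hm1 hmono hf hσ hft hfm ht x),
      cascadeLaplace_succ γ m (fun _ => measurable_const) hτ hh _ x
        (lintegral_one_sub_cascadeLaplace_ne_top γ hh hM hhM
        hm0 hm1 hmono (fun _ => measurable_const) hτ (fun _ _ => ENNReal.one_ne_top)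
        (fun p => by simp) hct x),
      lintegral_one_sub_cascadeLaplace_eq γ (hm0 0) _ (fun p => hf p.succ)
        (fun p => hσ p.succ) hh (hf 0) (hft 0) (hσ 0) ht,
      lintegral_one_sub_cascadeLaplace_eq γ (hm0 0) _ (fun _ => measurable_const)
        (fun p => hτ p.succ) hh measurable_const (fun _ => ENNReal.one_ne_top) (hτ 0) hct]
    congr 1
    have hL := measurable_cascadeLaplace γ (fun p : Fin r => m p.succ)
      (f := fun _ _ => 1) (fun _ => measurable_const)
      (σ := fun p => τ p.succ) (fun p => hτ p.succ) hh
    have hscale : ∀ y, ∫⁻ u in Set.Ioi (0 : ℝ), (1 - cascadeLaplace γ (fun p => m p.succ)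
        (fun p => f p.succ) (fun p => σ p.succ) h (ENNReal.ofReal (u ^ (-1 / m 0))) y) =
        κ ^ m 0 * ∫⁻ u in Set.Ioi (0 : ℝ), (1 - cascadeLaplace γ (fun p => m p.succ)
        (fun _ _ => 1) (fun p => τ p.succ) h (ENNReal.ofReal (u ^ (-1 / m 0))) y) := by
      intro y
      rw [← lintegral_Ioi_rpow_mul (hm0 0) (G := fun s => 1 - cascadeLaplace γ (fun p => m p.succ)
        (fun _ _ => 1) (fun p => τ p.succ) h s y) _ _ hκt]
      · refine lintegral_congr fun u => ?_
        rw [hκ h hh M hM hhM _ ENNReal.ofReal_ne_top, mul_comm κ]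
      · exact measurable_const.sub (hL.comp (g := fun q : ℝ≥0∞ × V => _)
          (f := fun s : ℝ≥0∞ => (s, y)) (by fun_prop))
      · simp [cascadeLaplace, expNeg_zero]
    simp only [hscale, ENNReal.one_rpow, one_mul]
    have hΨ : Measurable fun y => ∫⁻ u in Set.Ioi (0 : ℝ), (1 - cascadeLaplace γ
        (fun p => m p.succ) (fun _ _ => 1) (fun p => τ p.succ) h
        (ENNReal.ofReal (u ^ (-1 / m 0))) y) := by
      refine Measurable.lintegral_prod_left' (f := fun q : ℝ × V =>
        1 - cascadeLaplace γ (fun p => m p.succ) (fun _ _ => 1) (fun p => τ p.succ) h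
          (ENNReal.ofReal (q.1 ^ (-1 / m 0))) q.2) ?_
      exact measurable_const.sub (hL.comp (g := fun q : ℝ≥0∞ × V => _)
        (f := fun q : ℝ × V => (ENNReal.ofReal (q.1 ^ (-1 / m 0)), q.2)) (by fun_prop))
    rw [hK (fun y => κ ^ m 0 * ∫⁻ u in Set.Ioi (0 : ℝ), (1 - cascadeLaplace γ
        (fun p => m p.succ) (fun _ _ => 1) (fun p => τ p.succ) h
        (ENNReal.ofReal (u ^ (-1 / m 0))) (x + y))) ((hΨ.comp (measurable_const_add x)).const_mul _),
      lintegral_const_mul' _ _ (ENNReal.rpow_lt_top_of_nonneg (hm0 0).le hκt).ne,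
      ENNReal.mul_rpow_of_nonneg _ _ (hm0 0).le, ENNReal.mul_rpow_of_nonneg _ _ (hm0 0).le, hKm]
    ring

omit [MeasurableSpace X] [MeasurableSpace V] [MeasurableAdd₂ V] in
theorem tendsto_cascadeSum_min {r : ℕ} (m : Fin r → ℝ) (f : Fin r → X → ℝ≥0∞) (σ : Fin r → X → V)
    (h : V → ℝ≥0∞) (x : V) (ω : List ℕ → ℝ × X) :
    Tendsto (fun N : ℕ => cascadeSum m f σ (fun y => min (h y) N) x ω) atTop
      (𝓝 (cascadeSum m f σ h x ω)) := by
  let _ : MeasurableSpace (Fin r → ℕ) := ⊤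
  simp only [cascadeSum, ← lintegral_count]
  refine lintegral_tendsto_of_tendsto_of_monotone (fun N => Measurable.of_discrete.aemeasurable)
    (Eventually.of_forall fun α N M hNM => ?_) (Eventually.of_forall fun α => ?_)
  · exact mul_le_mul_right (min_le_min_left _ (by exact_mod_cast hNM)) _
  · have h1 := (tendsto_const_nhds (x := h (x + ∑ p, σ p (ω (anc α (p + 1))).2))).min
      ENNReal.tendsto_nat_nhds_top
    rw [min_eq_left le_top] at h1
    by_cases h0 : h (x + ∑ p, σ p (ω (anc α (p + 1))).2) = 0
    · simp [h0]
    · exact ENNReal.Tendsto.const_mul h1 (Or.inl h0)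

/-- **Invariance of the cascade under tilting**, for the Laplace transforms. -/
theorem exists_cascadeLaplace_eq {r : ℕ} {m : Fin r → ℝ} (hm0 : ∀ p, 0 < m p)
    (hm1 : ∀ p, m p < 1) (hmono : StrictMono m) {f : Fin r → X → ℝ≥0∞} {σ τ : Fin r → X → V}
    (hf : ∀ p, Measurable (f p)) (hσ : ∀ p, Measurable (σ p)) (hτ : ∀ p, Measurable (τ p))
    (hft : ∀ p g, f p g ≠ ∞) (htilt : ∀ p, ∃ K ≠ 0, K ≠ ∞ ∧ ∀ F : V → ℝ≥0∞, Measurable F →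
      ∫⁻ g, f p g ^ m p * F (σ p g) ∂γ = K * ∫⁻ g, F (τ p g) ∂γ) :
    ∃ κ ≠ 0, κ ≠ ∞ ∧ ∀ h : V → ℝ≥0∞, Measurable h → ∀ x,
      cascadeLaplace γ m f σ h 1 x = cascadeLaplace γ m (fun _ _ => 1) τ h κ x := by
  obtain ⟨κ, hκ0, hκt, hκ⟩ := exists_cascadeLaplace_eq_of_bounded γ hm0 hm1 hmono hf hσ hτ hft htilt
  refine ⟨κ, hκ0, hκt, fun h hh x => ?_⟩
  -- Boundedness of h is removed by truncation at N: both Laplace transforms converge, and κ is the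
  -- same for every N.
  have hlim : ∀ {f : Fin r → X → ℝ≥0∞} {σ : Fin r → X → V}, (∀ p, Measurable (f p)) →
      (∀ p, Measurable (σ p)) → ∀ t ≠ 0, t ≠ ∞ → Tendsto (fun N : ℕ => cascadeLaplace γ m f σ
        (fun y => min (h y) N) t x) atTop (𝓝 (cascadeLaplace γ m f σ h t x)) := by
    intro f σ hf hσ t ht0 htt
    have hmeas : ∀ N : ℕ, Measurable fun ω => cascadeSum m f σ (fun y => min (h y) N) x ω :=
      fun N => measurable_cascadeSum measurable_const measurable_id m hf hσ (by fun_prop)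
    refine tendsto_lintegral_of_dominated_convergence (fun _ => 1)
      (fun N => measurable_expNeg.comp ((hmeas N).const_mul t))
      (fun N => Eventually.of_forall fun ω => expNeg_le_one _) (by simp)
      (Eventually.of_forall fun ω => ?_)
    exact (continuous_expNeg.tendsto _).comp (ENNReal.Tendsto.const_mul
      (tendsto_cascadeSum_min m f σ h x ω) (Or.inr htt))
  refine tendsto_nhds_unique (hlim hf hσ 1 one_ne_zero ENNReal.one_ne_top)
    ((hlim (f := fun _ _ => 1) (fun _ => measurable_const) hτ κ hκ0 hκt).congr fun N => ?_)
  rw [hκ _ (by fun_prop) N (ENNReal.natCast_ne_top N) (fun x => min_le_right _ _) 1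
    ENNReal.one_ne_top, mul_one]

/-- Where the sum is infinite, `expNeg` of t times the sum is 0 for every t > 0. The probability of
this event is therefore at most 1 minus the Laplace transform, which is at most J t^ν, and t → 0. -/
theorem ae_cascadeSum_ne_top {h : V → ℝ≥0∞} (hh : Measurable h) {M : ℝ≥0∞}
    (hM : M ≠ ∞) (hhM : ∀ x, h x ≤ M) {r : ℕ} {m : Fin r → ℝ} (hm0 : ∀ p, 0 < m p)
    (hm1 : ∀ p, m p < 1) (hmono : StrictMono m) {f : Fin r → X → ℝ≥0∞}
    {σ : Fin r → X → V} (hf : ∀ p, Measurable (f p))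
    (hσ : ∀ p, Measurable (σ p)) (hft : ∀ p g, f p g ≠ ∞) (hfm : ∀ p, ∫⁻ g, f p g ^ m p ∂γ ≠ ∞)
    (x : V) : ∀ᵐ ω ∂(treeLaw γ), cascadeSum m f σ h x ω ≠ ∞ := by
  obtain ⟨ν, hν0, -, J, hJ, hbound⟩ := exists_one_sub_cascadeLaplace_le γ hh hM hhM hm0 hm1 hmono
    hf hσ hft hfm
  have hmeas : Measurable fun ω => cascadeSum m f σ h x ω :=
    measurable_cascadeSum measurable_const measurable_id m hf hσ hh
  have hle : ∀ t ≠ 0, t ≠ ∞ → treeLaw γ {ω | cascadeSum m f σ h x ω = ∞} ≤ J * t ^ ν := by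
    intro t ht0 htt
    refine le_trans ?_ (hbound t htt x)
    rw [cascadeLaplace, one_sub_lintegral_prob (treeLaw γ)
      (F := fun ω => expNeg (t * cascadeSum m f σ h x ω)) (measurable_expNeg.comp
      (hmeas.const_mul t)) (fun _ => expNeg_le_one _),
      ← lintegral_indicator_one
        (show MeasurableSet {ω | cascadeSum m f σ h x ω = ∞} from hmeas (measurableSet_singleton ∞))]
    refine lintegral_mono fun ω => ?_
    by_cases hω : cascadeSum m f σ h x ω = ∞
    · simp [hω, ENNReal.mul_top ht0, expNeg_top]
    · simp [hω]
  have hlim : Tendsto (fun N : ℕ => J * ((N : ℝ≥0∞)⁻¹) ^ ν) atTop (𝓝 0) := by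
    have h1 := ENNReal.Tendsto.const_mul (a := J)
      ((ENNReal.continuous_rpow_const (y := ν)).tendsto 0 |>.comp ENNReal.tendsto_inv_nat_nhds_zero)
      (Or.inr hJ)
    rwa [ENNReal.zero_rpow_of_pos hν0, mul_zero] at h1
  rw [ae_iff]
  simp only [not_not]
  refine le_antisymm (ge_of_tendsto hlim ?_) (zero_le)
  filter_upwards [eventually_gt_atTop 0] with N hN
  exact hle _ (by simp) (by simp [hN.ne'])

end Invariance

/-! ### Uniqueness of Laplace transforms -/

/-- The bounded continuous function `v ↦ exp (-v i)` on `[0, ∞]^ι`. -/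
noncomputable def expNegCoord {ι : Type*} (i : ι) :
    BoundedContinuousFunction (ι → ℝ≥0∞) ℝ :=
  BoundedContinuousFunction.ofNormedAddCommGroup (fun v => (expNeg (v i)).toReal)
    ((ENNReal.continuousOn_toReal.comp_continuous continuous_expNeg fun t =>
      ((expNeg_le_one t).trans_lt ENNReal.one_lt_top).ne).comp (continuous_apply i)) 1 fun v => by
    rw [Real.norm_of_nonneg ENNReal.toReal_nonneg]
    simpa using ENNReal.toReal_mono ENNReal.one_ne_top (expNeg_le_one (v i))

/-- The functions exp(-v_i) separate the points of [0, ∞]^ι, and the algebra they generate is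
spanned by the monomials exp(-∑ n_i v_i). Natural exponents therefore suffice. -/
theorem ext_of_laplace {ι : Type*} [Fintype ι] {μ ν : Measure (ι → ℝ≥0∞)} [IsProbabilityMeasure μ]
    [IsProbabilityMeasure ν] (h : ∀ n : ι → ℕ, ∫⁻ v, expNeg (∑ i, n i * v i) ∂μ =
      ∫⁻ v, expNeg (∑ i, n i * v i) ∂ν) : μ = ν := by
  set A₀ : Subalgebra ℝ (BoundedContinuousFunction (ι → ℝ≥0∞) ℝ) :=
    Algebra.adjoin ℝ (Set.range expNegCoord) with hA₀
  set A : StarSubalgebra ℝ (BoundedContinuousFunction (ι → ℝ≥0∞) ℝ) :=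
    { A₀ with
      star_mem' := fun {a} ha => by
        have : star a = a := by ext; simp
        rw [this]
        exact ha } with hA
  refine ext_of_forall_mem_subalgebra_integral_eq_of_polish (𝕜 := ℝ) (A := A) ?_ ?_
  · intro v w hvw
    obtain ⟨i, hi⟩ := Function.ne_iff.mp hvw
    refine ⟨expNegCoord i, ⟨BoundedContinuousFunction.toContinuousMap (expNegCoord i),
      ⟨expNegCoord i, Algebra.subset_adjoin ⟨i, rfl⟩, rfl⟩, rfl⟩, fun heq => hi ?_⟩
    have hne : ∀ t, expNeg t ≠ ∞ := fun t => ((expNeg_le_one t).trans_lt ENNReal.one_lt_top).ne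
    exact expNeg_injective ((ENNReal.toReal_eq_toReal_iff' (hne _) (hne _)).mp heq)
  · intro g hg
    have hg' : g ∈ Submodule.span ℝ (Submonoid.closure (Set.range (expNegCoord (ι := ι))) :
        Set (BoundedContinuousFunction (ι → ℝ≥0∞) ℝ)) := by
      rw [← Algebra.adjoin_eq_span]
      exact hg
    clear hg
    induction hg' using Submodule.span_induction with
    | mem x hx =>
      obtain ⟨n, rfl⟩ := Submonoid.exists_of_mem_closure_range _ _ hx
      have h1 : ∀ v, (∏ i, expNegCoord i ^ n i : BoundedContinuousFunction (ι → ℝ≥0∞) ℝ) v =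
          (expNeg (∑ i, n i * v i)).toReal := by
        intro v
        have h2 : ∀ s : Finset ι, (∏ i ∈ s, expNegCoord i ^ n i :
            BoundedContinuousFunction (ι → ℝ≥0∞) ℝ) v = ∏ i ∈ s, (expNeg (v i)).toReal ^ n i := by
          classical
          intro s
          induction s using Finset.induction_on with
          | empty => simp
          | insert a s ha ih =>
            rw [Finset.prod_insert ha, Finset.prod_insert ha, BoundedContinuousFunction.mul_apply,
              ih]
            rfl
        rw [h2, expNeg_sum, ENNReal.toReal_prod]
        refine Finset.prod_congr rfl fun i _ => ?_
        rw [expNeg_nsmul, ENNReal.toReal_pow]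
      have hm : Measurable fun v : ι → ℝ≥0∞ => expNeg (∑ i, n i * v i) :=
        measurable_expNeg.comp (by fun_prop)
      simp only [h1]
      rw [integral_toReal hm.aemeasurable, integral_toReal hm.aemeasurable, h n] <;>
        exact Eventually.of_forall fun v => (expNeg_le_one _).trans_lt ENNReal.one_lt_top
    | zero => simp
    | add x y _ _ hx hy =>
      simp only [BoundedContinuousFunction.coe_add, Pi.add_apply]
      rw [integral_add (x.integrable μ) (y.integrable μ),
        integral_add (x.integrable ν) (y.integrable ν), hx, hy]
    | smul c x _ hx =>
      simp only [BoundedContinuousFunction.coe_smul, integral_smul]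
      rw [hx]

/-! ### Joint laws of several tilted cascades. -/

section Invariance

variable {X V : Type*} [AddCommMonoid V] [MeasurableSpace X] [MeasurableSpace V] [MeasurableAdd₂ V]
variable (γ : Measure X) [IsProbabilityMeasure γ]

/-- **Invariance of the cascade under tilting** (Bolthausen-Sznitman): if the increments `σ` tilted
by `f ^ m` have the law of `τ` up to a constant, then the joint law of cascades with the tilts `f`
and the increments `σ` is the joint law of cascades without tilts and with the increments `τ`, up to
a common constant factor. -/
theorem exists_map_cascadeSum_eq {r : ℕ} {m : Fin r → ℝ} (hm0 : ∀ p, 0 < m p)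
    (hm1 : ∀ p, m p < 1) (hmono : StrictMono m) {f : Fin r → X → ℝ≥0∞} {σ τ : Fin r → X → V}
    (hf : ∀ p, Measurable (f p)) (hσ : ∀ p, Measurable (σ p)) (hτ : ∀ p, Measurable (τ p))
    (hft : ∀ p g, f p g ≠ ∞) (htilt : ∀ p, ∃ K ≠ 0, K ≠ ∞ ∧ ∀ F : V → ℝ≥0∞, Measurable F →
      ∫⁻ g, f p g ^ m p * F (σ p g) ∂γ = K * ∫⁻ g, F (τ p g) ∂γ) :
    ∃ κ ≠ 0, κ ≠ ∞ ∧ ∀ {ι : Type} [Fintype ι] (h : ι → V → ℝ≥0∞), (∀ i, Measurable (h i)) → ∀ x,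
      (treeLaw γ).map (fun ω i => cascadeSum m f σ (h i) x ω) =
        (treeLaw γ).map (fun ω i => κ * cascadeSum m (fun _ _ => 1) τ (h i) x ω) := by
  obtain ⟨κ, hκ0, hκt, hκ⟩ := exists_cascadeLaplace_eq γ hm0 hm1 hmono hf hσ hτ hft htilt
  refine ⟨κ, hκ0, hκt, fun {ι} _ h hh x => ?_⟩
  have hm₁ : Measurable fun ω i => cascadeSum m f σ (h i) x ω := measurable_pi_lambda _ fun i =>
    measurable_cascadeSum measurable_const measurable_id m hf hσ (hh i)
  have hm₂ : Measurable fun ω i => κ * cascadeSum m (fun _ _ => 1) τ (h i) x ω :=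
    measurable_pi_lambda _ fun i => (measurable_cascadeSum measurable_const measurable_id m
      (fun _ => measurable_const) hτ (hh i)).const_mul κ
  have := Measure.isProbabilityMeasure_map (μ := treeLaw γ) hm₁.aemeasurable
  have := Measure.isProbabilityMeasure_map (μ := treeLaw γ) hm₂.aemeasurable
  refine ext_of_laplace fun n => ?_
  have hm : Measurable fun v : ι → ℝ≥0∞ => expNeg (∑ i, n i * v i) :=
    measurable_expNeg.comp (by fun_prop)
  rw [lintegral_map hm hm₁, lintegral_map hm hm₂]
  -- A linear combination of cascade sums over the same tree is again a cascade sum, so a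
  -- one-dimensional Laplace transform determines the joint law.
  have h1 := hκ (fun y => ∑ i, n i * h i y) (by fun_prop) x
  simp only [cascadeLaplace, cascadeSum_finset_sum, cascadeSum_const_mul, one_mul] at h1
  rw [h1]
  refine lintegral_congr fun ω => ?_
  rw [Finset.mul_sum]
  simp only [mul_left_comm κ]

end Invariance

/-! ### Exponential tilts of Gaussian measures -/

theorem lintegral_exp_mul_gaussianReal (t : ℝ) :
    ∫⁻ x, ENNReal.ofReal (Real.exp (t * x)) ∂(gaussianReal 0 1) =
      ENNReal.ofReal (Real.exp (t ^ 2 / 2)) := by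
  rw [← ofReal_integral_eq_lintegral_ofReal (integrable_exp_mul_gaussianReal t)
    (Eventually.of_forall fun x => (Real.exp_pos _).le)]
  have h := congrFun (mgf_fun_id_gaussianReal (μ := 0) (v := 1)) t
  simp only [mgf, zero_mul, zero_add, NNReal.coe_one, one_mul] at h
  rw [h]

theorem gaussianReal_withDensity_exp (t : ℝ) :
    (gaussianReal 0 1).withDensity (fun x => ENNReal.ofReal (Real.exp (t * x - t ^ 2 / 2))) =
      gaussianReal t 1 := by
  rw [gaussianReal_of_var_ne_zero _ one_ne_zero, gaussianReal_of_var_ne_zero _ one_ne_zero,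
    ← withDensity_mul _ (measurable_gaussianPDF 0 1) (by fun_prop)]
  congr 1
  ext x
  simp only [Pi.mul_apply, gaussianPDF, gaussianPDFReal]
  rw [← ENNReal.ofReal_mul (by positivity), mul_assoc, ← Real.exp_add]
  congr 3
  simp only [NNReal.coe_one]
  ring

theorem pi_gaussianReal_withDensity_exp {ι : Type*} [Fintype ι] (t : ℝ) :
    (Measure.pi fun _ : ι => gaussianReal 0 1).withDensity
      (fun g => ∏ i, ENNReal.ofReal (Real.exp (t * g i - t ^ 2 / 2))) =
      Measure.pi fun _ : ι => gaussianReal t 1 := by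
  symm
  refine Measure.pi_eq fun s hs => ?_
  have h1 : ∀ g : ι → ℝ, (Set.univ.pi s).indicator
      (fun g => ∏ i, ENNReal.ofReal (Real.exp (t * g i - t ^ 2 / 2))) g =
      ∏ i, (s i).indicator (fun x => ENNReal.ofReal (Real.exp (t * x - t ^ 2 / 2))) (g i) := by
    intro g
    by_cases hg : g ∈ Set.univ.pi s
    · rw [Set.indicator_of_mem hg]
      refine Finset.prod_congr rfl fun i _ => ?_
      rw [Set.indicator_of_mem (hg i trivial)]
    · rw [Set.indicator_of_notMem hg]
      simp only [Set.mem_pi, Set.mem_univ, true_imp_iff, not_forall] at hg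
      obtain ⟨i, hi⟩ := hg
      exact (Finset.prod_eq_zero (Finset.mem_univ i) (Set.indicator_of_notMem hi _)).symm
  have h2 : ∀ i, Measurable
      ((s i).indicator fun x => ENNReal.ofReal (Real.exp (t * x - t ^ 2 / 2))) := fun i =>
    Measurable.indicator (by fun_prop) (hs i)
  rw [withDensity_apply _ (.univ_pi hs), ← lintegral_indicator (.univ_pi hs), lintegral_congr h1,
    lintegral_prod_eq_prod_lintegral_of_indepFun _ (fun i (g : ι → ℝ) => (s i).indicator
      (fun x => ENNReal.ofReal (Real.exp (t * x - t ^ 2 / 2))) (g i))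
      (iIndepFun_pi fun i => (h2 i).aemeasurable) (fun i => (h2 i).comp (measurable_pi_apply i))]
  refine Finset.prod_congr rfl fun i _ => ?_
  rw [(measurePreserving_eval (fun _ : ι => gaussianReal 0 1) i).lintegral_comp (h2 i),
    lintegral_indicator (hs i), ← withDensity_apply _ (hs i), gaussianReal_withDensity_exp]

/-- Cameron–Martin in the direction (t, …, t): completing the square in each coordinate turns the
tilt into a shift. -/
theorem lintegral_exp_mul_pi_gaussianReal {ι : Type*} [Fintype ι] (t : ℝ) {F : (ι → ℝ) → ℝ≥0∞}
    (hF : Measurable F) :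
    ∫⁻ g, ENNReal.ofReal (Real.exp (t * ∑ i, g i)) * F g
      ∂(Measure.pi fun _ : ι => gaussianReal 0 1) =
      ENNReal.ofReal (Real.exp (Fintype.card ι * (t ^ 2 / 2))) *
        ∫⁻ g, F (fun i => g i + t) ∂(Measure.pi fun _ : ι => gaussianReal 0 1) := by
  have h1 : ∀ g : ι → ℝ, ENNReal.ofReal (Real.exp (t * ∑ i, g i)) * F g =
      ENNReal.ofReal (Real.exp (Fintype.card ι * (t ^ 2 / 2))) *
        ((∏ i, ENNReal.ofReal (Real.exp (t * g i - t ^ 2 / 2))) * F g) := by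
    intro g
    rw [← ENNReal.ofReal_prod_of_nonneg fun i _ => (Real.exp_pos _).le, ← Real.exp_sum, ← mul_assoc,
      ← ENNReal.ofReal_mul (Real.exp_pos _).le, ← Real.exp_add, Finset.sum_sub_distrib,
      ← Finset.mul_sum]
    simp
  have h2 := Measure.pi_map_pi (μ := fun _ : ι => gaussianReal 0 1) (f := fun _ x => x + t)
    fun _ => by fun_prop
  simp only [gaussianReal_map_add_const, zero_add] at h2
  have h3 : Measurable fun g : ι → ℝ => ∏ i, ENNReal.ofReal (Real.exp (t * g i - t ^ 2 / 2)) := by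
    fun_prop
  rw [lintegral_congr h1, lintegral_const_mul' _ _ ENNReal.ofReal_ne_top]
  congr 1
  have h4 := lintegral_withDensity_eq_lintegral_mul (Measure.pi fun _ : ι => gaussianReal 0 1) h3 hF
  simp only [Pi.mul_apply] at h4
  rw [← h4, pi_gaussianReal_withDensity_exp, ← h2, lintegral_map hF (by fun_prop)]

/-! ### The probability space as a tree of independent node variables -/

/-- Both sides have the same finite-dimensional marginals, and these determine the infinite product.
-/
theorem infinitePi_prod_map_zip {ι X Y : Type*} [MeasurableSpace X] [MeasurableSpace Y]
    (μ : Measure X) (ν : Measure Y) [IsProbabilityMeasure μ] [IsProbabilityMeasure ν] :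
    ((Measure.infinitePi fun _ : ι => μ).prod (Measure.infinitePi fun _ : ι => ν)).map
      (fun p i => (p.1 i, p.2 i)) = Measure.infinitePi fun _ : ι => μ.prod ν := by
  have hm : Measurable fun (p : (ι → X) × (ι → Y)) i => (p.1 i, p.2 i) := by fun_prop
  refine (Measure.isProjectiveLimit_infinitePi fun _ : ι => μ.prod ν).unique (fun I => ?_) |>.symm
  rw [Measure.map_map (Finset.measurable_restrict I) hm]
  have h1 : I.restrict ∘ (fun (p : (ι → X) × (ι → Y)) i => (p.1 i, p.2 i)) =
      (MeasurableEquiv.arrowProdEquivProdArrow X Y I).symm ∘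
        Prod.map (I.restrict (π := fun _ => X)) (I.restrict (π := fun _ => Y)) := rfl
  rw [h1, ← Measure.map_map (MeasurableEquiv.measurable _) (by fun_prop),
    ← Measure.map_prod_map _ _ (by fun_prop) (by fun_prop), Measure.infinitePi_map_restrict,
    Measure.infinitePi_map_restrict]
  exact ((measurePreserving_arrowProdEquivProdArrow X Y I (fun _ => μ) (fun _ => ν)).symm _).map_eq

/-- The Gaussian marks of a vertex. -/
abbrev Mark (n : ℕ) : Type := (Fin n → ℝ) × (Fin n → ℝ)

/-- The law of the Gaussian marks of a vertex. -/
noncomputable def markLaw (n : ℕ) : Measure (Mark n) :=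
  (Measure.pi fun _ : Fin n => gaussianReal 0 1).prod (Measure.pi fun _ : Fin n => gaussianReal 0 1)

instance (n : ℕ) : IsProbabilityMeasure (markLaw n) := by
  unfold markLaw
  infer_instance

/-- The node variables of the tree. -/
def toTree {n : ℕ} (ω : Sample n) (b : List ℕ) : ℝ × Mark n :=
  (ω.1 b, (fun i => ω.2.1 (b, i), fun i => ω.2.2 (b, i)))

theorem measurePreserving_toTree (n : ℕ) :
    MeasurePreserving toTree (sampleLaw n) (treeLaw (markLaw n)) := by
  have hc : MeasurePreserving (MeasurableEquiv.curry (List ℕ) (Fin n) ℝ)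
      (Measure.infinitePi fun _ : List ℕ × Fin n => gaussianReal 0 1)
      (Measure.infinitePi fun _ : List ℕ => Measure.pi fun _ : Fin n => gaussianReal 0 1) := by
    refine ⟨MeasurableEquiv.measurable _, ?_⟩
    have := Measure.infinitePi_map_curry fun (_ : List ℕ) (_ : Fin n) => gaussianReal 0 1
    simpa only [Measure.infinitePi_eq_pi] using this
  have hz : MeasurePreserving (fun (p : (List ℕ → Fin n → ℝ) × (List ℕ → Fin n → ℝ)) i =>
      (p.1 i, p.2 i)) _ _ :=
    ⟨by fun_prop, infinitePi_prod_map_zip (Measure.pi fun _ : Fin n => gaussianReal 0 1)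
      (Measure.pi fun _ : Fin n => gaussianReal 0 1)⟩
  have hz' : MeasurePreserving (fun (p : (List ℕ → ℝ) × (List ℕ → Mark n)) i =>
      (p.1 i, p.2 i)) _ _ :=
    ⟨by fun_prop, infinitePi_prod_map_zip (expMeasure 1) (markLaw n)⟩
  exact hz'.comp ((MeasurePreserving.id _).prod (hz.comp (hc.prod hc)))

/-! ### Overlap distributions with finite replica symmetry breaking -/

namespace FiniteRSB

variable (S : FiniteRSB)

/-- The support is finite, so some neighbourhood of `S.q p` meets it in this point only, and the
complement of the support is null. Positive atoms make the parameters of the cascade positive and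
strictly increasing. -/
theorem measure_singleton_pos (p : Fin (S.r + 1)) :
    0 < (S.ζ : Measure unitInterval) {S.q p} := by
  have hmem : S.q p ∈ (S.ζ : Measure unitInterval).support := by
    rw [S.support_eq]
    exact ⟨p, rfl⟩
  have hfin : (Set.range S.q \ {S.q p}).Finite := (Set.finite_range _).subset Set.sdiff_subset
  have hU : (Set.range S.q \ {S.q p})ᶜ ∈ 𝓝 (S.q p) :=
    hfin.isClosed.isOpen_compl.mem_nhds (by simp)
  have hpos := (Measure.mem_support_iff_forall _).mp hmem _ hU
  have hsub : (Set.range S.q \ {S.q p})ᶜ ⊆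
      {S.q p} ∪ ((S.ζ : Measure unitInterval).support)ᶜ := by
    rw [S.support_eq]
    intro x hx
    by_cases h : x = S.q p
    · exact Or.inl h
    · exact Or.inr fun h2 => hx ⟨h2, h⟩
  have hle := (measure_mono (μ := (S.ζ : Measure unitInterval)) hsub).trans (measure_union_le _ _)
  rw [Measure.measure_compl_support, add_zero] at hle
  exact hpos.trans_le hle

theorem cdf_pos (p : Fin (S.r + 1)) : 0 < S.cdf p :=
  ENNReal.toReal_pos ((S.measure_singleton_pos p).trans_le (measure_mono (by simp))).ne'
    (measure_ne_top _ _)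

theorem strictMono_cdf : StrictMono S.cdf := by
  intro p p' h
  have hq := S.strictMono_q h
  have hsub : Set.Iic (S.q p) ∪ {S.q p'} ⊆ Set.Iic (S.q p') := by
    rintro x (hx | hx)
    · exact le_trans hx hq.le
    · exact le_of_eq hx
  have hdisj : Disjoint (Set.Iic (S.q p)) {S.q p'} := by simpa using hq
  have h1 := measureReal_mono (μ := (S.ζ : Measure unitInterval)) hsub
  rw [measureReal_union hdisj (measurableSet_singleton _)] at h1
  have h2 : 0 < (S.ζ : Measure unitInterval).real {S.q p'} :=
    ENNReal.toReal_pos (S.measure_singleton_pos p').ne' (measure_ne_top _ _)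
  unfold cdf
  linarith

theorem cdf_castSucc_lt_one (p : Fin S.r) : S.cdf p.castSucc < 1 :=
  (S.strictMono_cdf (Fin.castSucc_lt_last p)).trans_le measureReal_le_one

theorem q_mem (p : Fin (S.r + 1)) : (S.q p : ℝ) ∈ Set.Icc (0 : ℝ) 1 := (S.q p).2

theorem qStar_mem : S.qStar ∈ Set.Icc (0 : ℝ) 1 := S.q_mem _

theorem q_castSucc_le_q_succ (p : Fin S.r) : (S.q p.castSucc : ℝ) ≤ S.q p.succ :=
  (S.strictMono_q Fin.castSucc_lt_succ).le

end FiniteRSB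

/-! ### The covariance functions -/

section Covariance

variable {β : ℕ → ℝ}

theorem xiDeriv_term_nonneg (β : ℕ → ℝ) (p : ℕ) {x : ℝ} (hx : 0 ≤ x) :
    0 ≤ ((p : ℝ) + 2) * β (p + 2) ^ 2 * x ^ (p + 1) := by positivity

theorem xiDeriv_nonneg (β : ℕ → ℝ) {x : ℝ} (hx : 0 ≤ x) : 0 ≤ xiDeriv β x :=
  tsum_nonneg fun p => xiDeriv_term_nonneg β p hx

theorem summable_xiDeriv (hβ : Summable fun p : ℕ => ((p : ℝ) + 2) * β (p + 2) ^ 2) {x : ℝ}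
    (hx : x ∈ Set.Icc (0 : ℝ) 1) :
    Summable fun p : ℕ => ((p : ℝ) + 2) * β (p + 2) ^ 2 * x ^ (p + 1) :=
  Summable.of_nonneg_of_le (fun p => xiDeriv_term_nonneg β p hx.1)
    (fun p => mul_le_of_le_one_right (by positivity) (pow_le_one₀ hx.1 hx.2)) hβ

theorem xiDeriv_mono (hβ : Summable fun p : ℕ => ((p : ℝ) + 2) * β (p + 2) ^ 2) {x y : ℝ}
    (hx : 0 ≤ x) (hxy : x ≤ y) (hy : y ≤ 1) : xiDeriv β x ≤ xiDeriv β y :=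
  (summable_xiDeriv hβ ⟨hx, hxy.trans hy⟩).tsum_le_tsum
    (fun p => by gcongr) (summable_xiDeriv hβ ⟨hx.trans hxy, hy⟩)

theorem thetaY_nonneg (β : ℕ → ℝ) {x : ℝ} (hx : 0 ≤ x) : 0 ≤ thetaY β x :=
  mul_nonneg hx (xiDeriv_nonneg β hx)

theorem thetaY_mono (hβ : Summable fun p : ℕ => ((p : ℝ) + 2) * β (p + 2) ^ 2) {x y : ℝ}
    (hx : 0 ≤ x) (hxy : x ≤ y) (hy : y ≤ 1) : thetaY β x ≤ thetaY β y :=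
  mul_le_mul hxy (xiDeriv_mono hβ hx hxy hy) (xiDeriv_nonneg β hx) (hx.trans hxy)

theorem thetaY_le (hβ : Summable fun p : ℕ => ((p : ℝ) + 2) * β (p + 2) ^ 2) {x : ℝ}
    (hx : x ∈ Set.Icc (0 : ℝ) 1) : thetaY β x ≤ xiDeriv β 1 :=
  (thetaY_mono hβ hx.1 hx.2 le_rfl).trans_eq (by simp [thetaY])

end Covariance

/-! ### Exponential moments of the Gaussian fields -/

theorem length_anc {r : ℕ} (α : Fin r → ℕ) (p : Fin (r + 1)) : (anc α p).length = p := by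
  simp [anc, Nat.lt_succ_iff.mp p.2]

/-- The vertices on a path have different depths, so their Gaussian variables are independent, and
the squared coefficients telescope to f(q_*). The law of the field at a leaf is thus the same for
all leaves. -/
theorem lintegral_exp_field {n : ℕ} (S : FiniteRSB) {f : ℝ → ℝ} (h0 : 0 ≤ f (S.q 0))
    (hf : ∀ p : Fin S.r, f (S.q p.castSucc) ≤ f (S.q p.succ)) (i : Fin n) (α : Fin S.r → ℕ) (t : ℝ) :
    ∫⁻ g : List ℕ × Fin n → ℝ, ENNReal.ofReal (Real.exp (t * field S f (fun b => g (b, i)) α))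
      ∂(Measure.infinitePi fun _ => gaussianReal 0 1) =
      ENNReal.ofReal (Real.exp (t ^ 2 * f S.qStar / 2)) := by
  obtain ⟨c, hc0, hc⟩ : ∃ c : Fin (S.r + 1) → ℝ, c 0 = √(f (S.q 0)) ∧
      ∀ p : Fin S.r, c p.succ = √(f (S.q p.succ) - f (S.q p.castSucc)) :=
    ⟨Fin.cons (√(f (S.q 0))) fun p => √(f (S.q p.succ) - f (S.q p.castSucc)), rfl, fun p => rfl⟩
  have hfield : ∀ g : List ℕ × Fin n → ℝ,
      ENNReal.ofReal (Real.exp (t * field S f (fun b => g (b, i)) α)) =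
        ∏ p : Fin (S.r + 1), ENNReal.ofReal (Real.exp (t * c p * g (anc α p, i))) := by
    intro g
    rw [← ENNReal.ofReal_prod_of_nonneg fun i _ => (Real.exp_pos _).le, ← Real.exp_sum,
      Fin.sum_univ_succ, hc0, field, mul_add, Finset.mul_sum]
    simp [hc, mul_assoc]
  have hinj : Function.Injective fun p : Fin (S.r + 1) => (anc α p, i) := by
    intro p p' h
    have h3 := congrArg List.length (Prod.mk.inj h).1
    rw [length_anc, length_anc] at h3
    exact Fin.ext h3
  have hX : ∀ p : Fin (S.r + 1), Measurable fun x : ℝ => ENNReal.ofReal (Real.exp (t * c p * x)) :=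
    fun p => by fun_prop
  have hind := (iIndepFun_infinitePi (P := fun _ : List ℕ × Fin n => gaussianReal 0 1)
    (X := fun _ x => x) (fun _ => measurable_id)).precomp hinj
  have hind' := hind.comp (fun p x => ENNReal.ofReal (Real.exp (t * c p * x))) hX
  rw [lintegral_congr hfield, lintegral_prod_eq_prod_lintegral_of_indepFun _
    (fun p (g : List ℕ × Fin n → ℝ) => ENNReal.ofReal (Real.exp (t * c p * g (anc α p, i))))
    hind' fun p => by fun_prop]
  have hterm : ∀ p : Fin (S.r + 1), ∫⁻ g : List ℕ × Fin n → ℝ,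
      ENNReal.ofReal (Real.exp (t * c p * g (anc α p, i)))
        ∂(Measure.infinitePi fun _ => gaussianReal 0 1) =
      ENNReal.ofReal (Real.exp (t ^ 2 / 2 * c p ^ 2)) := by
    intro p
    rw [(measurePreserving_eval_infinitePi (fun _ : List ℕ × Fin n => gaussianReal 0 1)
      (anc α p, i)).lintegral_comp (hX p), lintegral_exp_mul_gaussianReal]
    congr 2
    ring
  rw [Finset.prod_congr rfl fun p _ => hterm p,
    ← ENNReal.ofReal_prod_of_nonneg fun i _ => (Real.exp_pos _).le, ← Real.exp_sum,
    ← Finset.mul_sum]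
  -- Only the last d is needed; the partial sums are what the induction runs on.
  have hsum : ∀ d : Fin (S.r + 1), ∑ p : Fin (S.r + 1), (if p ≤ d then c p ^ 2 else 0) =
      f (S.q d) := by
    intro d
    induction d using Fin.induction with
    | zero =>
      rw [Finset.sum_eq_single 0]
      · simp [hc0, Real.sq_sqrt h0]
      · intro p _ hp
        rw [if_neg (fun h => hp (Fin.le_zero_iff.mp h))]
      · simp
    | succ d ih =>
      have h4 : ∀ p : Fin (S.r + 1), (if p ≤ d.succ then c p ^ 2 else 0) =
          (if p ≤ d.castSucc then c p ^ 2 else 0) + if p = d.succ then c p ^ 2 else 0 := by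
        intro p
        have e1 : p ≤ d.succ ↔ (p : ℕ) ≤ d + 1 := Iff.rfl
        have e2 : p ≤ d.castSucc ↔ (p : ℕ) ≤ d := Iff.rfl
        have e3 : p = d.succ ↔ (p : ℕ) = d + 1 := Fin.ext_iff
        simp only [e1, e2, e3]
        split_ifs <;> first | omega | simp
      simp_rw [h4]
      rw [Finset.sum_add_distrib, ih, Finset.sum_ite_eq' Finset.univ d.succ]
      simp [hc, Real.sq_sqrt (sub_nonneg.mpr (hf d))]
  have hlast := hsum (Fin.last S.r)
  simp only [Fin.le_last, if_true] at hlast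
  rw [hlast]
  congr 2
  rw [FiniteRSB.qStar]
  ring

/-- The sum of the |y_i| is at most n times the largest one, and e^{|x|} ≤ e^x + e^{-x}. The summand
1 covers n = 0. -/
theorem exp_sum_abs_le {n : ℕ} {c : ℝ} (hc : 0 ≤ c) (y : Fin n → ℝ) :
    Real.exp (c * ∑ i, |y i|) ≤
      1 + ∑ i, (Real.exp (n * c * y i) + Real.exp (-(n * c) * y i)) := by
  rcases isEmpty_or_nonempty (Fin n) with h | h
  · simp
  obtain ⟨j, -, hj⟩ := Finset.exists_max_image Finset.univ (fun i => |y i|) Finset.univ_nonempty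
  have h1 : c * ∑ i, |y i| ≤ n * c * |y j| := by
    have := Finset.sum_le_card_nsmul Finset.univ (fun i => |y i|) (|y j|) hj
    rw [Finset.card_univ, Fintype.card_fin, nsmul_eq_mul] at this
    calc c * ∑ i, |y i| ≤ c * (n * |y j|) := by gcongr
      _ = n * c * |y j| := by ring
  have h2 : Real.exp (n * c * |y j|) ≤ Real.exp (n * c * y j) + Real.exp (-(n * c) * y j) := by
    rcases abs_cases (y j) with ⟨h, -⟩ | ⟨h, -⟩
    · rw [h]
      linarith [Real.exp_pos (-(n * c) * y j)]
    · rw [h, mul_neg, ← neg_mul]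
      linarith [Real.exp_pos (n * c * y j)]
  have h3 := Finset.single_le_sum
    (f := fun i => Real.exp (n * c * y i) + Real.exp (-(n * c) * y i))
    (fun i _ => by positivity) (Finset.mem_univ j)
  have h4 := Real.exp_le_exp.mpr h1
  linarith

/-- A bound for the exponential moments of a centred Gaussian vector in dimension `n`
whose coordinates have variance at most `v`. -/
noncomputable def expMomentBound (n : ℕ) (c v : ℝ) : ℝ :=
  1 + 2 * n * Real.exp ((n * c) ^ 2 * v / 2)

theorem expMomentBound_nonneg (n : ℕ) (c v : ℝ) : 0 ≤ expMomentBound n c v := by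
  unfold expMomentBound
  positivity

theorem expMomentBound_mono (n : ℕ) (c : ℝ) {v w : ℝ} (h : v ≤ w) :
    expMomentBound n c v ≤ expMomentBound n c w := by
  unfold expMomentBound
  gcongr

theorem measurable_field (S : FiniteRSB) (f : ℝ → ℝ) {n : ℕ} (i : Fin n) (α : Fin S.r → ℕ) :
    Measurable fun g : List ℕ × Fin n → ℝ => field S f (fun b => g (b, i)) α := by
  unfold field
  fun_prop

theorem lintegral_exp_sum_abs_field_le {n : ℕ} (S : FiniteRSB) {f : ℝ → ℝ} (h0 : 0 ≤ f (S.q 0))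
    (hf : ∀ p : Fin S.r, f (S.q p.castSucc) ≤ f (S.q p.succ)) (α : Fin S.r → ℕ) {c : ℝ}
    (hc : 0 ≤ c) :
    ∫⁻ g : List ℕ × Fin n → ℝ, ENNReal.ofReal
      (Real.exp (c * ∑ i, |field S f (fun b => g (b, i)) α|))
      ∂(Measure.infinitePi fun _ => gaussianReal 0 1) ≤
      ENNReal.ofReal (expMomentBound n c (f S.qStar)) := by
  have hm := measurable_field S f (n := n) (α := α)
  calc _ ≤ ∫⁻ g : List ℕ × Fin n → ℝ, (1 + ∑ i,
        (ENNReal.ofReal (Real.exp (n * c * field S f (fun b => g (b, i)) α)) +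
          ENNReal.ofReal (Real.exp (-(n * c) * field S f (fun b => g (b, i)) α))))
        ∂(Measure.infinitePi fun _ => gaussianReal 0 1) := by
        refine lintegral_mono fun g => ?_
        refine (ENNReal.ofReal_le_ofReal (exp_sum_abs_le hc _)).trans_eq ?_
        rw [ENNReal.ofReal_add zero_le_one (by positivity), ENNReal.ofReal_one,
          ENNReal.ofReal_sum_of_nonneg fun i _ => by positivity]
        congr 1
        exact Finset.sum_congr rfl fun i _ =>
          ENNReal.ofReal_add (Real.exp_pos _).le (Real.exp_pos _).le
    _ = _ := by
        rw [lintegral_add_left measurable_const, lintegral_finsetSum _ fun i _ => by fun_prop]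
        have h1 : ∀ i : Fin n, ∫⁻ g : List ℕ × Fin n → ℝ,
            (ENNReal.ofReal (Real.exp (n * c * field S f (fun b => g (b, i)) α)) +
              ENNReal.ofReal (Real.exp (-(n * c) * field S f (fun b => g (b, i)) α)))
              ∂(Measure.infinitePi fun _ => gaussianReal 0 1) =
            ENNReal.ofReal (2 * Real.exp ((n * c) ^ 2 * f S.qStar / 2)) := by
          intro i
          rw [lintegral_add_left (by fun_prop), lintegral_exp_field S h0 hf,
            lintegral_exp_field S h0 hf, ← ENNReal.ofReal_add (Real.exp_pos _).le (Real.exp_pos _).le]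
          congr 1
          ring_nf
        rw [Finset.sum_congr rfl fun i _ => h1 i, Finset.sum_const, Finset.card_univ,
          Fintype.card_fin, lintegral_const, measure_univ, mul_one, expMomentBound,
          ENNReal.ofReal_add zero_le_one (by positivity), ENNReal.ofReal_one, nsmul_eq_mul,
          ← ENNReal.ofReal_natCast, ← ENNReal.ofReal_mul (Nat.cast_nonneg n)]
        congr 2
        ring

/-! ### Integrals over the spins -/

/-- An exponent that is continuous and grows at most linearly in the fields. -/
structure Admissible (C : ℝ) (U : ℝ → ℝ → ℝ → ℝ) : Prop where
  continuous : Continuous fun p : ℝ × ℝ × ℝ => U p.1 p.2.1 p.2.2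
  growth : ∃ K c : ℝ, 0 ≤ c ∧ ∀ y z s, |s| ≤ C → U y z s ≤ K + c * (|y| + |z|)

/-- `∏_i ∫_{-C}^C s^{e_i} exp(U(y_i, z_i, s)) ds`. -/
noncomputable def spinIntegral {n : ℕ} (C : ℝ) (U : ℝ → ℝ → ℝ → ℝ) (e : Fin n → ℕ) (v : Mark n) :
    ℝ :=
  ∏ i, ∫ s in (-C)..C, s ^ e i * Real.exp (U (v.1 i) (v.2 i) s)

section SpinIntegral

variable {n : ℕ} {C : ℝ} {U : ℝ → ℝ → ℝ → ℝ}

theorem continuous_spinIntegral (hU : Continuous fun p : ℝ × ℝ × ℝ => U p.1 p.2.1 p.2.2)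
    (e : Fin n → ℕ) : Continuous (spinIntegral C U e) := by
  unfold spinIntegral
  refine continuous_finsetProd _ fun i _ => ?_
  refine intervalIntegral.continuous_parametric_intervalIntegral_of_continuous' ?_ _ _
  have : Continuous fun p : Mark n × ℝ => U (p.1.1 i) (p.1.2 i) p.2 :=
    hU.comp (g := fun p : ℝ × ℝ × ℝ => U p.1 p.2.1 p.2.2)
      (f := fun p : Mark n × ℝ => (p.1.1 i, p.1.2 i, p.2)) (by fun_prop)
  exact (continuous_snd.pow _).mul (Real.continuous_exp.comp this)

theorem continuous_exponent (hU : Continuous fun p : ℝ × ℝ × ℝ => U p.1 p.2.1 p.2.2) (y z : ℝ) :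
    Continuous (U y z) :=
  hU.comp (g := fun p : ℝ × ℝ × ℝ => U p.1 p.2.1 p.2.2) (f := fun s : ℝ => (y, z, s)) (by fun_prop)

theorem integral_exp_pos (hC : 0 < C) (hU : Continuous fun p : ℝ × ℝ × ℝ => U p.1 p.2.1 p.2.2)
    (y z : ℝ) : 0 < ∫ s in (-C)..C, Real.exp (U y z s) := by
  have := continuous_exponent hU y z
  exact intervalIntegral.intervalIntegral_pos_of_pos
    (Continuous.intervalIntegrable (by fun_prop) _ _) (fun s => Real.exp_pos _) (by linarith)

theorem spinIntegral_zero (v : Mark n) :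
    spinIntegral C U 0 v = ∏ i, ∫ s in (-C)..C, Real.exp (U (v.1 i) (v.2 i) s) := by
  simp [spinIntegral]

theorem spinIntegral_zero_pos (hC : 0 < C)
    (hU : Continuous fun p : ℝ × ℝ × ℝ => U p.1 p.2.1 p.2.2) (v : Mark n) :
    0 < spinIntegral C U 0 v := by
  rw [spinIntegral_zero]
  exact Finset.prod_pos fun i _ => integral_exp_pos hC hU _ _

theorem abs_integral_pow_mul_le (hC : 0 < C) (k : ℕ) {F G : ℝ → ℝ} (hF : Continuous F)
    (hG : Continuous G) (h : ∀ s, |s| ≤ C → |F s| ≤ G s) :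
    |∫ s in (-C)..C, s ^ k * F s| ≤ C ^ k * ∫ s in (-C)..C, G s := by
  have hle : -C ≤ C := by linarith
  refine (intervalIntegral.abs_integral_le_integral_abs hle).trans ?_
  rw [← intervalIntegral.integral_const_mul]
  refine intervalIntegral.integral_mono_on hle (Continuous.intervalIntegrable (by fun_prop) _ _)
    (Continuous.intervalIntegrable (by fun_prop) _ _) fun s hs => ?_
  have hs' : |s| ≤ C := abs_le.mpr hs
  rw [abs_mul, abs_pow]
  exact mul_le_mul (pow_le_pow_left₀ (abs_nonneg s) hs' k) (h s hs') (abs_nonneg _) (by positivity)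

theorem abs_spinIntegral_le (hC : 0 < C)
    (hU : Continuous fun p : ℝ × ℝ × ℝ => U p.1 p.2.1 p.2.2) (e : Fin n → ℕ) (v : Mark n) :
    |spinIntegral C U e v| ≤ C ^ (∑ i, e i) * spinIntegral C U 0 v := by
  rw [spinIntegral_zero, spinIntegral, Finset.abs_prod, ← Finset.prod_pow_eq_pow_sum,
    ← Finset.prod_mul_distrib]
  refine Finset.prod_le_prod (fun i _ => abs_nonneg _) fun i _ => ?_
  have := continuous_exponent hU (v.1 i) (v.2 i)
  exact abs_integral_pow_mul_le hC _ (by fun_prop) (by fun_prop) fun s _ => (Real.abs_exp _).le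

theorem exists_spinIntegral_le (hC : 0 < C) (hU : Admissible C U) (n : ℕ) :
    ∃ K c : ℝ, 0 ≤ K ∧ 0 ≤ c ∧ ∀ v : Mark n, spinIntegral C U 0 v ≤
      K * (Real.exp (c * ∑ i, |v.1 i|) * Real.exp (c * ∑ i, |v.2 i|)) := by
  obtain ⟨K, c, hc, h⟩ := hU.growth
  refine ⟨∏ _ : Fin n, (2 * C * Real.exp K), c, by positivity, hc, fun v => ?_⟩
  have h1 : ∀ i, ∫ s in (-C)..C, Real.exp (U (v.1 i) (v.2 i) s) ≤
      2 * C * Real.exp K * (Real.exp (c * |v.1 i|) * Real.exp (c * |v.2 i|)) := by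
    intro i
    have := continuous_exponent hU.continuous (v.1 i) (v.2 i)
    have h2 : ∫ s in (-C)..C, Real.exp (U (v.1 i) (v.2 i) s) ≤
        ∫ _ in (-C)..C, Real.exp (K + c * (|v.1 i| + |v.2 i|)) :=
      intervalIntegral.integral_mono_on (by linarith)
        (Continuous.intervalIntegrable (by fun_prop) _ _)
        (Continuous.intervalIntegrable (by fun_prop) _ _)
        fun s hs => Real.exp_le_exp.mpr (h _ _ _ (abs_le.mpr hs))
    refine h2.trans_eq ?_
    rw [intervalIntegral.integral_const, smul_eq_mul, mul_add, Real.exp_add, Real.exp_add]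
    ring
  rw [spinIntegral_zero, Finset.mul_sum, Finset.mul_sum, Real.exp_sum, Real.exp_sum,
    ← Finset.prod_mul_distrib, ← Finset.prod_mul_distrib]
  exact Finset.prod_le_prod (fun i _ => (integral_exp_pos hC hU.continuous _ _).le) fun i _ => h1 i

end SpinIntegral

section Root

variable {X V : Type*} [AddCommMonoid V] [MeasurableSpace X] [MeasurableSpace V] [MeasurableAdd₂ V]
variable (γ : Measure X) [IsProbabilityMeasure γ]

/-- Invariance under tilting of cascades with a random starting point. -/
theorem exists_map_cascadeSum_root_eq {r : ℕ} {m : Fin r → ℝ} (hm0 : ∀ p, 0 < m p)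
    (hm1 : ∀ p, m p < 1) (hmono : StrictMono m) {f : Fin r → X → ℝ≥0∞} {σ τ : Fin r → X → V}
    (hf : ∀ p, Measurable (f p)) (hσ : ∀ p, Measurable (σ p)) (hτ : ∀ p, Measurable (τ p))
    (hft : ∀ p g, f p g ≠ ∞) (htilt : ∀ p, ∃ K ≠ 0, K ≠ ∞ ∧ ∀ F : V → ℝ≥0∞, Measurable F →
      ∫⁻ g, f p g ^ m p * F (σ p g) ∂γ = K * ∫⁻ g, F (τ p g) ∂γ) :
    ∃ κ ≠ 0, κ ≠ ∞ ∧ ∀ {ι : Type} [Fintype ι] (h : ι → V → ℝ≥0∞), (∀ i, Measurable (h i)) →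
      ∀ x₀ : X → V, Measurable x₀ →
      (treeLaw γ).map (fun ω i => cascadeSum m f σ (h i) (x₀ (ω []).2) ω) =
        (treeLaw γ).map (fun ω i => κ * cascadeSum m (fun _ _ => 1) τ (h i) (x₀ (ω []).2) ω) := by
  obtain ⟨κ, hκ0, hκt, hκ⟩ := exists_map_cascadeSum_eq γ hm0 hm1 hmono hf hσ hτ hft htilt
  refine ⟨κ, hκ0, hκt, fun {ι} _ h hh x₀ hx₀ => ?_⟩
  have hupd := measurePreserving_treeLaw_update_root γ
  have hone : ∀ _ : Fin r, Measurable fun _ : X => (1 : ℝ≥0∞) := fun _ => measurable_const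
  have hm₁ : Measurable fun ω i => cascadeSum m f σ (h i) (x₀ (ω []).2) ω :=
    measurable_pi_lambda _ fun i =>
      measurable_cascadeSum (by fun_prop) measurable_id m hf hσ (hh i)
  have hm₂ : Measurable fun ω i => κ * cascadeSum m (fun _ _ => 1) τ (h i) (x₀ (ω []).2) ω :=
    measurable_pi_lambda _ fun i => (measurable_cascadeSum (by fun_prop) measurable_id m
      hone hτ (hh i)).const_mul κ
  have hm₃ : Measurable fun (q : (ℝ × X) × (List ℕ → ℝ × X)) i =>
      cascadeSum m f σ (h i) (x₀ q.1.2) q.2 := measurable_pi_lambda _ fun i =>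
    measurable_cascadeSum (by fun_prop) measurable_snd m hf hσ (hh i)
  have hm₄ : Measurable fun (q : (ℝ × X) × (List ℕ → ℝ × X)) i =>
      κ * cascadeSum m (fun _ _ => 1) τ (h i) (x₀ q.1.2) q.2 := measurable_pi_lambda _ fun i =>
    (measurable_cascadeSum (by fun_prop) measurable_snd m hone hτ (hh i)).const_mul κ
  have hm₅ : ∀ x, Measurable fun (ω : List ℕ → ℝ × X) i => cascadeSum m f σ (h i) x ω :=
    fun x => measurable_pi_lambda _ fun i =>
      measurable_cascadeSum measurable_const measurable_id m hf hσ (hh i)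
  have hm₆ : ∀ x, Measurable fun (ω : List ℕ → ℝ × X) i =>
      κ * cascadeSum m (fun _ _ => 1) τ (h i) x ω :=
    fun x => measurable_pi_lambda _ fun i =>
      (measurable_cascadeSum measurable_const measurable_id m hone hτ (hh i)).const_mul κ
  -- With the root resampled independently, the starting point is fixed once the root is given, and
  -- the invariance for a fixed start applies to each of its values.
  rw [← hupd.map_eq, Measure.map_map hm₁ hupd.measurable, Measure.map_map hm₂ hupd.measurable]
  have e₁ : (fun (ω : List ℕ → ℝ × X) i => cascadeSum m f σ (h i) (x₀ (ω []).2) ω) ∘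
      (fun p : (ℝ × X) × (List ℕ → ℝ × X) => Function.update p.2 [] p.1) =
      fun q i => cascadeSum m f σ (h i) (x₀ q.1.2) q.2 := by
    ext q i
    simp only [Function.comp_apply, Function.update_self, cascadeSum_update_nil]
  have e₂ : (fun (ω : List ℕ → ℝ × X) i =>
      κ * cascadeSum m (fun _ _ => 1) τ (h i) (x₀ (ω []).2) ω) ∘
      (fun p : (ℝ × X) × (List ℕ → ℝ × X) => Function.update p.2 [] p.1) =
      fun q i => κ * cascadeSum m (fun _ _ => 1) τ (h i) (x₀ q.1.2) q.2 := by
    ext q i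
    simp only [Function.comp_apply, Function.update_self, cascadeSum_update_nil]
  rw [e₁, e₂]
  ext B hB
  rw [Measure.map_apply hm₃ hB, Measure.map_apply hm₄ hB, Measure.prod_apply (hm₃ hB),
    Measure.prod_apply (hm₄ hB)]
  refine lintegral_congr fun y => ?_
  have h1 := congrArg (fun μ : Measure (ι → ℝ≥0∞) => μ B) (hκ h hh (x₀ y.2))
  rw [Measure.map_apply (hm₅ _) hB, Measure.map_apply (hm₆ _) hB] at h1
  exact h1

end Root

/-! ### The fields as sums along the branches of the tree -/

/-- The values of all fields at a leaf. -/
noncomputable def fieldMark {n : ℕ} (β : ℕ → ℝ) (S : FiniteRSB)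
    (g : (List ℕ × Fin n → ℝ) × (List ℕ × Fin n → ℝ)) (α : Fin S.r → ℕ) : Mark n :=
  (fun i => field S (thetaY β) (fun b => g.1 (b, i)) α,
    fun i => field S (xiDeriv β) (fun b => g.2 (b, i)) α)

/-- The contribution of the root to the fields. -/
noncomputable def rootStep {n : ℕ} (β : ℕ → ℝ) (S : FiniteRSB) (g : Mark n) : Mark n :=
  (fun i => √(thetaY β (S.q 0)) * g.1 i, fun i => √(xiDeriv β (S.q 0)) * g.2 i)

/-- The contribution of a vertex at depth `p + 1` to the fields. -/
noncomputable def branchStep {n : ℕ} (β : ℕ → ℝ) (S : FiniteRSB) (p : Fin S.r) (g : Mark n) :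
    Mark n :=
  (fun i => √(thetaY β (S.q p.succ) - thetaY β (S.q p.castSucc)) * g.1 i,
    fun i => √(xiDeriv β (S.q p.succ) - xiDeriv β (S.q p.castSucc)) * g.2 i)

/-- The parameters of the Poisson processes of the cascade. -/
noncomputable def FiniteRSB.level (S : FiniteRSB) (p : Fin S.r) : ℝ := S.cdf p.castSucc

theorem FiniteRSB.strictMono_level (S : FiniteRSB) : StrictMono S.level := fun _ _ h =>
  S.strictMono_cdf (Fin.castSucc_lt_castSucc_iff.mpr h)

theorem measurable_fieldMark {n : ℕ} (β : ℕ → ℝ) (S : FiniteRSB) (α : Fin S.r → ℕ) :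
    Measurable fun g => fieldMark (n := n) β S g α :=
  (measurable_pi_lambda _ fun i => (measurable_field S _ i α).comp measurable_fst).prodMk
    (measurable_pi_lambda _ fun i => (measurable_field S _ i α).comp measurable_snd)

theorem measurable_rootStep {n : ℕ} (β : ℕ → ℝ) (S : FiniteRSB) :
    Measurable (rootStep (n := n) β S) := by
  unfold rootStep
  fun_prop

theorem measurable_branchStep {n : ℕ} (β : ℕ → ℝ) (S : FiniteRSB) (p : Fin S.r) :
    Measurable (branchStep (n := n) β S p) := by
  unfold branchStep
  fun_prop

theorem fieldMark_eq {n : ℕ} (β : ℕ → ℝ) (S : FiniteRSB) (ω : Sample n) (α : Fin S.r → ℕ) :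
    fieldMark β S ω.2 α = rootStep β S (toTree ω []).2 +
      ∑ p : Fin S.r, branchStep β S p (toTree ω (anc α (p + 1))).2 := by
  ext i
  · simp [fieldMark, field, rootStep, branchStep, toTree, anc_zero, Prod.fst_sum]
  · simp [fieldMark, field, rootStep, branchStep, toTree, anc_zero, Prod.snd_sum]

theorem lintegral_spinIntegral_fieldMark_ne_top {β : ℕ → ℝ}
    (hβ : Summable fun p : ℕ => ((p : ℝ) + 2) * β (p + 2) ^ 2) {C : ℝ} (hC : 0 < C)
    {U : ℝ → ℝ → ℝ → ℝ} (hU : Admissible C U) (S : FiniteRSB) (n : ℕ) :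
    ∃ B : ℝ≥0∞, B ≠ ∞ ∧ ∀ α : Fin S.r → ℕ,
      ∫⁻ g, ENNReal.ofReal (spinIntegral C U 0 (fieldMark (n := n) β S g α))
        ∂((Measure.infinitePi fun _ => gaussianReal 0 1).prod
          (Measure.infinitePi fun _ => gaussianReal 0 1)) ≤ B := by
  obtain ⟨K, c, hK, hc, h⟩ := exists_spinIntegral_le hC hU n
  refine ⟨ENNReal.ofReal K * (ENNReal.ofReal (expMomentBound n c (thetaY β S.qStar)) *
    ENNReal.ofReal (expMomentBound n c (xiDeriv β S.qStar))),
    ENNReal.mul_ne_top ENNReal.ofReal_ne_top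
      (ENNReal.mul_ne_top ENNReal.ofReal_ne_top ENNReal.ofReal_ne_top), fun α => ?_⟩
  have hm := fun (f : ℝ → ℝ) i => measurable_field S f (n := n) i α
  calc _ ≤ ∫⁻ g, ENNReal.ofReal K * (ENNReal.ofReal (Real.exp (c * ∑ i : Fin n,
          |field S (thetaY β) (fun b => (Prod.fst g) (b, i)) α|)) * ENNReal.ofReal (Real.exp
            (c * ∑ i : Fin n, |field S (xiDeriv β) (fun b => (Prod.snd g) (b, i)) α|)))
        ∂((Measure.infinitePi fun _ => gaussianReal 0 1).prod
          (Measure.infinitePi fun _ => gaussianReal 0 1)) := by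
        refine lintegral_mono fun g => ?_
        rw [← ENNReal.ofReal_mul (Real.exp_pos _).le, ← ENNReal.ofReal_mul hK]
        exact ENNReal.ofReal_le_ofReal (h _)
    _ ≤ _ := by
        rw [lintegral_const_mul' _ _ ENNReal.ofReal_ne_top]
        refine mul_le_mul_right ?_ _
        refine (lintegral_prod_mul (f := fun g : List ℕ × Fin n → ℝ => ENNReal.ofReal (Real.exp
          (c * ∑ i : Fin n, |field S (thetaY β) (fun b => g (b, i)) α|)))
          (g := fun g : List ℕ × Fin n → ℝ => ENNReal.ofReal (Real.exp
          (c * ∑ i : Fin n, |field S (xiDeriv β) (fun b => g (b, i)) α|))) ?_ ?_).trans_le ?_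
        · have := hm (thetaY β)
          exact Measurable.aemeasurable (by fun_prop)
        · have := hm (xiDeriv β)
          exact Measurable.aemeasurable (by fun_prop)
        · exact mul_le_mul'
            (lintegral_exp_sum_abs_field_le S (thetaY_nonneg β (S.q_mem 0).1)
              (fun p => thetaY_mono hβ (S.q_mem _).1 (S.q_castSucc_le_q_succ p) (S.q_mem _).2) α hc)
            (lintegral_exp_sum_abs_field_le S (xiDeriv_nonneg β (S.q_mem 0).1)
              (fun p => xiDeriv_mono hβ (S.q_mem _).1 (S.q_castSucc_le_q_succ p) (S.q_mem _).2) α hc)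

/-! ### The weights -/

theorem ae_sampleLaw_pos (n : ℕ) : ∀ᵐ ω ∂(sampleLaw n), ∀ b, 0 < ω.1 b := by
  rw [ae_all_iff]
  intro b
  have h := (measurePreserving_eval_infinitePi (fun _ : List ℕ => expMeasure 1) b).comp
    (measurePreserving_fst (μ := Measure.infinitePi fun _ : List ℕ => expMeasure 1)
      (ν := (Measure.infinitePi fun _ : List ℕ × Fin n => gaussianReal 0 1).prod
        (Measure.infinitePi fun _ : List ℕ × Fin n => gaussianReal 0 1)))
  exact h.quasiMeasurePreserving.ae ae_expMeasure_pos

theorem arrival_pos {E : List ℕ → ℝ} (hE : ∀ b, 0 < E b) (b : List ℕ) (j : ℕ) :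
    0 < arrival E b j :=
  Finset.sum_pos (fun _ _ => hE _) ⟨0, by simp⟩

theorem rawWeight_pos (S : FiniteRSB) {E : List ℕ → ℝ} (hE : ∀ b, 0 < E b) (α : Fin S.r → ℕ) :
    0 < rawWeight S E α :=
  Finset.prod_pos fun _ _ => Real.rpow_pos_of_pos (arrival_pos hE _ _) _

theorem ofReal_rawWeight (S : FiniteRSB) {E : List ℕ → ℝ} (hE : ∀ b, 0 < E b) (α : Fin S.r → ℕ) :
    ENNReal.ofReal (rawWeight S E α) =
      ∏ p : Fin S.r, ENNReal.ofReal (arrival E (anc α p) (α p) ^ (-1 / S.level p)) :=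
  ENNReal.ofReal_prod_of_nonneg fun _ _ => (Real.rpow_pos_of_pos (arrival_pos hE _ _) _).le

theorem measurable_rawWeight (S : FiniteRSB) (α : Fin S.r → ℕ) :
    Measurable fun E : List ℕ → ℝ => rawWeight S E α := by
  unfold rawWeight arrival
  fun_prop

theorem tsum_ofReal_ne_top_iff {ι : Type*} {f : ι → ℝ} (hf : ∀ i, 0 ≤ f i) :
    ∑' i, ENNReal.ofReal (f i) ≠ ∞ ↔ Summable f := by
  refine ⟨fun h => ?_, fun h => h.tsum_ofReal_ne_top⟩
  exact (ENNReal.summable_toReal h).congr fun i => ENNReal.toReal_ofReal (hf i)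

theorem ae_summable_rawWeight (S : FiniteRSB) (n : ℕ) :
    ∀ᵐ ω ∂(sampleLaw n), Summable (rawWeight S ω.1) := by
  have h1 := ae_cascadeSum_ne_top (markLaw n) (V := Mark n) (h := fun _ => 1) measurable_const
    ENNReal.one_ne_top (fun _ => le_rfl) (m := S.level) (fun p => S.cdf_pos _)
    S.cdf_castSucc_lt_one S.strictMono_level (f := fun _ _ => 1) (σ := fun _ _ => 0)
    (fun _ => measurable_const) (fun _ => measurable_const) (fun _ _ => ENNReal.one_ne_top)
    (fun _ => by simp) 0
  filter_upwards [(measurePreserving_toTree n).quasiMeasurePreserving.ae h1,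
    ae_sampleLaw_pos n] with ω h2 hpos
  rw [← tsum_ofReal_ne_top_iff fun α => (rawWeight_pos S hpos α).le]
  convert h2 using 1
  unfold cascadeSum
  refine tsum_congr fun α => ?_
  rw [ofReal_rawWeight S hpos]
  simp [toTree]

/-- Given the exponential variables, the raw weights are summable and the spin integrals have
expectations bounded uniformly over the leaves, so Tonelli gives a finite expected sum. -/
theorem ae_summable_rawWeight_mul {β : ℕ → ℝ}
    (hβ : Summable fun p : ℕ => ((p : ℝ) + 2) * β (p + 2) ^ 2) {C : ℝ} (hC : 0 < C)
    {U : ℝ → ℝ → ℝ → ℝ} (hU : Admissible C U) (S : FiniteRSB) (n : ℕ) :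
    ∀ᵐ ω ∂(sampleLaw n),
      Summable fun α => rawWeight S ω.1 α * spinIntegral C U 0 (fieldMark β S ω.2 α) := by
  have hspin : ∀ α : Fin S.r → ℕ, Measurable fun g =>
      ENNReal.ofReal (spinIntegral C U 0 (fieldMark (n := n) β S g α)) := fun α =>
    ((continuous_spinIntegral hU.continuous 0).measurable.comp
      (measurable_fieldMark β S α)).ennreal_ofReal
  have hmeas : Measurable fun ω : Sample n => ∑' α : Fin S.r → ℕ,
      ENNReal.ofReal (rawWeight S ω.1 α) *
        ENNReal.ofReal (spinIntegral C U 0 (fieldMark β S ω.2 α)) :=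
    Measurable.tsum fun α =>
      ((measurable_rawWeight S α).comp measurable_fst).ennreal_ofReal.mul
        ((hspin α).comp measurable_snd)
  obtain ⟨B, hB, hle⟩ := lintegral_spinIntegral_fieldMark_ne_top hβ hC hU S n
  have hfin : ∀ᵐ ω ∂(sampleLaw n), ∑' α : Fin S.r → ℕ, ENNReal.ofReal (rawWeight S ω.1 α) *
        ENNReal.ofReal (spinIntegral C U 0 (fieldMark β S ω.2 α)) ≠ ∞ := by
    have hraw : ∀ᵐ E ∂(Measure.infinitePi fun _ : List ℕ => expMeasure 1),
        (∀ b, 0 < E b) ∧ Summable (rawWeight S E) := by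
      have h := (ae_sampleLaw_pos n).and (ae_summable_rawWeight S n)
      have h' := Measure.ae_ae_of_ae_prod h
      filter_upwards [h'] with E hE
      obtain ⟨g, hg⟩ := hE.exists
      exact hg
    unfold sampleLaw
    refine (Measure.ae_prod_iff_ae_ae (p := fun ω : Sample n => ∑' α : Fin S.r → ℕ,
      ENNReal.ofReal (rawWeight S ω.1 α) * ENNReal.ofReal (spinIntegral C U 0
        (fieldMark β S ω.2 α)) ≠ ∞) (measurableSet_eq_fun hmeas measurable_const).compl).mpr ?_
    filter_upwards [hraw] with E hE
    have hsum : ∫⁻ g, ∑' α : Fin S.r → ℕ, ENNReal.ofReal (rawWeight S E α) *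
        ENNReal.ofReal (spinIntegral C U 0 (fieldMark (n := n) β S g α))
        ∂((Measure.infinitePi fun _ => gaussianReal 0 1).prod
          (Measure.infinitePi fun _ => gaussianReal 0 1)) ≠ ∞ := by
      rw [lintegral_tsum fun α => ((hspin α).const_mul _).aemeasurable]
      refine ne_top_of_le_ne_top (ENNReal.mul_ne_top hE.2.tsum_ofReal_ne_top hB) ?_
      rw [← ENNReal.tsum_mul_right]
      refine ENNReal.tsum_le_tsum fun α => ?_
      rw [lintegral_const_mul' _ _ ENNReal.ofReal_ne_top]
      exact mul_le_mul_right (hle α) _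
    filter_upwards [ae_lt_top (Measurable.tsum fun α => (hspin α).const_mul _) hsum]
      with g hg using hg.ne
  filter_upwards [hfin, ae_sampleLaw_pos n] with ω h hpos
  have hp := fun α => (rawWeight_pos S hpos α).le
  rw [← tsum_ofReal_ne_top_iff fun α =>
    mul_nonneg (hp α) (spinIntegral_zero_pos hC hU.continuous _).le]
  simpa only [ENNReal.ofReal_mul (hp _)] using h

/-! ### Cascade averages on the event where the series converge -/

theorem cascadeTerm_eq {n : ℕ} (β : ℕ → ℝ) (C : ℝ) (U : ℝ → ℝ → ℝ → ℝ) (S : FiniteRSB)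
    (e : Fin n → ℕ) (ω : Sample n) :
    cascadeTerm β C U S e ω = fun α => (∑' γ, rawWeight S ω.1 γ)⁻¹ *
      (rawWeight S ω.1 α * spinIntegral C U e (fieldMark β S ω.2 α)) := by
  ext α
  change rawWeight S ω.1 α / _ * spinIntegral C U e (fieldMark β S ω.2 α) = _
  ring

/-- The series defining the cascade averages converge, and the denominators are positive. -/
structure Regular {n : ℕ} (β : ℕ → ℝ) (C : ℝ) (U : ℝ → ℝ → ℝ → ℝ) (S : FiniteRSB)
    (ω : Sample n) : Prop where
  pos : ∀ b, 0 < ω.1 b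
  weights : Summable (rawWeight S ω.1)
  denominator : Summable fun α => rawWeight S ω.1 α * spinIntegral C U 0 (fieldMark β S ω.2 α)

theorem ae_regular {β : ℕ → ℝ}
    (hβ : Summable fun p : ℕ => ((p : ℝ) + 2) * β (p + 2) ^ 2) {C : ℝ} (hC : 0 < C)
    {U : ℝ → ℝ → ℝ → ℝ} (hU : Admissible C U) (S : FiniteRSB) (n : ℕ) :
    ∀ᵐ ω ∂(sampleLaw n), Regular β C U S ω := by
  filter_upwards [ae_sampleLaw_pos n, ae_summable_rawWeight S n,
    ae_summable_rawWeight_mul hβ hC hU S n] with ω h1 h2 h3 using ⟨h1, h2, h3⟩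

namespace Regular

variable {n : ℕ} {β : ℕ → ℝ} {C : ℝ} {U : ℝ → ℝ → ℝ → ℝ} {S : FiniteRSB} {ω : Sample n}

theorem tsum_rawWeight_pos (h : Regular β C U S ω) : 0 < ∑' α, rawWeight S ω.1 α :=
  h.weights.tsum_pos (fun α => (rawWeight_pos S h.pos α).le) 0 (rawWeight_pos S h.pos 0)

theorem term_pos (h : Regular β C U S ω) (hC : 0 < C)
    (hU : Continuous fun p : ℝ × ℝ × ℝ => U p.1 p.2.1 p.2.2) (α : Fin S.r → ℕ) :
    0 < rawWeight S ω.1 α * spinIntegral C U 0 (fieldMark β S ω.2 α) :=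
  mul_pos (rawWeight_pos S h.pos α) (spinIntegral_zero_pos hC hU _)

theorem tsum_pos (h : Regular β C U S ω) (hC : 0 < C)
    (hU : Continuous fun p : ℝ × ℝ × ℝ => U p.1 p.2.1 p.2.2) :
    0 < ∑' α, rawWeight S ω.1 α * spinIntegral C U 0 (fieldMark β S ω.2 α) :=
  h.denominator.tsum_pos (fun α => (h.term_pos hC hU α).le) 0 (h.term_pos hC hU 0)

theorem abs_term_le (h : Regular β C U S ω) (hC : 0 < C)
    (hU : Continuous fun p : ℝ × ℝ × ℝ => U p.1 p.2.1 p.2.2) (e : Fin n → ℕ) (α : Fin S.r → ℕ) :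
    |rawWeight S ω.1 α * spinIntegral C U e (fieldMark β S ω.2 α)| ≤
      C ^ (∑ i, e i) * (rawWeight S ω.1 α * spinIntegral C U 0 (fieldMark β S ω.2 α)) := by
  rw [abs_mul, abs_of_pos (rawWeight_pos S h.pos α), mul_left_comm]
  exact mul_le_mul_of_nonneg_left (abs_spinIntegral_le hC hU e _) (rawWeight_pos S h.pos α).le

theorem summable (h : Regular β C U S ω) (hC : 0 < C)
    (hU : Continuous fun p : ℝ × ℝ × ℝ => U p.1 p.2.1 p.2.2) (e : Fin n → ℕ) :
    Summable fun α => rawWeight S ω.1 α * spinIntegral C U e (fieldMark β S ω.2 α) :=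
  (h.denominator.mul_left _).of_norm_bounded fun α => h.abs_term_le hC hU e α

theorem cascadeAverage_eq (h : Regular β C U S ω) (e : Fin n → ℕ) :
    cascadeAverage β C U S e ω =
      (∑' α, rawWeight S ω.1 α * spinIntegral C U e (fieldMark β S ω.2 α)) /
        ∑' α, rawWeight S ω.1 α * spinIntegral C U 0 (fieldMark β S ω.2 α) := by
  unfold cascadeAverage
  rw [cascadeTerm_eq, cascadeTerm_eq, tsum_mul_left, tsum_mul_left,
    mul_div_mul_left _ _ (inv_pos.mpr h.tsum_rawWeight_pos).ne']

theorem abs_cascadeAverage_le (h : Regular β C U S ω) (hC : 0 < C)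
    (hU : Continuous fun p : ℝ × ℝ × ℝ => U p.1 p.2.1 p.2.2) (e : Fin n → ℕ) :
    |cascadeAverage β C U S e ω| ≤ C ^ (∑ i, e i) := by
  rw [h.cascadeAverage_eq, abs_div, abs_of_pos (h.tsum_pos hC hU), div_le_iff₀ (h.tsum_pos hC hU),
    ← tsum_mul_left]
  have h1 := (h.summable hC hU e).abs
  refine (norm_tsum_le_tsum_norm (f := fun α =>
    rawWeight S ω.1 α * spinIntegral C U e (fieldMark β S ω.2 α)) h1).trans ?_
  exact h1.tsum_le_tsum (fun α => h.abs_term_le hC hU e α) (h.denominator.mul_left _)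

end Regular

/-! ### Cascade averages as ratios of cascade sums -/

section Ratio

variable {n k : ℕ} {β : ℕ → ℝ} {C : ℝ} {U V : ℝ → ℝ → ℝ → ℝ} {S : FiniteRSB}

/-- The tilt by `exp(A ∑_i Y^i)`, at a vertex of depth `p + 1`. -/
noncomputable def tiltWeight (β : ℕ → ℝ) (S : FiniteRSB) (A : ℝ) (p : Fin S.r) (g : Mark n) :
    ℝ≥0∞ :=
  ENNReal.ofReal (Real.exp (A * ∑ i, (branchStep β S p g).1 i))

theorem measurable_tiltWeight (β : ℕ → ℝ) (S : FiniteRSB) (A : ℝ) (p : Fin S.r) :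
    Measurable (tiltWeight (n := n) β S A p) := by
  unfold tiltWeight branchStep
  fun_prop

/-- The integral over the spins, shifted so as to be nonnegative. -/
noncomputable def shiftedSpin (C : ℝ) (U : ℝ → ℝ → ℝ → ℝ) (e : Fin n → ℕ) (v : Mark n) : ℝ :=
  spinIntegral C U e v + C ^ (∑ i, e i) * spinIntegral C U 0 v

theorem shiftedSpin_nonneg (hC : 0 < C) (hU : Continuous fun p : ℝ × ℝ × ℝ => U p.1 p.2.1 p.2.2)
    (e : Fin n → ℕ) (v : Mark n) : 0 ≤ shiftedSpin C U e v := by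
  have := (abs_le.mp (abs_spinIntegral_le hC hU e v)).1
  unfold shiftedSpin
  linarith

theorem measurable_shiftedSpin (hU : Continuous fun p : ℝ × ℝ × ℝ => U p.1 p.2.1 p.2.2)
    (e : Fin n → ℕ) : Measurable (shiftedSpin C U e) :=
  Continuous.measurable ((continuous_spinIntegral hU e).add
    (continuous_const.mul (continuous_spinIntegral hU 0)))

theorem spinIntegral_add_fun (η : ℝ → ℝ)
    (e : Fin n → ℕ) (v : Mark n) :
    spinIntegral C (fun y z s => η y + U y z s) e v =
      Real.exp (∑ i, η (v.1 i)) * spinIntegral C U e v := by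
  unfold spinIntegral
  rw [Real.exp_sum, ← Finset.prod_mul_distrib]
  refine Finset.prod_congr rfl fun i _ => ?_
  rw [← intervalIntegral.integral_const_mul]
  congr 1
  ext s
  rw [Real.exp_add]
  ring

theorem spinIntegral_add_linear {A : ℝ} (hV : ∀ y z s, V y z s = A * y + U y z s)
    (e : Fin n → ℕ) (v : Mark n) :
    spinIntegral C V e v = Real.exp (A * ∑ i, v.1 i) * spinIntegral C U e v := by
  obtain rfl : V = fun y z s => A * y + U y z s := by
    ext y z s
    exact hV y z s
  rw [spinIntegral_add_fun (fun y => A * y), Finset.mul_sum]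

theorem shiftedSpin_add_linear {A : ℝ} (hV : ∀ y z s, V y z s = A * y + U y z s)
    (e : Fin n → ℕ) (v : Mark n) :
    shiftedSpin C V e v = Real.exp (A * ∑ i, v.1 i) * shiftedSpin C U e v := by
  unfold shiftedSpin
  rw [spinIntegral_add_linear hV, spinIntegral_add_linear hV]
  ring

/-- The numerators of the cascade averages and, at `none`, their denominator. -/
noncomputable def cascadeVector (β : ℕ → ℝ) (C : ℝ) (U : ℝ → ℝ → ℝ → ℝ) (S : FiniteRSB)
    (A : ℝ) (e : Fin k → Fin n → ℕ) (ω : List ℕ → ℝ × Mark n) (i : Option (Fin k)) : ℝ≥0∞ :=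
  cascadeSum S.level (tiltWeight β S A) (branchStep β S)
    (fun v => ENNReal.ofReal (shiftedSpin C U (i.elim 0 e) v)) (rootStep β S (ω []).2) ω

theorem measurable_cascadeVector (hU : Continuous fun p : ℝ × ℝ × ℝ => U p.1 p.2.1 p.2.2)
    (A : ℝ) (e : Fin k → Fin n → ℕ) : Measurable (cascadeVector β C U S A e) :=
  measurable_pi_lambda _ fun _ => measurable_cascadeSum
    ((measurable_rootStep β S).comp (measurable_snd.comp (measurable_pi_apply []))) measurable_id _
    (measurable_tiltWeight β S A) (measurable_branchStep β S)
    (measurable_shiftedSpin hU _).ennreal_ofReal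

/-- The product of the cascade averages, in terms of the vector of numerators and denominator. -/
noncomputable def ratioProduct (M : Fin k → ℝ) (v : Option (Fin k) → ℝ≥0∞) : ℝ :=
  ∏ l, (2 * ((v (some l)).toReal / (v none).toReal) - M l)

theorem measurable_ratioProduct (M : Fin k → ℝ) : Measurable (ratioProduct M) := by
  unfold ratioProduct
  fun_prop

theorem ratioProduct_const_mul (M : Fin k → ℝ) {κ : ℝ≥0∞} (h0 : κ ≠ 0) (ht : κ ≠ ∞)
    (v : Option (Fin k) → ℝ≥0∞) : ratioProduct M (fun i => κ * v i) = ratioProduct M v := by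
  unfold ratioProduct
  refine Finset.prod_congr rfl fun l _ => ?_
  rw [ENNReal.toReal_mul, ENNReal.toReal_mul,
    mul_div_mul_left _ _ (ENNReal.toReal_ne_zero.mpr ⟨h0, ht⟩)]

/-- The factor exp(A ∑ Y^i) splits along the path into tilts at the vertices. The root factor is
common to all leaves and stands outside the cascade sum, so it will cancel in the ratios. -/
theorem ofReal_exp_mul_cascadeVector {A : ℝ} (hV : ∀ y z s, V y z s = A * y + U y z s)
    {ω : Sample n} (hω : ∀ b, 0 < ω.1 b) (e : Fin k → Fin n → ℕ) (i : Option (Fin k)) :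
    ENNReal.ofReal (Real.exp (A * ∑ j, (rootStep β S (toTree ω []).2).1 j)) *
      cascadeVector β C U S A e (toTree ω) i =
    ∑' α, ENNReal.ofReal (rawWeight S ω.1 α *
      shiftedSpin C V (i.elim 0 e) (fieldMark β S ω.2 α)) := by
  unfold cascadeVector cascadeSum
  rw [← ENNReal.tsum_mul_left]
  refine tsum_congr fun α => ?_
  rw [← fieldMark_eq, shiftedSpin_add_linear hV, ENNReal.ofReal_mul (rawWeight_pos S hω α).le,
    ENNReal.ofReal_mul (Real.exp_pos _).le, ofReal_rawWeight S hω, Finset.prod_mul_distrib]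
  have h1 : ENNReal.ofReal (Real.exp (A * ∑ j, (fieldMark β S ω.2 α).1 j)) =
      ENNReal.ofReal (Real.exp (A * ∑ j, (rootStep β S (toTree ω []).2).1 j)) *
        ∏ p : Fin S.r, tiltWeight β S A p (toTree ω (anc α (p + 1))).2 := by
    unfold tiltWeight
    rw [← ENNReal.ofReal_prod_of_nonneg fun _ _ => (Real.exp_pos _).le, ← Real.exp_sum,
      ← ENNReal.ofReal_mul (Real.exp_pos _).le, ← Real.exp_add, ← Finset.mul_sum, ← mul_add,
      Finset.sum_comm, ← Finset.sum_add_distrib, fieldMark_eq]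
    simp [Prod.fst_sum]
  rw [h1]
  simp only [toTree]
  ring

/-- Numerators N may be negative, whereas cascade sums take values in [0, ∞]. With M = C^{∑ e}, the
shifted numerator is N + M D. The entry at `none` is shifted by the same rule with e = 0 and becomes
2 D, whence N / D = 2 (N + M D) / (2 D) - M. -/
theorem ae_prod_cascadeAverage_eq
    (hβ : Summable fun p : ℕ => ((p : ℝ) + 2) * β (p + 2) ^ 2) (hC : 0 < C)
    (hVa : Admissible C V) {A : ℝ} (hV : ∀ y z s, V y z s = A * y + U y z s)
    (e : Fin k → Fin n → ℕ) :
    ∀ᵐ ω ∂(sampleLaw n), ∏ l, cascadeAverage β C V S (e l) ω =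
      ratioProduct (fun l => C ^ (∑ i, e l i)) (cascadeVector β C U S A e (toTree ω)) := by
  filter_upwards [ae_regular hβ hC hVa S n] with ω hω
  have hVc := hVa.continuous
  have key : ∀ i : Option (Fin k),
      (ENNReal.ofReal (Real.exp (A * ∑ j, (rootStep β S (toTree ω []).2).1 j)) *
        cascadeVector β C U S A e (toTree ω) i).toReal =
      ∑' α, rawWeight S ω.1 α * spinIntegral C V (i.elim 0 e) (fieldMark β S ω.2 α) +
        C ^ (∑ j, i.elim 0 e j) *
          ∑' α, rawWeight S ω.1 α * spinIntegral C V 0 (fieldMark β S ω.2 α) := by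
    intro i
    rw [ofReal_exp_mul_cascadeVector hV hω.pos, ← tsum_mul_left,
      ← (hω.summable hC hVc _).tsum_add (hω.denominator.mul_left _)]
    have h1 : ∀ α, rawWeight S ω.1 α * shiftedSpin C V (i.elim 0 e) (fieldMark β S ω.2 α) =
        rawWeight S ω.1 α * spinIntegral C V (i.elim 0 e) (fieldMark β S ω.2 α) +
        C ^ (∑ j, i.elim 0 e j) * (rawWeight S ω.1 α * spinIntegral C V 0 (fieldMark β S ω.2 α)) := by
      intro α
      unfold shiftedSpin
      ring
    have h2 : ∀ α, 0 ≤ rawWeight S ω.1 α * shiftedSpin C V (i.elim 0 e) (fieldMark β S ω.2 α) :=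
      fun α => mul_nonneg (rawWeight_pos S hω.pos α).le (shiftedSpin_nonneg hC hVc _ _)
    have h3 := ((hω.summable hC hVc (i.elim 0 e)).add
      (hω.denominator.mul_left (C ^ (∑ j, i.elim 0 e j)))).congr fun α => (h1 α).symm
    rw [← ENNReal.ofReal_tsum_of_nonneg h2 h3, ENNReal.toReal_ofReal (tsum_nonneg h2)]
    exact tsum_congr h1
  rw [← ratioProduct_const_mul _ (κ := ENNReal.ofReal (Real.exp
    (A * ∑ j, (rootStep β S (toTree ω []).2).1 j)))
    (by simpa using Real.exp_pos _) ENNReal.ofReal_ne_top, ratioProduct]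
  refine Finset.prod_congr rfl fun l _ => ?_
  rw [key, key, hω.cascadeAverage_eq]
  have hD := hω.tsum_pos hC hVc
  simp only [Option.elim, Pi.zero_apply, Finset.sum_const_zero, pow_zero, one_mul]
  field_simp
  ring

theorem wellDefined (hβ : Summable fun p : ℕ => ((p : ℝ) + 2) * β (p + 2) ^ 2) (hC : 0 < C)
    (hU : Admissible C U) (S : FiniteRSB) (e : Fin k → Fin n → ℕ) : WellDefined β C U S e := by
  have hreg := ae_regular hβ hC hU S n
  have hsum : ∀ e' : Fin n → ℕ, ∀ᵐ ω ∂(sampleLaw n), Summable (cascadeTerm β C U S e' ω) := by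
    intro e'
    filter_upwards [hreg] with ω hω
    rw [cascadeTerm_eq]
    exact (hω.summable hC hU.continuous e').mul_left _
  refine ⟨?_, fun l => hsum _, ?_, ?_⟩
  · filter_upwards [hreg] with ω hω using ⟨hω.weights, hω.tsum_rawWeight_pos⟩
  · filter_upwards [hreg, hsum 0] with ω hω h0
    refine ⟨h0, ?_⟩
    rw [cascadeTerm_eq, tsum_mul_left]
    exact mul_pos (inv_pos.mpr hω.tsum_rawWeight_pos) (hω.tsum_pos hC hU.continuous)
  -- The representation by cascade sums, here without tilt, provides measurability; integrability
  -- then follows from the bound |s| ≤ C.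
  · have hae := ae_prod_cascadeAverage_eq (S := S) (U := U) (A := 0) hβ hC hU
      (fun y z s => by simp) e
    have hm := ((measurable_ratioProduct fun l => C ^ (∑ i, e l i)).comp
      (measurable_cascadeVector (β := β) (C := C) (S := S) hU.continuous 0 e)).comp
      (measurePreserving_toTree n).measurable
    have : IsProbabilityMeasure (sampleLaw n) := by
      unfold sampleLaw
      infer_instance
    refine Integrable.of_bound (hm.aestronglyMeasurable.congr
      (hae.mono fun ω h => h.symm)) (∏ l, C ^ (∑ i, e l i)) ?_
    filter_upwards [hreg] with ω hω
    rw [Real.norm_eq_abs, Finset.abs_prod]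
    exact Finset.prod_le_prod (fun _ _ => abs_nonneg _) fun l _ =>
      hω.abs_cascadeAverage_le hC hU.continuous (e l)

/-! ### Invariance of the cascade under Gaussian tilts -/

/-- The shift of `Y^i` per unit of tilt. -/
noncomputable def FiniteRSB.shift (S : FiniteRSB) (β : ℕ → ℝ) : ℝ :=
  ∑ p : Fin S.r, (thetaY β (S.q p.succ) - thetaY β (S.q p.castSucc)) * S.level p

/-- With a² the increment of x ξ'(x), the power m of the tilt is exp(m A a ∑ g_i). By Cameron–Martin
it shifts each g_i by m A a, and hence the increment a g_i of Y^i by A a² m. The marks of Z are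
untouched. -/
theorem lintegral_tiltWeight_rpow_mul
    (hβ : Summable fun p : ℕ => ((p : ℝ) + 2) * β (p + 2) ^ 2) (A : ℝ) (p : Fin S.r)
    {F : Mark n → ℝ≥0∞} (hF : Measurable F) :
    ∫⁻ g, tiltWeight β S A p g ^ S.level p * F (branchStep β S p g) ∂(markLaw n) =
      ENNReal.ofReal (Real.exp (n * ((S.level p * A *
        √(thetaY β (S.q p.succ) - thetaY β (S.q p.castSucc))) ^ 2 / 2))) *
      ∫⁻ g, F (branchStep β S p g + (fun _ => A *
        ((thetaY β (S.q p.succ) - thetaY β (S.q p.castSucc)) * S.level p), 0)) ∂(markLaw n) := by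
  have hθ := thetaY_mono hβ (S.q_mem p.castSucc).1 (S.q_castSucc_le_q_succ p) (S.q_mem p.succ).2
  set a := √(thetaY β (S.q p.succ) - thetaY β (S.q p.castSucc)) with ha
  have ha2 : thetaY β (S.q p.succ) - thetaY β (S.q p.castSucc) = a * a :=
    (Real.mul_self_sqrt (sub_nonneg.mpr hθ)).symm
  have hb := measurable_branchStep (n := n) β S p
  have hw : ∀ g : Mark n, tiltWeight β S A p g ^ S.level p =
      ENNReal.ofReal (Real.exp (S.level p * A * a * ∑ i, g.1 i)) := by
    intro g
    unfold tiltWeight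
    rw [ENNReal.ofReal_rpow_of_pos (Real.exp_pos _), ← Real.exp_mul]
    congr 2
    simp only [branchStep, ← ha, ← Finset.mul_sum]
    ring
  have hm₁ : Measurable fun g : Mark n => tiltWeight β S A p g ^ S.level p *
      F (branchStep β S p g) :=
    ((measurable_tiltWeight β S A p).pow_const _).mul (hF.comp hb)
  have hm₂ : Measurable fun g : Mark n => F (branchStep β S p g + (fun _ => A *
        ((thetaY β (S.q p.succ) - thetaY β (S.q p.castSucc)) * S.level p), 0)) :=
    hF.comp (hb.add_const _)
  unfold markLaw
  rw [lintegral_prod_symm' _ hm₁, lintegral_prod_symm' _ hm₂, ← lintegral_const_mul' _ _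
    ENNReal.ofReal_ne_top]
  refine lintegral_congr fun z => ?_
  have h := lintegral_exp_mul_pi_gaussianReal (ι := Fin n) (S.level p * A * a)
    (F := fun y => F (branchStep β S p (y, z))) (hF.comp (hb.comp (by fun_prop)))
  simp only [hw]
  rw [h, Fintype.card_fin]
  congr 1
  refine lintegral_congr fun y => ?_
  congr 1
  ext i
  · simp only [branchStep, Prod.fst_add, Pi.add_apply, ← ha]
    rw [ha2]
    ring
  · simp [branchStep]

/-- Both moments are integrals of one function of the vector of numerators and denominator, and that
function is invariant under a common scaling. By the invariance of the cascade, the two vectors have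
the same law up to the factor κ. -/
theorem cascadeMoment_add_linear
    (hβ : Summable fun p : ℕ => ((p : ℝ) + 2) * β (p + 2) ^ 2) (hC : 0 < C)
    (hVa : Admissible C V) {A : ℝ} (hV : ∀ y z s, V y z s = A * y + U y z s)
    (hU : Continuous fun p : ℝ × ℝ × ℝ => U p.1 p.2.1 p.2.2)
    (hWa : Admissible C fun y z s => U (y + A * S.shift β) z s) (e : Fin k → Fin n → ℕ) :
    cascadeMoment β C V S e = cascadeMoment β C (fun y z s => U (y + A * S.shift β) z s) S e := by
  set M : Fin k → ℝ := fun l => C ^ (∑ i, e l i) with hM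
  have hmp := measurePreserving_toTree n
  have hΨ := measurable_ratioProduct M
  have e₁ : ∀ {V' U' : ℝ → ℝ → ℝ → ℝ} {A' : ℝ}, Admissible C V' →
      (Continuous fun p : ℝ × ℝ × ℝ => U' p.1 p.2.1 p.2.2) →
      (∀ y z s, V' y z s = A' * y + U' y z s) → cascadeMoment β C V' S e =
        ∫ v, ratioProduct M v ∂((treeLaw (markLaw n)).map (cascadeVector β C U' S A' e)) := by
    intro V' U' A' hVa' hU' hV'
    have hm := measurable_cascadeVector (β := β) (C := C) (S := S) hU' A' e
    rw [integral_map hm.aemeasurable hΨ.aestronglyMeasurable, ← hmp.map_eq,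
      integral_map (f := fun ω => ratioProduct M (cascadeVector β C U' S A' e ω))
        hmp.measurable.aemeasurable (hΨ.comp hm).aestronglyMeasurable]
    exact integral_congr_ae (ae_prod_cascadeAverage_eq hβ hC hVa' hV' e)
  rw [e₁ hVa hU hV, e₁ (A' := 0) (U' := fun y z s => U (y + A * S.shift β) z s) hWa
    hWa.continuous fun y z s => by simp]
  set τ : Fin S.r → Mark n → Mark n := fun p g => branchStep β S p g + (fun _ => A *
        ((thetaY β (S.q p.succ) - thetaY β (S.q p.castSucc)) * S.level p), 0) with hτ
  obtain ⟨κ, hκ0, hκt, hκ⟩ := exists_map_cascadeSum_root_eq (markLaw n) (m := S.level)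
    (fun p => S.cdf_pos _) S.cdf_castSucc_lt_one S.strictMono_level (measurable_tiltWeight β S A)
    (measurable_branchStep β S) (τ := τ) (fun p => (measurable_branchStep β S p).add_const _)
    (fun p g => ENNReal.ofReal_ne_top) fun p => ⟨_, by simpa using Real.exp_pos _,
      ENNReal.ofReal_ne_top, fun F hF => lintegral_tiltWeight_rpow_mul hβ A p hF⟩
  have h1 := hκ (fun (i : Option (Fin k)) v => ENNReal.ofReal (shiftedSpin C U (i.elim 0 e) v))
    (fun i => (measurable_shiftedSpin hU _).ennreal_ofReal) (rootStep β S) (measurable_rootStep β S)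
  have h2 : (fun (ω : List ℕ → ℝ × Mark n) (i : Option (Fin k)) =>
      κ * cascadeSum S.level (fun _ _ => 1) τ
        (fun v => ENNReal.ofReal (shiftedSpin C U (i.elim 0 e) v)) (rootStep β S (ω []).2) ω) =
      (fun v i => κ * v i) ∘
        cascadeVector β C (fun y z s => U (y + A * S.shift β) z s) S 0 e := by
    ext ω i
    simp only [Function.comp_apply, cascadeVector, cascadeSum]
    congr 1
    refine tsum_congr fun α => ?_
    congr 1
    · simp [tiltWeight]
    · congr 1
      -- The shifts are deterministic and depend on the depth only. They add up to the same amount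
      -- at every leaf and can be moved into U.
      have h3 : ∑ p : Fin S.r, τ p (ω (anc α (p + 1))).2 =
          ∑ p : Fin S.r, branchStep β S p (ω (anc α (p + 1))).2 +
            (fun _ => A * S.shift β, 0) := by
        rw [hτ, Finset.sum_add_distrib]
        congr 1
        ext i
        · simp [Prod.fst_sum, FiniteRSB.shift, Finset.mul_sum]
        · simp [Prod.snd_sum]
      rw [h3, ← add_assoc]
      generalize rootStep β S (ω []).2 + _ = v
      simp [shiftedSpin, spinIntegral]
  change ∫ v, ratioProduct M v ∂((treeLaw (markLaw n)).map fun ω i => cascadeSum S.level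
    (tiltWeight β S A) (branchStep β S) (fun v => ENNReal.ofReal (shiftedSpin C U (i.elim 0 e) v))
      (rootStep β S (ω []).2) ω) = _
  have hscale : Measurable fun (v : Option (Fin k) → ℝ≥0∞) i => κ * v i := by fun_prop
  rw [h1, h2, ← Measure.map_map hscale (measurable_cascadeVector hWa.continuous 0 e),
    integral_map hscale.aemeasurable hΨ.aestronglyMeasurable]
  exact integral_congr_ae (Eventually.of_forall fun v => ratioProduct_const_mul M hκ0 hκt v)

end Ratio

/-! ### The exponents -/

theorem Admissible.of_le {C : ℝ} {U : ℝ → ℝ → ℝ → ℝ} {a b : ℝ → ℝ}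
    (hU : Continuous fun p : ℝ × ℝ × ℝ => U p.1 p.2.1 p.2.2) (ha : Continuous a)
    (hb : Continuous b) (h : ∀ y z s, U y z s ≤ a s + b s * (|y| + |z|)) : Admissible C U := by
  obtain ⟨K, hK⟩ := (isCompact_Icc (a := -C) (b := C)).bddAbove_image ha.continuousOn
  obtain ⟨c, hc⟩ := (isCompact_Icc (a := -C) (b := C)).bddAbove_image hb.continuousOn
  refine ⟨hU, K, max c 0, le_max_right _ _, fun y z s hs => (h y z s).trans ?_⟩
  have h1 := hK (Set.mem_image_of_mem a (Set.mem_Icc.mpr (abs_le.mp hs)))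
  have h2 := hc (Set.mem_image_of_mem b (Set.mem_Icc.mpr (abs_le.mp hs)))
  have h3 : b s * (|y| + |z|) ≤ max c 0 * (|y| + |z|) :=
    mul_le_mul_of_nonneg_right (h2.trans (le_max_left _ _)) (by positivity)
  linarith

theorem mul_add_mul_le (y z t s : ℝ) : y * t + z * s ≤ (|t| + |s|) * (|y| + |z|) := by
  have h1 := le_abs_self (y * t)
  have h2 := le_abs_self (z * s)
  rw [abs_mul] at h1 h2
  nlinarith [mul_nonneg (abs_nonneg t) (abs_nonneg z), mul_nonneg (abs_nonneg s) (abs_nonneg y)]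

/-- The exponent in `F^{R,C,E}(ζ)` without its term `A y`, where `A = √(R² + 1)`. -/
noncomputable def exponentPert (β : ℕ → ℝ) (A : ℝ) (S : FiniteRSB) (y z s : ℝ) : ℝ :=
  -(1 / 2) * s ^ 2 * (1 + xiDeriv β S.qStar * (1 - S.qStar)) + z * s - y * (s ^ 2 / (2 * A))
    + (xiDeriv β 1 - S.qStar * xiDeriv β S.qStar) * s ^ 4 / (4 * A ^ 2)

theorem exponentR_eq (β : ℕ → ℝ) (R : ℝ) (S : FiniteRSB) (y z s : ℝ) :
    exponentR β R S y z s = √(R ^ 2 + 1) * y + exponentPert β (√(R ^ 2 + 1)) S y z s := by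
  unfold exponentR exponentPert
  rw [Real.sq_sqrt (by positivity)]
  ring

/-- The shift A·`shift` meets the coefficient -s²/(2A), and A cancels. This produces the sum in Ŝ_ζ,
and only terms of order 1/A and 1/A² remain. -/
theorem exponentPert_add_shift (β : ℕ → ℝ) {A : ℝ} (hA : A ≠ 0) (S : FiniteRSB) (y z s : ℝ) :
    exponentPert β A S (y + A * S.shift β) z s = exponentLim β S y z s +
      (-y * (s ^ 2 / (2 * A)) +
        (xiDeriv β 1 - S.qStar * xiDeriv β S.qStar) * s ^ 4 / (4 * A ^ 2)) := by
  have h : S.sHat β = xiDeriv β S.qStar * (1 - S.qStar) + S.shift β := rfl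
  have h2 : A * S.shift β * (s ^ 2 / (2 * A)) = S.shift β * s ^ 2 / 2 := by
    field_simp
  unfold exponentPert exponentLim
  rw [h, add_mul, h2]
  ring

theorem continuous_exponentPert (β : ℕ → ℝ) (A : ℝ) (S : FiniteRSB) :
    Continuous fun p : ℝ × ℝ × ℝ => exponentPert β A S p.1 p.2.1 p.2.2 := by
  unfold exponentPert
  fun_prop

/-- Covers two exponents: the original one (B = A, t = 0) and the one after the tilt (B = 0, t =
A·`shift`). -/
theorem admissible_exponentPert_add (β : ℕ → ℝ) (A B C t : ℝ) (S : FiniteRSB) :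
    Admissible C fun y z s => B * y + exponentPert β A S (y + t) z s := by
  have hc := continuous_exponentPert β A S
  refine Admissible.of_le (a := fun s => -(1 / 2) * s ^ 2 * (1 + xiDeriv β S.qStar * (1 - S.qStar))
      - t * (s ^ 2 / (2 * A))
      + (xiDeriv β 1 - S.qStar * xiDeriv β S.qStar) * s ^ 4 / (4 * A ^ 2))
    (b := fun s => |B - s ^ 2 / (2 * A)| + |s|) ?_ (by fun_prop) (by fun_prop) fun y z s => ?_
  · unfold exponentPert
    fun_prop
  · have := mul_add_mul_le y z (B - s ^ 2 / (2 * A)) s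
    unfold exponentPert
    linarith

theorem admissible_exponentLim_add (β : ℕ → ℝ) (C c c' : ℝ) (S : FiniteRSB) :
    Admissible C fun y z s => (c * |y| + c') + exponentLim β S y z s := by
  refine Admissible.of_le (a := fun s => c' + -(1 / 2) * s ^ 2 * (1 + S.sHat β))
    (b := fun s => |c| + |s|) ?_ (by fun_prop) (by fun_prop) fun y z s => ?_
  · unfold exponentLim
    fun_prop
  · have := mul_add_mul_le |y| z c s
    rw [abs_abs] at this
    unfold exponentLim
    linarith

/-! ### Differences of products and of ratios -/

theorem abs_prod_sub_prod_le {ι : Type*} (s : Finset ι) {a a' b t : ι → ℝ}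
    (ha : ∀ i, |a i| ≤ b i) (ht : ∀ i, 1 ≤ t i) (h : ∀ i, |a' i - a i| ≤ b i * (t i - 1)) :
    |∏ i ∈ s, a' i - ∏ i ∈ s, a i| ≤ (∏ i ∈ s, b i) * (∏ i ∈ s, t i - 1) := by
  classical
  induction s using Finset.induction_on with
  | empty => simp
  | insert j s hj ih =>
    rw [Finset.prod_insert hj, Finset.prod_insert hj, Finset.prod_insert hj, Finset.prod_insert hj]
    have hb : ∀ i, 0 ≤ b i := fun i => (abs_nonneg _).trans (ha i)
    have hB : 0 ≤ ∏ i ∈ s, b i := Finset.prod_nonneg fun i _ => hb i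
    have hP : |∏ i ∈ s, a i| ≤ ∏ i ∈ s, b i := by
      rw [Finset.abs_prod]
      exact Finset.prod_le_prod (fun _ _ => abs_nonneg _) fun i _ => ha i
    have hP' : |∏ i ∈ s, a' i| ≤ (∏ i ∈ s, b i) * ∏ i ∈ s, t i := by
      have := abs_add_le (∏ i ∈ s, a' i - ∏ i ∈ s, a i) (∏ i ∈ s, a i)
      rw [sub_add_cancel] at this
      linarith
    calc |a' j * ∏ i ∈ s, a' i - a j * ∏ i ∈ s, a i|
        = |(a' j - a j) * ∏ i ∈ s, a' i + a j * (∏ i ∈ s, a' i - ∏ i ∈ s, a i)| := by ring_nf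
      _ ≤ |a' j - a j| * |∏ i ∈ s, a' i| + |a j| * |∏ i ∈ s, a' i - ∏ i ∈ s, a i| := by
          rw [← abs_mul, ← abs_mul]
          exact abs_add_le _ _
      _ ≤ b j * (t j - 1) * ((∏ i ∈ s, b i) * ∏ i ∈ s, t i) +
          b j * ((∏ i ∈ s, b i) * (∏ i ∈ s, t i - 1)) := by
          refine add_le_add (mul_le_mul (h j) hP' (abs_nonneg _) ?_)
            (mul_le_mul (ha j) ih (abs_nonneg _) (hb j))
          exact mul_nonneg (hb j) (by linarith [ht j])
      _ = _ := by ring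

theorem abs_prod_sub_prod_le_card {ι : Type*} (s : Finset ι) {a a' M : ι → ℝ} {x : ℝ}
    (ha : ∀ i, |a i| ≤ M i) (ha' : ∀ i, |a' i| ≤ M i) (h : ∀ i, |a' i - a i| ≤ M i * x) :
    |∏ i ∈ s, a' i - ∏ i ∈ s, a i| ≤ s.card * x * ∏ i ∈ s, M i := by
  classical
  induction s using Finset.induction_on with
  | empty => simp
  | insert j s hj ih =>
    rw [Finset.prod_insert hj, Finset.prod_insert hj, Finset.prod_insert hj,
      Finset.card_insert_of_notMem hj]
    have hM : ∀ i, 0 ≤ M i := fun i => (abs_nonneg _).trans (ha i)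
    have hP' : |∏ i ∈ s, a' i| ≤ ∏ i ∈ s, M i := by
      rw [Finset.abs_prod]
      exact Finset.prod_le_prod (fun _ _ => abs_nonneg _) fun i _ => ha' i
    calc |a' j * ∏ i ∈ s, a' i - a j * ∏ i ∈ s, a i|
        = |(a' j - a j) * ∏ i ∈ s, a' i + a j * (∏ i ∈ s, a' i - ∏ i ∈ s, a i)| := by ring_nf
      _ ≤ |a' j - a j| * |∏ i ∈ s, a' i| + |a j| * |∏ i ∈ s, a' i - ∏ i ∈ s, a i| := by
          rw [← abs_mul, ← abs_mul]
          exact abs_add_le _ _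
      _ ≤ M j * x * (∏ i ∈ s, M i) + M j * (s.card * x * ∏ i ∈ s, M i) :=
          add_le_add (mul_le_mul (h j) hP' (abs_nonneg _) ((abs_nonneg _).trans (h j)))
            (mul_le_mul (ha j) ih (abs_nonneg _) (hM j))
      _ = _ := by
          push_cast
          ring

/-- The difference is written over D alone, with D' occurring only in the bounded ratio N' / D'. In
the application D is the limiting denominator, which does not involve Y. -/
theorem abs_div_sub_div_le {N N' D D' M E : ℝ} (hD : 0 < D) (hD' : 0 < D') (hN' : |N'| ≤ M * D')
    (hNE : |N' - N| ≤ M * E) (hDE : |D' - D| ≤ E) : |N' / D' - N / D| ≤ M * (2 * (E / D)) := by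
  have hE : 0 ≤ E := (abs_nonneg _).trans hDE
  have h1 : N' / D' - N / D = (N' / D' * (D - D') + (N' - N)) / D := by
    field_simp
    ring
  have h2 : |N' / D'| ≤ M := by
    rwa [abs_div, abs_of_pos hD', div_le_iff₀ hD']
  have hM : 0 ≤ M := (abs_nonneg _).trans h2
  rw [h1, abs_div, abs_of_pos hD, div_le_iff₀ hD]
  calc |N' / D' * (D - D') + (N' - N)| ≤ |N' / D'| * |D - D'| + |N' - N| := by
        rw [← abs_mul]
        exact abs_add_le _ _
    _ ≤ M * E + M * E := by
        rw [abs_sub_comm D D']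
        exact add_le_add (mul_le_mul h2 hDE (abs_nonneg _) hM) hNE
    _ = M * (2 * (E / D)) * D := by
        field_simp
        ring

theorem abs_exp_sub_one_le_exp_abs (x : ℝ) : |Real.exp x - 1| ≤ Real.exp |x| - 1 := by
  rcases le_total 0 x with h | h
  · rw [abs_of_nonneg h, abs_of_nonneg (by linarith [Real.add_one_le_exp x])]
  · rw [abs_of_nonpos h, abs_of_nonpos (by linarith [Real.exp_le_one_iff.mpr h])]
    have h1 : Real.exp x * Real.exp (-x) = 1 := by rw [← Real.exp_add]; simp
    nlinarith [Real.exp_pos x, Real.exp_pos (-x), sq_nonneg (Real.exp x - 1),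
      Real.add_one_le_exp (-x)]

/-- Convexity of exp between 0 and x. It takes the small factor t = 1/A out of the exponent, at the
price of the exponential moment at t = 1. -/
theorem exp_mul_sub_one_le {t : ℝ} (h0 : 0 ≤ t) (h1 : t ≤ 1) (x : ℝ) :
    Real.exp (t * x) - 1 ≤ t * Real.exp x := by
  have h := convexOn_exp.2 (Set.mem_univ x) (Set.mem_univ 0) h0 (sub_nonneg.mpr h1)
    (add_sub_cancel t 1)
  simp only [smul_eq_mul, mul_zero, add_zero, Real.exp_zero, mul_one] at h
  linarith

theorem abs_spinIntegral_sub_le {n : ℕ} {C : ℝ} (hC : 0 < C) {U W : ℝ → ℝ → ℝ → ℝ} {η : ℝ → ℝ}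
    (hU : Continuous fun p : ℝ × ℝ × ℝ => U p.1 p.2.1 p.2.2)
    (hW : Continuous fun p : ℝ × ℝ × ℝ => W p.1 p.2.1 p.2.2)
    (h : ∀ y z s, |s| ≤ C → |W y z s - U y z s| ≤ η y) (e : Fin n → ℕ) (v : Mark n) :
    |spinIntegral C W e v - spinIntegral C U e v| ≤
      C ^ (∑ i, e i) * spinIntegral C U 0 v * (Real.exp (∑ i, η (v.1 i)) - 1) := by
  have hη : ∀ y, 0 ≤ η y := fun y =>
    (abs_nonneg _).trans (h y 0 0 (by simpa using hC.le))
  rw [spinIntegral_zero, ← Finset.prod_pow_eq_pow_sum, ← Finset.prod_mul_distrib, Real.exp_sum]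
  unfold spinIntegral
  refine abs_prod_sub_prod_le _ (fun i => ?_) (fun i => Real.one_le_exp (hη _)) fun i => ?_
  · have := continuous_exponent hU (v.1 i) (v.2 i)
    exact abs_integral_pow_mul_le hC _ (by fun_prop) (by fun_prop) fun s _ => (Real.abs_exp _).le
  · have h1 := continuous_exponent hU (v.1 i) (v.2 i)
    have h2 := continuous_exponent hW (v.1 i) (v.2 i)
    rw [← intervalIntegral.integral_sub (Continuous.intervalIntegrable (by fun_prop) _ _)
      (Continuous.intervalIntegrable (by fun_prop) _ _), mul_assoc,
      ← intervalIntegral.integral_mul_const]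
    simp only [← mul_sub]
    refine abs_integral_pow_mul_le hC _ (by fun_prop) (by fun_prop) fun s hs => ?_
    have h3 : Real.exp (W (v.1 i) (v.2 i) s) - Real.exp (U (v.1 i) (v.2 i) s) =
        Real.exp (U (v.1 i) (v.2 i) s) *
          (Real.exp (W (v.1 i) (v.2 i) s - U (v.1 i) (v.2 i) s) - 1) := by
      rw [mul_sub, ← Real.exp_add]
      ring_nf
    rw [h3, abs_mul, Real.abs_exp]
    refine mul_le_mul_of_nonneg_left ((abs_exp_sub_one_le_exp_abs _).trans ?_) (Real.exp_pos _).le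
    linarith [Real.exp_le_exp.mpr (h (v.1 i) (v.2 i) s hs)]

/-! ### Comparison of cascade averages -/

/-- Leaf by leaf the spin integrals differ by at most t exp(∑ η(Y^i)) times the unperturbed one.
Summed over the leaves this is t times the denominator for the exponent η + U, so the error is t
times a Gibbs average of exp(∑ η(Y^i)). -/
theorem abs_cascadeAverage_sub_le {n : ℕ} {β : ℕ → ℝ} {C : ℝ} (hC : 0 < C)
    {U W : ℝ → ℝ → ℝ → ℝ} {η : ℝ → ℝ} {S : FiniteRSB} {ω : Sample n} {t : ℝ} (ht0 : 0 ≤ t)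
    (ht1 : t ≤ 1) (hU : Continuous fun p : ℝ × ℝ × ℝ => U p.1 p.2.1 p.2.2)
    (hW : Continuous fun p : ℝ × ℝ × ℝ => W p.1 p.2.1 p.2.2)
    (h : ∀ y z s, |s| ≤ C → |W y z s - U y z s| ≤ t * η y)
    (hωU : Regular β C U S ω) (hωW : Regular β C W S ω)
    (hωη : Regular β C (fun y z s => η y + U y z s) S ω) (e : Fin n → ℕ) :
    |cascadeAverage β C W S e ω - cascadeAverage β C U S e ω| ≤ C ^ (∑ i, e i) *
      (2 * (t * (∑' α, rawWeight S ω.1 α *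
        spinIntegral C (fun y z s => η y + U y z s) 0 (fieldMark β S ω.2 α)) /
        ∑' α, rawWeight S ω.1 α * spinIntegral C U 0 (fieldMark β S ω.2 α))) := by
  have hdiff : ∀ e' : Fin n → ℕ,
      |∑' α, rawWeight S ω.1 α * spinIntegral C W e' (fieldMark β S ω.2 α) -
        ∑' α, rawWeight S ω.1 α * spinIntegral C U e' (fieldMark β S ω.2 α)| ≤
      C ^ (∑ i, e' i) * (t * ∑' α, rawWeight S ω.1 α *
        spinIntegral C (fun y z s => η y + U y z s) 0 (fieldMark β S ω.2 α)) := by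
    intro e'
    have hs := (hωW.summable hC hW e').sub (hωU.summable hC hU e')
    rw [← (hωW.summable hC hW e').tsum_sub (hωU.summable hC hU e'), ← tsum_mul_left,
      ← tsum_mul_left]
    rw [← Real.norm_eq_abs]
    refine (norm_tsum_le_tsum_norm hs.norm).trans ?_
    refine hs.norm.tsum_le_tsum (fun α => ?_) ((hωη.denominator.mul_left _).mul_left _)
    have hr := rawWeight_pos S hωU.pos α
    rw [spinIntegral_add_fun, Real.norm_eq_abs, ← mul_sub, abs_mul, abs_of_pos hr]
    have h1 := abs_spinIntegral_sub_le (η := fun y => t * η y) hC hU hW h e' (fieldMark β S ω.2 α)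
    rw [← Finset.mul_sum] at h1
    have h2 := exp_mul_sub_one_le ht0 ht1 (∑ i, η ((fieldMark β S ω.2 α).1 i))
    have h3 := spinIntegral_zero_pos hC hU (fieldMark β S ω.2 α)
    calc _ ≤ rawWeight S ω.1 α * (C ^ (∑ i, e' i) * spinIntegral C U 0 (fieldMark β S ω.2 α) *
          (t * Real.exp (∑ i, η ((fieldMark β S ω.2 α).1 i)))) := by
          gcongr
          exact h1.trans (mul_le_mul_of_nonneg_left h2 (by positivity))
      _ = _ := by ring
  rw [hωU.cascadeAverage_eq, hωW.cascadeAverage_eq]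
  refine abs_div_sub_div_le (hωU.tsum_pos hC hU) (hωW.tsum_pos hC hW) ?_ (hdiff e) ?_
  · have := hωW.abs_cascadeAverage_le hC hW e
    rwa [hωW.cascadeAverage_eq, abs_div, abs_of_pos (hωW.tsum_pos hC hW),
      div_le_iff₀ (hωW.tsum_pos hC hW)] at this
  · simpa using hdiff 0

/-- Averages of functions of variables that are independent of the weights. -/
theorem lintegral_average_le {ι X Y Z : Type*} [Countable ι] [MeasurableSpace X]
    [MeasurableSpace Y] [MeasurableSpace Z] (μ : Measure X) (ν : Measure Y) (ρ : Measure Z)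
    [IsProbabilityMeasure μ] [IsProbabilityMeasure ν] [IsProbabilityMeasure ρ]
    {w : X → Z → ι → ℝ≥0∞} {x : Y → ι → ℝ≥0∞}
    (hw : ∀ α, Measurable fun p : X × Z => w p.1 p.2 α) (hx : ∀ α, Measurable fun y => x y α)
    {B : ℝ≥0∞} (hB : ∀ α, ∫⁻ y, x y α ∂ν ≤ B) :
    ∫⁻ ω, (∑' α, w ω.1 ω.2.2 α * x ω.2.1 α) * (∑' α, w ω.1 ω.2.2 α)⁻¹ ∂(μ.prod (ν.prod ρ)) ≤ B := by
  have hm : Measurable fun ω : X × Y × Z =>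
      (∑' α, w ω.1 ω.2.2 α * x ω.2.1 α) * (∑' α, w ω.1 ω.2.2 α)⁻¹ := by
    have h1 : ∀ α, Measurable fun ω : X × Y × Z => w ω.1 ω.2.2 α := fun α =>
      (hw α).comp (measurable_fst.prodMk (measurable_snd.comp measurable_snd))
    exact (Measurable.tsum fun α => (h1 α).mul
      ((hx α).comp (measurable_fst.comp measurable_snd))).mul (Measurable.tsum h1).inv
  rw [lintegral_prod _ hm.aemeasurable]
  refine (lintegral_mono fun E => ?_).trans_eq ((lintegral_const B).trans (by simp))
  refine (lintegral_prod_symm' _ (hm.comp (measurable_prodMk_left (x := E)))).trans_le ?_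
  refine (lintegral_mono fun z => ?_).trans_eq ((lintegral_const B).trans (by simp))
  change ∫⁻ y, (∑' α, w E z α * x y α) * (∑' α, w E z α)⁻¹ ∂ν ≤ B
  rw [lintegral_mul_const _ (Measurable.tsum fun α => (hx α).const_mul _),
    lintegral_tsum fun α => ((hx α).const_mul _).aemeasurable]
  calc _ ≤ (∑' α, w E z α * B) * (∑' α, w E z α)⁻¹ := by
        refine mul_le_mul_left (ENNReal.tsum_le_tsum fun α => ?_) _
        rw [lintegral_const_mul _ (hx α)]
        exact mul_le_mul_right (hB α) _
    _ = B * ((∑' α, w E z α) / ∑' α, w E z α) := by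
        rw [ENNReal.tsum_mul_right, div_eq_mul_inv]
        ring
    -- An inequality only, since the total weight may be 0 or ∞ here.
    _ ≤ B := mul_le_of_le_one_right' ENNReal.div_self_le_one

/-- For exponents that do not involve the fields `Y^i`, the Gibbs weights are independent of
these fields. -/
theorem lintegral_gibbs_exp_le {n : ℕ} {β : ℕ → ℝ}
    (hβ : Summable fun p : ℕ => ((p : ℝ) + 2) * β (p + 2) ^ 2) {C c c' : ℝ} (hC : 0 < C)
    (hc : 0 ≤ c) (S : FiniteRSB) :
    ∫⁻ ω, ENNReal.ofReal ((∑' α, rawWeight S ω.1 α *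
        spinIntegral C (fun y z s => (c * |y| + c') + exponentLim β S y z s) 0
          (fieldMark β S ω.2 α)) /
        ∑' α, rawWeight S ω.1 α * spinIntegral C (exponentLim β S) 0 (fieldMark β S ω.2 α))
      ∂(sampleLaw n) ≤
      ENNReal.ofReal (Real.exp (n * c') * expMomentBound n c (xiDeriv β 1)) := by
  have haU : Admissible C (exponentLim β S) := by
    simpa using admissible_exponentLim_add β C 0 0 S
  have haη := admissible_exponentLim_add β C c c' S
  -- The variables of Y are replaced by 0. Since `exponentLim` ignores its first argument, the value
  -- is unchanged, and the independence of Y becomes visible.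
  set w : (List ℕ → ℝ) → (List ℕ × Fin n → ℝ) → (Fin S.r → ℕ) → ℝ≥0∞ := fun E z α =>
    ENNReal.ofReal (rawWeight S E α *
      spinIntegral C (exponentLim β S) 0 (fieldMark β S (0, z) α)) with hw
  set x : (List ℕ × Fin n → ℝ) → (Fin S.r → ℕ) → ℝ≥0∞ := fun y α =>
    ENNReal.ofReal (Real.exp (∑ i : Fin n, (c * |field S (thetaY β) (fun b => y (b, i)) α| + c')))
    with hx
  set B := ENNReal.ofReal (Real.exp (n * c') * expMomentBound n c (xiDeriv β 1)) with hB
  have hxm : ∀ α, Measurable fun y => x y α := by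
    intro α
    have := fun i => measurable_field S (thetaY β) (n := n) i α
    fun_prop
  have hwm : ∀ α, Measurable fun p : (List ℕ → ℝ) × (List ℕ × Fin n → ℝ) => w p.1 p.2 α := by
    intro α
    refine Measurable.ennreal_ofReal (((measurable_rawWeight S α).comp measurable_fst).mul
      ((continuous_spinIntegral haU.continuous 0).measurable.comp ?_))
    exact (measurable_fieldMark β S α).comp (measurable_const.prodMk measurable_snd)
  have hxB : ∀ α, ∫⁻ y, x y α ∂(Measure.infinitePi fun _ => gaussianReal 0 1) ≤ B := by
    intro α
    have h1 : ∀ y, x y α = ENNReal.ofReal (Real.exp (n * c')) * ENNReal.ofReal (Real.exp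
        (c * ∑ i : Fin n, |field S (thetaY β) (fun b => y (b, i)) α|)) := by
      intro y
      rw [← ENNReal.ofReal_mul (Real.exp_pos _).le, ← Real.exp_add, hx]
      simp only [Finset.sum_add_distrib, ← Finset.mul_sum]
      simp [add_comm]
    rw [lintegral_congr h1, lintegral_const_mul' _ _ ENNReal.ofReal_ne_top, hB,
      ENNReal.ofReal_mul (Real.exp_pos _).le]
    refine mul_le_mul_right ((lintegral_exp_sum_abs_field_le S (thetaY_nonneg β (S.q_mem 0).1)
      (fun p => thetaY_mono hβ (S.q_mem _).1 (S.q_castSucc_le_q_succ p) (S.q_mem _).2) α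
      hc).trans ?_) _
    exact ENNReal.ofReal_le_ofReal (expMomentBound_mono n c (thetaY_le hβ S.qStar_mem))
  calc _ ≤ ∫⁻ ω, (∑' α, w ω.1 ω.2.2 α * x ω.2.1 α) * (∑' α, w ω.1 ω.2.2 α)⁻¹ ∂(sampleLaw n) := by
        refine lintegral_mono_ae ?_
        filter_upwards [ae_regular hβ hC haU S n, ae_regular hβ hC haη S n] with ω hωU hωη
        have hD := hωU.tsum_pos hC haU.continuous
        rw [div_eq_mul_inv, ENNReal.ofReal_mul (tsum_nonneg fun α =>
            (hωη.term_pos hC haη.continuous α).le), ENNReal.ofReal_inv_of_pos hD,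
          ENNReal.ofReal_tsum_of_nonneg (fun α => (hωη.term_pos hC haη.continuous α).le)
            hωη.denominator,
          ENNReal.ofReal_tsum_of_nonneg (fun α => (hωU.term_pos hC haU.continuous α).le)
            hωU.denominator]
        refine (congrArg₂ (· * ·) (tsum_congr fun α => ?_) rfl).le
        rw [spinIntegral_add_fun (fun y => c * |y| + c'), mul_left_comm,
          ENNReal.ofReal_mul (Real.exp_pos _).le, mul_comm]
        rfl
    _ ≤ B := lintegral_average_le _ _ _ hwm hxm hxB

/-! ### The limit of the functionals -/

/-- The distance of `F^{R,C,E}(ζ)` to its limit is at most a constant, uniform over all overlap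
distributions, divided by `√(R² + 1)`. -/
theorem abs_F_sub_FLim_le {n k : ℕ} {β : ℕ → ℝ}
    (hβ : Summable fun p : ℕ => ((p : ℝ) + 2) * β (p + 2) ^ 2) {C : ℝ} (hC : 0 < C)
    (e : Fin k → Fin n → ℕ) (R : ℝ) (S : FiniteRSB) :
    |F β C e R S - FLim β C e S| ≤ (√(R ^ 2 + 1))⁻¹ * (2 * k * (∏ l, C ^ (∑ i, e l i)) *
      (Real.exp (n * (xiDeriv β 1 * C ^ 4 / 4)) * expMomentBound n (C ^ 2 / 2) (xiDeriv β 1))) := by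
  set A := √(R ^ 2 + 1) with hA
  have hA1 : 1 ≤ A := Real.one_le_sqrt.mpr (by nlinarith [sq_nonneg R])
  have hA0 : 0 < A := one_pos.trans_le hA1
  have hc0 := xiDeriv_nonneg β (zero_le_one' ℝ)
  set W : ℝ → ℝ → ℝ → ℝ := fun y z s => exponentPert β A S (y + A * S.shift β) z s with hWdef
  have hW : Admissible C W := by simpa using admissible_exponentPert_add β A 0 C (A * S.shift β) S
  have hU : Admissible C (exponentLim β S) := by
    simpa using admissible_exponentLim_add β C 0 0 S
  have hη := admissible_exponentLim_add β C (C ^ 2 / 2) (xiDeriv β 1 * C ^ 4 / 4) S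
  have hV : Admissible C (exponentR β R S) := by
    have h := admissible_exponentPert_add β A A C 0 S
    simp only [add_zero, hA, ← exponentR_eq] at h
    exact h
  have htilt : F β C e R S = cascadeMoment β C W S e :=
    cascadeMoment_add_linear hβ hC hV (exponentR_eq β R S) (continuous_exponentPert β A S) hW e
  -- The quartic term even has the factor A⁻², which is at most A⁻¹. Its coefficient lies between 0
  -- and ξ'(1) because 0 ≤ q_* ξ'(q_*) ≤ ξ'(1).
  have hdist : ∀ y z s, |s| ≤ C → |W y z s - exponentLim β S y z s| ≤
      A⁻¹ * (C ^ 2 / 2 * |y| + xiDeriv β 1 * C ^ 4 / 4) := by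
    intro y z s hs
    have hq := S.qStar_mem
    have hθ := thetaY_le hβ hq
    have hθ0 := thetaY_nonneg β hq.1
    unfold thetaY at hθ hθ0
    have hs2 : s ^ 2 ≤ C ^ 2 := sq_le_sq' (by linarith [(abs_le.mp hs).1]) (abs_le.mp hs).2
    have hs4 : s ^ 4 ≤ C ^ 4 := by nlinarith [sq_nonneg s]
    have hAinv : A⁻¹ ≤ 1 := inv_le_one_of_one_le₀ hA1
    have hAinv0 : 0 ≤ A⁻¹ := by positivity
    rw [hWdef]
    simp only
    rw [exponentPert_add_shift β hA0.ne', add_sub_cancel_left]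
    have e1 : -y * (s ^ 2 / (2 * A)) = A⁻¹ * (s ^ 2 / 2 * -y) := by
      field_simp
    have e2 : (xiDeriv β 1 - S.qStar * xiDeriv β S.qStar) * s ^ 4 / (4 * A ^ 2) =
        A⁻¹ * (A⁻¹ * ((xiDeriv β 1 - S.qStar * xiDeriv β S.qStar) * s ^ 4 / 4)) := by
      field_simp
    rw [e1, e2, ← mul_add, abs_mul, abs_of_nonneg hAinv0]
    refine mul_le_mul_of_nonneg_left ((abs_add_le _ _).trans (add_le_add ?_ ?_)) hAinv0
    · rw [abs_mul, abs_neg, abs_of_nonneg (by positivity : 0 ≤ s ^ 2 / 2)]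
      gcongr
    · have h0 : 0 ≤ (xiDeriv β 1 - S.qStar * xiDeriv β S.qStar) * s ^ 4 / 4 := by
        have : 0 ≤ xiDeriv β 1 - S.qStar * xiDeriv β S.qStar := by linarith
        positivity
      rw [abs_of_nonneg (mul_nonneg hAinv0 h0)]
      refine (mul_le_of_le_one_left h0 hAinv).trans ?_
      gcongr
      linarith
  have hint : ∀ ω : Sample n, Regular β C (exponentLim β S) S ω → Regular β C W S ω →
      Regular β C (fun y z s => (C ^ 2 / 2 * |y| + xiDeriv β 1 * C ^ 4 / 4) +
        exponentLim β S y z s) S ω →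
      ‖∏ l, cascadeAverage β C W S (e l) ω - ∏ l, cascadeAverage β C (exponentLim β S) S (e l) ω‖ ≤
        (A⁻¹ * (2 * k * ∏ l, C ^ (∑ i, e l i))) * ((∑' α, rawWeight S ω.1 α *
        spinIntegral C (fun y z s => (C ^ 2 / 2 * |y| + xiDeriv β 1 * C ^ 4 / 4) +
          exponentLim β S y z s) 0 (fieldMark β S ω.2 α)) /
        ∑' α, rawWeight S ω.1 α * spinIntegral C (exponentLim β S) 0 (fieldMark β S ω.2 α)) := by
    intro ω h1 h2 h3
    refine (abs_prod_sub_prod_le_card Finset.univ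
      (fun l => h1.abs_cascadeAverage_le hC hU.continuous (e l))
      (fun l => h2.abs_cascadeAverage_le hC hW.continuous (e l))
      fun l => abs_cascadeAverage_sub_le hC (by positivity) (inv_le_one_of_one_le₀ hA1)
        hU.continuous hW.continuous hdist h1 h2 h3 (e l)).trans_eq ?_
    rw [Finset.card_univ, Fintype.card_fin]
    ring
  have hM : 0 ≤ A⁻¹ * (2 * k * ∏ l, C ^ (∑ i, e l i)) := by positivity
  rw [htilt, FLim, cascadeMoment, cascadeMoment,
    ← integral_sub (wellDefined hβ hC hW S e).integrable (wellDefined hβ hC hU S e).integrable,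
    ← Real.norm_eq_abs]
  -- Working with the lower integral avoids a separate proof that the bounding Gibbs average is
  -- integrable.
  refine (norm_integral_le_lintegral_norm _).trans (ENNReal.toReal_le_of_le_ofReal
    (mul_nonneg (by positivity) (mul_nonneg (by positivity) (mul_nonneg (Real.exp_pos _).le
      (expMomentBound_nonneg _ _ _)))) ?_)
  rw [← mul_assoc, ENNReal.ofReal_mul hM]
  refine le_trans ?_ (mul_le_mul_right
    (lintegral_gibbs_exp_le hβ hC (c := C ^ 2 / 2) (by positivity) S) _)
  rw [← lintegral_const_mul' _ _ ENNReal.ofReal_ne_top]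
  refine lintegral_mono_ae ?_
  filter_upwards [ae_regular hβ hC hU S n, ae_regular hβ hC hW S n, ae_regular hβ hC hη S n]
    with ω h1 h2 h3
  rw [← ENNReal.ofReal_mul hM]
  exact ENNReal.ofReal_le_ofReal (hint ω h1 h2 h3)

/-- The bound on the error contains the overlap distribution nowhere, so convergence is uniform over
all finite RSB measures; single measures and sequences are special cases. -/
theorem tendstoUniformly_F {n k : ℕ} {β : ℕ → ℝ}
    (hβ : Summable fun p : ℕ => ((p : ℝ) + 2) * β (p + 2) ^ 2) {C : ℝ} (hC : 0 < C)
    (e : Fin k → Fin n → ℕ) :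
    TendstoUniformly (fun (R : ℝ) (S : FiniteRSB) => F β C e R S) (fun S => FLim β C e S) atTop := by
  rw [Metric.tendstoUniformly_iff]
  intro ε hε
  have h1 : Tendsto (fun R : ℝ => √(R ^ 2 + 1)) atTop atTop :=
    Real.tendsto_sqrt_atTop.comp
      (tendsto_atTop_add_const_right _ _ (tendsto_pow_atTop two_ne_zero))
  have h2 := h1.inv_tendsto_atTop.mul_const (2 * k * (∏ l, C ^ (∑ i, e l i)) *
      (Real.exp (n * (xiDeriv β 1 * C ^ 4 / 4)) * expMomentBound n (C ^ 2 / 2) (xiDeriv β 1)))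
  rw [zero_mul] at h2
  filter_upwards [h2.eventually_lt_const hε] with R hR S
  rw [dist_comm, Real.dist_eq]
  exact (abs_F_sub_FLim_le hβ hC e R S).trans_lt hR

end SphericalCascade

theorem mainTheorem4 (β : ℕ → ℝ)
    (hβ : Summable fun p : ℕ => ((p : ℝ) + 2) * β (p + 2) ^ 2)
    (C : ℝ) (hC : 0 < C) (n k : ℕ) (e : Fin k → Fin n → ℕ) :
    (∀ S : SphericalCascade.FiniteRSB,
      (∀ R : ℝ, SphericalCascade.WellDefined β C (SphericalCascade.exponentR β R S) S e) ∧
      SphericalCascade.WellDefined β C (SphericalCascade.exponentLim β S) S e ∧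
      Tendsto (fun R : ℝ => SphericalCascade.F β C e R S) atTop
        (𝓝 (SphericalCascade.FLim β C e S))) ∧
    (∀ (ζstar : ProbabilityMeasure unitInterval) (S : ℕ → SphericalCascade.FiniteRSB),
      Tendsto (fun i => (S i).ζ) atTop (𝓝 ζstar) →
      TendstoUniformly (fun (R : ℝ) (i : ℕ) => SphericalCascade.F β C e R (S i))
        (fun i : ℕ => SphericalCascade.FLim β C e (S i)) atTop) := by
  have hunif := SphericalCascade.tendstoUniformly_F hβ hC e
  refine ⟨fun S => ⟨fun R => SphericalCascade.wellDefined hβ hC ?_ S e,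
    SphericalCascade.wellDefined hβ hC ?_ S e, hunif.tendsto_at S⟩,
    fun ζstar S _ => hunif.comp S⟩
  · have h := SphericalCascade.admissible_exponentPert_add β (√(R ^ 2 + 1)) (√(R ^ 2 + 1)) C 0 S
    simp only [add_zero, ← SphericalCascade.exponentR_eq] at h
    exact h
  · simpa using SphericalCascade.admissible_exponentLim_add β C 0 0 S
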